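/- Theorem 5.2 (convergence of adaptive Clifford TM expansion). Let $m\ge 1$ and let $\mathscr{A}_m$ be the real Clifford algebra generated by $e_1,\dots,e_m$ with $e_ie_j+e_je_i=-2\delta_{ij}$, with conjugation $x\mapsto\overline{x}$ (the anti-automorphism with $\overline{e_i}=-e_i$) and norm $|x|=(\sum_T x_T^2)^{1/2}$ for $x=\sum_T x_Te_T$. Identify $(x_0,\dots,x_m)\in\mathbb{R}^{m+1}$ with $x_0+\sum_{i=1}^m x_ie_i\in\mathscr{A}_m$, let $B^{m+1}$ be the open unit ball of $\mathbb{R}^{m+1}$, $S^m$ its boundary with surface measure $dS$, and $\omega_m$ the area of $S^m$. The monogenic Hardy space $\mathcal{H}^2(B^{m+1})$ consists of the $C^1$ functions $f:B^{m+1}\to\mathscr{A}_m$ with $\partial_{x_0}f+\sum_{i=1}^m e_i\,\partial_{x_i}f=0$ on $B^{m+1}$ and $$\|f\|:=\sup_{0<r<1}\Big(\frac1{\omega_m}\int_{S^m}|f(r\eta)|^2\,dS(\eta)\Big)^{1/2}<\infty ,$$ with the $\mathscr{A}_m$-valued inner product $\langle f,g\rangle=\frac1{\omega_m}\int_{S^m}\overline{g(\eta)}f(\eta)\,dS(\eta)$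 of the non-tangential boundary limits. For $a\in B^{m+1}$ let $S_a(x)=\overline{1-\overline{a}x}\,/\,|1-\overline{a}x|^{m+1}$ be the Szegő kernel. For $a_1,a_2,\ldots\in B^{m+1}$, a Takenaka–Malmquist (TM) system $B_1,B_2,\dots$ is defined recursively. Given $a_1,\dots,a_{n-1}$ and $B_1,\dots,B_{n-1}$, for $b\in B^{m+1}\setminus\{a_1,\dots,a_{n-1}\}$ put $$T_{a_1,\dots,a_{n-1},b}=S_b-\sum_{i=1}^{n-1}B_i\langle B_i,B_i\rangle^{-1}\langle S_b,B_i\rangle,\qquad B_{a_1,\dots,a_{n-1},b}=\frac{T_{a_1,\dots,a_{n-1},b}}{\|T_{a_1,\dots,a_{n-1},b}\|};$$ for $b\in\{a_1,\dots,a_{n-1}\}$, $B_{a_1,\dots,a_{n-1},b}$ denotes any limit in $\mathcal{H}^2(B^{m+1})$ of functions $B_{a_1,\dots,a_{n-1},b_k}$ with $b_k\in B^{m+1}\setminus\{a_1,\dots,a_{n-1}\}$ and $b_k\to b$ (for example $b_k=b+\rho_k\omega$ with $|\omega|=1$, $\rho_k\to0^+$). Then $B_n$ is $B_{a_1,\dots,a_{n-1},a_n}$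 (one of these limits, if $a_n$ repeats an earlier parameter). Let $f\in\mathcal{H}^2(B^{m+1})$, and let $a_1,a_2,\dots\in B^{m+1}$ with a TM system $B_1,B_2,\dots$ be chosen according to the maximum selection principle, that is, for every $n\ge1$, $$\big\|B_n\langle B_n,B_n\rangle^{-1}\langle f,B_n\rangle\big\|=\sup_{b\in B^{m+1}}\big\|B_{a_1,\dots,a_{n-1},b}\langle B_{a_1,\dots,a_{n-1},b},B_{a_1,\dots,a_{n-1},b}\rangle^{-1}\langle f,B_{a_1,\dots,a_{n-1},b}\rangle\big\| ,$$ where, for $b\in\{a_1,\dots,a_{n-1}\}$, the supremum is also taken over all the limits denoted by $B_{a_1,\dots,a_{n-1},b}$. (Should some $\langle B,B\rangle$ fail to be invertible, the function $B\langle B,B\rangle^{-1}\langle g,B\rangle$ is read as $0$ for every $g$.) Then $$\Big\|\sum_{n=1}^N B_n\langle B_n,B_n\rangle^{-1}\langle f,B_n\rangle-f\Big\|\longrightarrow0\qquad(N\to\infty).$$ -/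

import Mathlib

open Set Filter Topology MeasureTheory
open scoped ENNReal symmDiff

noncomputable section

namespace CliffordTM

/-! ### The real Clifford algebra with `e_i e_j + e_j e_i = -2 δ_ij` -/

/-- The underlying Euclidean space of the real Clifford algebra on `m` generators: an element is
the family of its coefficients `x_T`, for `T` a subset of the index set of the generators
(the coefficient of `e_T = e_{i_1} ⋯ e_{i_l}` for `T = {i_1 < ⋯ < i_l}`), and
`‖x‖ = (∑ T, x_T ^ 2) ^ (1/2)`. The generators `e_1, …, e_m` are indexed by `Fin m`. -/
def Cl (m : ℕ) : Type := EuclideanSpace ℝ (Finset (Fin m))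

namespace Cl

instance (m : ℕ) : NormedAddCommGroup (Cl m) :=
  inferInstanceAs (NormedAddCommGroup (EuclideanSpace ℝ (Finset (Fin m))))

instance (m : ℕ) : InnerProductSpace ℝ (Cl m) :=
  inferInstanceAs (InnerProductSpace ℝ (EuclideanSpace ℝ (Finset (Fin m))))

instance (m : ℕ) : FiniteDimensional ℝ (Cl m) :=
  inferInstanceAs (FiniteDimensional ℝ (EuclideanSpace ℝ (Finset (Fin m))))

/-- The coefficient `x_T`. -/
def coeff {m : ℕ} (x : Cl m) (T : Finset (Fin m)) : ℝ := WithLp.ofLp x T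

/-- The element with prescribed coefficients. -/
def ofCoeff {m : ℕ} (c : Finset (Fin m) → ℝ) : Cl m := WithLp.toLp 2 c

@[simp] theorem coeff_ofCoeff {m : ℕ} (c : Finset (Fin m) → ℝ) (T : Finset (Fin m)) :
    (ofCoeff c).coeff T = c T := rfl

@[ext] theorem ext {m : ℕ} {x y : Cl m} (h : ∀ T, x.coeff T = y.coeff T) : x = y :=
  (WithLp.ofLp_injective 2) (funext h)

@[simp] theorem coeff_zero {m : ℕ} (T : Finset (Fin m)) : (0 : Cl m).coeff T = 0 := rfl

@[simp] theorem coeff_add {m : ℕ} (x y : Cl m) (T : Finset (Fin m)) :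
    (x + y).coeff T = x.coeff T + y.coeff T := rfl

@[simp] theorem coeff_smul {m : ℕ} (r : ℝ) (x : Cl m) (T : Finset (Fin m)) :
    (r • x).coeff T = r * x.coeff T := rfl

/-- The sign in `e_A e_B = sgn A B • e_{A ∆ B}`:
`(-1) ^ #(A ∩ B) * (-1) ^ p(A, B)` with `p(A, B) = ∑ j ∈ B, #{i ∈ A | i > j}`. -/
def sgn {m : ℕ} (A B : Finset (Fin m)) : ℝ :=
  (-1) ^ (A ∩ B).card * (-1) ^ (∑ j ∈ B, (A.filter fun i => j < i).card)

/-- The bilinear product with `e_A e_B = sgn A B • e_{A ∆ B}`; the coefficient at `T` collects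
the pairs `(A, B)` with `A ∆ B = T`, that is `B = A ∆ T`. -/
instance (m : ℕ) : Mul (Cl m) :=
  ⟨fun x y => ofCoeff fun T => ∑ A, sgn A (A ∆ T) * x.coeff A * y.coeff (A ∆ T)⟩

/-- The unit `e_∅`. -/
instance (m : ℕ) : One (Cl m) := ⟨ofCoeff fun T => if T = ∅ then 1 else 0⟩

theorem coeff_mul {m : ℕ} (x y : Cl m) (T : Finset (Fin m)) :
    (x * y).coeff T = ∑ A, sgn A (A ∆ T) * x.coeff A * y.coeff (A ∆ T) := rfl

theorem coeff_one {m : ℕ} (T : Finset (Fin m)) :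
    (1 : Cl m).coeff T = if T = ∅ then 1 else 0 := rfl

theorem sgn_eq_prod {m : ℕ} (A B : Finset (Fin m)) :
    sgn A B = ∏ i ∈ A, ∏ j ∈ B, (if j ≤ i then (-1 : ℝ) else 1) := by
  have h1 : ((-1 : ℝ)) ^ (A ∩ B).card = ∏ j ∈ B, ∏ i ∈ A, (if i = j then (-1 : ℝ) else 1) := by
    have : ∀ j ∈ B, (∏ i ∈ A, (if i = j then (-1 : ℝ) else 1)) = if j ∈ A then -1 else 1 := by
      intro j _
      rw [Finset.prod_ite_eq']
    rw [Finset.prod_congr rfl this, Finset.prod_ite]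
    simp [Finset.filter_mem_eq_inter, Finset.inter_comm]
  have h2 : ((-1 : ℝ)) ^ (∑ j ∈ B, (A.filter fun i => j < i).card)
      = ∏ j ∈ B, ∏ i ∈ A, (if j < i then (-1 : ℝ) else 1) := by
    rw [← Finset.prod_pow_eq_pow_sum]
    refine Finset.prod_congr rfl fun j _ => ?_
    rw [Finset.prod_ite]
    simp
  rw [sgn, h1, h2, ← Finset.prod_mul_distrib, Finset.prod_comm (s := A)]
  refine Finset.prod_congr rfl fun j _ => ?_
  rw [← Finset.prod_mul_distrib]
  refine Finset.prod_congr rfl fun i _ => ?_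
  rcases lt_trichotomy i j with h | h | h
  · simp [h.ne, h.not_gt, h.not_ge]
  · simp [h]
  · simp [h.ne', h, h.le]

theorem prod_symmDiff {m : ℕ} (g : Fin m → ℝ) (hg : ∀ i, g i * g i = 1) (A B : Finset (Fin m)) :
    ∏ i ∈ A ∆ B, g i = (∏ i ∈ A, g i) * ∏ i ∈ B, g i := by
  have hA : ∏ i ∈ A, g i = (∏ i ∈ A \ B, g i) * ∏ i ∈ A ∩ B, g i := by
    rw [mul_comm, Finset.prod_inter_mul_prod_sdiff]
  have hB : ∏ i ∈ B, g i = (∏ i ∈ B \ A, g i) * ∏ i ∈ A ∩ B, g i := by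
    rw [mul_comm, Finset.inter_comm, Finset.prod_inter_mul_prod_sdiff]
  have hI : (∏ i ∈ A ∩ B, g i) * ∏ i ∈ A ∩ B, g i = 1 := by
    rw [← Finset.prod_mul_distrib]
    exact Finset.prod_eq_one fun i _ => hg i
  have hS : ∏ i ∈ A ∆ B, g i = (∏ i ∈ A \ B, g i) * ∏ i ∈ B \ A, g i := by
    rw [show A ∆ B = (A \ B) ∪ (B \ A) from rfl]
    exact Finset.prod_union (disjoint_sdiff_sdiff)
  rw [hS, hA, hB]
  linear_combination (-(∏ i ∈ A \ B, g i) * ∏ i ∈ B \ A, g i) * hI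

theorem sgn_symmDiff_left {m : ℕ} (A B C : Finset (Fin m)) :
    sgn (A ∆ B) C = sgn A C * sgn B C := by
  simp only [sgn_eq_prod]
  refine prod_symmDiff _ (fun i => ?_) A B
  rw [← Finset.prod_mul_distrib]
  refine Finset.prod_eq_one fun j _ => ?_
  split_ifs <;> norm_num

theorem sgn_symmDiff_right {m : ℕ} (A B C : Finset (Fin m)) :
    sgn A (B ∆ C) = sgn A B * sgn A C := by
  simp only [sgn_eq_prod]
  rw [← Finset.prod_mul_distrib]
  refine Finset.prod_congr rfl fun i _ => ?_
  refine prod_symmDiff _ (fun j => ?_) B C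
  split_ifs <;> norm_num

theorem mul_assoc_aux {m : ℕ} (x y z : Cl m) : x * y * z = x * (y * z) := by
  ext T
  simp only [coeff_mul, Finset.sum_mul, Finset.mul_sum]
  rw [Finset.sum_comm]
  refine Finset.sum_congr rfl fun A _ => ?_
  refine Fintype.sum_equiv (Equiv.ofBijective (fun C => A ∆ C)
    (Function.Involutive.bijective fun C => symmDiff_symmDiff_cancel_left A C)) _ _ fun C => ?_
  have h1 : A ∆ C ∆ (A ∆ T) = C ∆ T := by
    rw [symmDiff_comm A C, symmDiff_assoc, symmDiff_symmDiff_cancel_left]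
  have hT : A ∆ T = (A ∆ C) ∆ (C ∆ T) := by
    rw [symmDiff_assoc, symmDiff_symmDiff_cancel_left]
  have hs : sgn A (A ∆ C) * sgn C (C ∆ T) = sgn A (A ∆ T) * sgn (A ∆ C) (C ∆ T) := by
    rw [hT, sgn_symmDiff_right A (A ∆ C), sgn_symmDiff_left A C (C ∆ T)]
    have : sgn A (C ∆ T) * sgn A (C ∆ T) = 1 := by
      simp only [sgn]
      rw [mul_mul_mul_comm, ← mul_pow, ← mul_pow]
      simp
    linear_combination (-(sgn A (A ∆ C) * sgn C (C ∆ T))) * this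
  simp only [Equiv.ofBijective_apply, h1]
  linear_combination (x.coeff A * y.coeff (A ∆ C) * z.coeff (C ∆ T)) * hs

instance (m : ℕ) : Ring (Cl m) :=
  { (inferInstance : AddCommGroup (Cl m)) with
    mul := (· * ·)
    one := 1
    mul_assoc := mul_assoc_aux
    one_mul := fun x => by
      ext T
      have h : (∅ : Finset (Fin m)) ∆ T = T := bot_symmDiff T
      simp [coeff_mul, coeff_one, sgn, h]
    mul_one := fun x => by
      ext T
      rw [coeff_mul, Finset.sum_eq_single T]
      · simp [coeff_one, sgn]
      · intro A _ hA
        have h : A ∆ T ≠ ∅ := fun h => hA (symmDiff_eq_bot.mp h)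
        rw [coeff_one, if_neg h, mul_zero]
      · simp
    left_distrib := fun x y z => by
      ext T
      simp only [coeff_mul, coeff_add, mul_add, Finset.sum_add_distrib]
    right_distrib := fun x y z => by
      ext T
      simp only [coeff_mul, coeff_add, mul_add, add_mul, Finset.sum_add_distrib]
    zero_mul := fun x => by
      ext T
      simp [coeff_mul]
    mul_zero := fun x => by
      ext T
      simp [coeff_mul] }

/-- The generator `e_i`. -/
def gen {m : ℕ} (i : Fin m) : Cl m := ofCoeff fun T => if T = {i} then 1 else 0

/-- The conjugation: the linear map with
`e_T ↦ (-e_{i_l}) ⋯ (-e_{i_1}) = (-1) ^ (l (l + 1) / 2) e_T` for `T = {i_1 < ⋯ < i_l}`. -/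
def conj {m : ℕ} (x : Cl m) : Cl m :=
  ofCoeff fun T => (-1) ^ (T.card * (T.card + 1) / 2) * x.coeff T

end Cl

/-! ### Monogenic functions and the Hardy space of the unit ball -/

/-- The space `ℝ^{m+1}` of vectors `x = (x_0, …, x_m)`. -/
abbrev E (m : ℕ) : Type := EuclideanSpace ℝ (Fin (m + 1))

/-- The embedding of `ℝ^{m+1}` in the Clifford algebra, `x = x_0 + x_1 e_1 + ⋯ + x_m e_m`. -/
def toCl {m : ℕ} (x : E m) : Cl m := x 0 • (1 : Cl m) + ∑ i : Fin m, x i.succ • Cl.gen i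

/-- The open unit ball `B^{m+1}`. -/
def unitBall (m : ℕ) : Set (E m) := Metric.ball 0 1

/-- The generalized Cauchy–Riemann (Dirac) operator `D f = ∑_{i=0}^m e_i ∂f/∂x_i`, `e_0 = 1`. -/
def dirac {m : ℕ} (f : E m → Cl m) (x : E m) : Cl m :=
  ∑ i : Fin (m + 1),
    toCl (EuclideanSpace.single i 1) * fderiv ℝ f x (EuclideanSpace.single i 1)

/-- `f` is left monogenic on the open set `Ω`. -/
def IsLeftMonogenicOn {m : ℕ} (f : E m → Cl m) (Ω : Set (E m)) : Prop :=
  ContDiffOn ℝ 1 f Ω ∧ ∀ x ∈ Ω, dirac f x = 0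

/-- The surface measure of the unit sphere `S^m`, divided by the area `ω_m` of the sphere. -/
def sphereMeasure (m : ℕ) : Measure (Metric.sphere (0 : E m) 1) :=
  ((volume : Measure (E m)).toSphere univ)⁻¹ • (volume : Measure (E m)).toSphere

/-- The Hardy norm
`‖f‖ = sup_{0 < r < 1} (1/ω_m ∫_{S^m} |f(rη)|² dS) ^ (1/2)`, possibly infinite. -/
def hardyNorm {m : ℕ} (f : E m → Cl m) : ℝ≥0∞ :=
  ⨆ r ∈ Ioo (0 : ℝ) 1,
    eLpNorm (fun η : Metric.sphere (0 : E m) 1 => f (r • (η : E m))) 2 (sphereMeasure m)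

/-- `f` belongs to the monogenic Hardy space `H²(B^{m+1})`. Elements are represented by functions
on `ℝ^{m+1}`, of which only the restriction to the unit ball is ever used. -/
def MemHardy {m : ℕ} (f : E m → Cl m) : Prop :=
  IsLeftMonogenicOn f (unitBall m) ∧ hardyNorm f < ∞

/-- The non-tangential approach region of aperture `α` in the unit ball with vertex `η`. -/
def approachRegion {m : ℕ} (α : ℝ) (η : E m) : Set (E m) :=
  {x | ‖x‖ < 1 ∧ ‖x - η‖ < α * (1 - ‖x‖)}

/-- `v` is the non-tangential limit of `f` at the boundary point `η`. -/
def HasNontangentialLimit {m : ℕ} (f : E m → Cl m) (η : E m) (v : Cl m) : Prop :=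
  ∀ α : ℝ, 1 < α → Tendsto f (𝓝[approachRegion α η] η) (𝓝 v)

open Classical in
/-- The non-tangential boundary limit of `f` at `η` (`0` at the points where there is none). -/
def boundaryValue {m : ℕ} (f : E m → Cl m) (η : E m) : Cl m :=
  if h : ∃ v, HasNontangentialLimit f η v then h.choose else 0

/-- The Clifford-valued inner product `⟨f, g⟩ = 1/ω_m ∫_{S^m} conj (g(η)) f(η) dS` of the
non-tangential boundary limits. -/
def hardyInner {m : ℕ} (f g : E m → Cl m) : Cl m :=
  ∫ η : Metric.sphere (0 : E m) 1,
    Cl.conj (boundaryValue g (η : E m)) * boundaryValue f (η : E m) ∂(sphereMeasure m)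

/-! ### Takenaka–Malmquist systems -/

/-- The Szegő kernel `S_a(x) = conj (1 - conj a * x) / |1 - conj a * x| ^ (m + 1)`. -/
def szego {m : ℕ} (a x : E m) : Cl m :=
  (‖1 - Cl.conj (toCl a) * toCl x‖ ^ (m + 1))⁻¹ • Cl.conj (1 - Cl.conj (toCl a) * toCl x)

/-- The function `β ⟨β, β⟩⁻¹ ⟨f, β⟩`. -/
def component {m : ℕ} (β f : E m → Cl m) : E m → Cl m :=
  fun x => β x * (Ring.inverse (hardyInner β β) * hardyInner f β)

/-- The Gram–Schmidt step `S_b - ∑_{i<n} B_i ⟨B_i, B_i⟩⁻¹ ⟨S_b, B_i⟩`. -/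
def gramSchmidt {m : ℕ} (B : ℕ → E m → Cl m) (n : ℕ) (b : E m) : E m → Cl m :=
  fun x => szego b x - ∑ i ∈ Finset.range n, component (B i) (szego b) x

/-- The normalized Gram–Schmidt step `T / ‖T‖`. -/
def normalizedStep {m : ℕ} (B : ℕ → E m → Cl m) (n : ℕ) (b : E m) : E m → Cl m :=
  fun x => (hardyNorm (gramSchmidt B n b)).toReal⁻¹ • gramSchmidt B n b x

/-- The points of the unit ball that differ from the parameters `a_i`, `i < n`. -/
def freshPoints {m : ℕ} (a : ℕ → E m) (n : ℕ) : Set (E m) :=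
  {b | b ∈ unitBall m ∧ ∀ i < n, b ≠ a i}

/-- `β` is a function `B_{a_0, …, a_{n-1}, b}` that continues the system `B_0, …, B_{n-1}` with
parameters `a_0, …, a_{n-1}` by the parameter `b`: the normalized Gram–Schmidt step if `b` is a
new point; and if `b` repeats an earlier parameter, a limit in the Hardy space of the functions
`B_{a_0, …, a_{n-1}, b'}` as the new point `b'` tends to `b`. The limit may depend on the way in
which `b'` approaches `b`, in particular on the direction `ω` when `b' = b + ρ ω`, `ρ → 0+`;
all such limits are allowed. -/
def IsContinuation {m : ℕ} (a : ℕ → E m) (B : ℕ → E m → Cl m) (n : ℕ) (b : E m)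
    (β : E m → Cl m) : Prop :=
  (b ∈ freshPoints a n ∧ EqOn β (normalizedStep B n b) (unitBall m)) ∨
  ((b ∈ unitBall m ∧ ∃ i < n, b = a i) ∧ MemHardy β ∧
    ∃ s : ℕ → E m, (∀ k, s k ∈ freshPoints a n) ∧ Tendsto s atTop (𝓝 b) ∧
      Tendsto (fun k => hardyNorm fun x => normalizedStep B n (s k) x - β x) atTop (𝓝 0))

/-- `B` is a Takenaka–Malmquist system with parameters `a` in the unit ball. -/
def IsTMSystem {m : ℕ} (a : ℕ → E m) (B : ℕ → E m → Cl m) : Prop :=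
  ∀ n, IsContinuation a B n (a n) (B n)

/-- The maximum selection principle: at every step `n` the choice of the parameter `a n` (and of
the function `B n` belonging to it) maximizes
`‖B_{a_0, …, a_{n-1}, b} ⟨B_{a_0, …, a_{n-1}, b}, B_{a_0, …, a_{n-1}, b}⟩⁻¹ ⟨f, B_{a_0, …, a_{n-1}, b}⟩‖`
over all parameters `b` in the unit ball. -/
def MaximumSelection {m : ℕ} (f : E m → Cl m) (a : ℕ → E m) (B : ℕ → E m → Cl m) : Prop :=
  ∀ n, ∀ b ∈ unitBall m, ∀ β, IsContinuation a B n b β →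
    hardyNorm (component β f) ≤ hardyNorm (component (B n) f)

end CliffordTM

end

/-! Let R_n (`residual`) be the remainder of f after n terms. Members of the system with invertible
square are mutually orthogonal, and the other components are 0 by convention. By Pythagoras
(`hardyNorm_residual_sq`) the norms of R_n decrease, so R_n is a Cauchy sequence and the norms of
the successive components tend to 0 (`IsTMSystem.residual_cauchy`, `IsTMSystem.tendsto_component`).
It remains to see that R_n tends to 0 pointwise on a dense set (`tendsto_hardyNorm_zero`).

Let T_b be the Gram–Schmidt step at b and β = T_b / ‖T_b‖. Since R_n is orthogonal to the invertible
members already chosen, the reproducing property gives ⟨R_n, β⟩ = R_n(b) / ‖T_b‖. If ⟨β, β⟩ is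
invertible, this number is also the inner product with β of the component of f along β.
Cauchy–Schwarz, ‖T_b‖ ≤ ‖S_b‖ and the maximum selection principle then bound |R_n(b)| by C ‖S_b‖
times the norm of the n-th selected component, which tends to 0
(`IsTMSystem.norm_residual_apply_le`).

The Clifford difficulty is that ⟨β, β⟩ may be a nonzero zero divisor. It is invertible as soon as
⟨β, g⟩ is invertible for one Hardy function g (`isUnit_hardyInner_self`). A suitable g is q(x_0 +
e_l x_l), where q is a complex polynomial vanishing to high order at the complex coordinates of the
earlier parameters. High order makes g orthogonal even to the limit functions attached to repeated
parameters (`IsTMSystem.exists_hardyInner_planePoly_eq_zero`), so ⟨g, T_b⟩ = g(b). This is a nonzero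
element of a copy of ℂ, hence a unit, whenever b_0 differs from the zeroth coordinate of every
parameter (`IsTMSystem.generic`); such b are dense.

The analytic groundwork is the theory of the Hardy space. Integration by parts against radial
cutoffs gives the Cauchy and Poisson formulas on spheres (`cauchy_formula`, `poisson_formula`).
Self-adjointness of the Poisson operators makes the dilates of f converge in L² of the sphere
(`exists_tendsto_dilateLp`). Fatou's theorem (`boundaryValue_ae_eq`) identifies the limit with the
nontangential boundary values, and the Szegő kernel reproduces (`hardyInner_szego`). -/

noncomputable section

namespace CliffordTM

/-! ### Clifford algebra: bounded product, conjugation and inner product. -/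

namespace Cl

variable {m : ℕ}

instance : IsScalarTower ℝ (Cl m) (Cl m) := ⟨fun r x y => by
  ext T
  simp only [smul_eq_mul, coeff_mul, coeff_smul, Finset.mul_sum]
  exact Finset.sum_congr rfl fun A _ => by ring⟩

instance : SMulCommClass ℝ (Cl m) (Cl m) := ⟨fun r x y => by
  ext T
  simp only [smul_eq_mul, coeff_mul, coeff_smul, Finset.mul_sum]
  exact Finset.sum_congr rfl fun A _ => by ring⟩

instance : Algebra ℝ (Cl m) := Algebra.ofModule (fun r x y => smul_mul_assoc r x y)
  (fun r x y => mul_smul_comm r x y)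

instance : Nontrivial (Cl m) := ⟨⟨1, 0, fun h => by
  have := congrArg (fun x => coeff x ∅) h
  simp [coeff_one] at this⟩⟩

/-- The product as a continuous bilinear map. -/
def mulL (m : ℕ) : Cl m →L[ℝ] Cl m →L[ℝ] Cl m :=
  LinearMap.toContinuousLinearMap
    ((LinearMap.toContinuousLinearMap : (Cl m →ₗ[ℝ] Cl m) ≃ₗ[ℝ] (Cl m →L[ℝ] Cl m)).toLinearMap ∘ₗ
      LinearMap.mul ℝ (Cl m))

@[simp] theorem mulL_apply (x y : Cl m) : mulL m x y = x * y := rfl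

/-- A constant bounding the product. -/
def mulBound (m : ℕ) : ℝ := ‖mulL m‖

theorem mulBound_nonneg : 0 ≤ mulBound m := norm_nonneg (mulL m)

theorem norm_mul_le_mulBound (x y : Cl m) : ‖x * y‖ ≤ mulBound m * ‖x‖ * ‖y‖ :=
  (mulL m).le_opNorm₂ x y

instance : ContinuousMul (Cl m) := ⟨(mulL m).continuous₂⟩

/-- Expressing the sign of the conjugation through `sgn` reduces identities about conjugates to the
bimultiplicativity of `sgn`. -/
theorem sgn_self (A : Finset (Fin m)) : sgn A A = (-1) ^ (A.card * (A.card + 1) / 2) := by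
  have key : ∀ A : Finset (Fin m), ∑ j ∈ A, (A.filter fun i => j < i).card
      = A.card * (A.card - 1) / 2 := by
    intro A
    induction A using Finset.induction_on_max with
    | empty => simp
    | insert a s hs ih =>
      have ha : a ∉ s := fun h => lt_irrefl _ (hs a h)
      rw [Finset.sum_insert ha, Finset.card_insert_of_notMem ha]
      have h1 : ((insert a s).filter fun i => a < i) = ∅ := by
        ext i
        simp only [Finset.mem_filter, Finset.mem_insert, Finset.notMem_empty, iff_false, not_and,
          not_lt]
        rintro (rfl | h)
        · exact le_rfl
        · exact (hs i h).le
      have h2 : ∀ j ∈ s, ((insert a s).filter fun i => j < i).card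
          = (s.filter fun i => j < i).card + 1 := by
        intro j hj
        rw [Finset.filter_insert, if_pos (hs j hj), Finset.card_insert_of_notMem]
        simp [ha]
      rw [h1, Finset.sum_congr rfl h2, Finset.sum_add_distrib, ih]
      simp only [Finset.card_empty, Finset.sum_const, smul_eq_mul, mul_one, zero_add,
        Nat.add_sub_cancel]
      rcases s.card with _ | k
      · rfl
      · simp only [Nat.add_sub_cancel]
        rw [show (k + 1 + 1) * (k + 1) = (k + 1) * k + (k + 1) * 2 by ring,
          Nat.add_mul_div_right _ _ (by norm_num)]
  rw [sgn, key, Finset.inter_self, ← pow_add]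
  congr 1
  rcases A.card with _ | k
  · rfl
  · simp only [Nat.add_sub_cancel]
    rw [show (k + 1) * (k + 1 + 1) = (k + 1) * k + (k + 1) * 2 by ring,
      Nat.add_mul_div_right _ _ (by norm_num), add_comm]

theorem sgn_mul_self (A B : Finset (Fin m)) : sgn A B * sgn A B = 1 := by
  simp only [sgn]
  rw [mul_mul_mul_comm, ← mul_pow, ← mul_pow]
  simp

theorem coeff_conj (x : Cl m) (T : Finset (Fin m)) : (conj x).coeff T = sgn T T * x.coeff T := by
  rw [sgn_self]; rfl

theorem conj_conj (x : Cl m) : conj (conj x) = x := by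
  ext T
  rw [coeff_conj, coeff_conj, ← mul_assoc, sgn_mul_self, one_mul]

@[simp] theorem conj_add (x y : Cl m) : conj (x + y) = conj x + conj y := by
  ext T
  simp only [coeff_conj, coeff_add, mul_add]

@[simp] theorem conj_smul (r : ℝ) (x : Cl m) : conj (r • x) = r • conj x := by
  ext T
  simp only [coeff_conj, coeff_smul]
  ring

/-- Both sides are matched by the reindexing A ↦ T ∆ A. With C = A ∆ T the signs agree by
bimultiplicativity and `sgn A C` squared being 1. -/
theorem conj_mul (x y : Cl m) : conj (x * y) = conj y * conj x := by
  ext T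
  simp only [coeff_conj, coeff_mul, Finset.mul_sum]
  refine Fintype.sum_equiv (Equiv.ofBijective (fun C => T ∆ C)
    (Function.Involutive.bijective fun C => symmDiff_symmDiff_cancel_left T C)) _ _ fun A => ?_
  have h1 : T ∆ A ∆ T = A := by rw [symmDiff_comm T A, symmDiff_symmDiff_cancel_right]
  have hs : sgn T T * sgn A (A ∆ T)
      = sgn (A ∆ T) A * sgn (A ∆ T) (A ∆ T) * sgn A A := by
    have hT : T = A ∆ (A ∆ T) := (symmDiff_symmDiff_cancel_left A T).symm
    generalize A ∆ T = C at hT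
    subst hT
    simp only [sgn_symmDiff_left, sgn_symmDiff_right]
    linear_combination (sgn C A * sgn C C * sgn A A) * sgn_mul_self A C
  rw [Equiv.ofBijective_apply, h1, symmDiff_comm T A]
  linear_combination (x.coeff A * y.coeff (A ∆ T)) * hs

/-- The conjugation as a continuous linear map. -/
def conjL (m : ℕ) : Cl m →L[ℝ] Cl m :=
  LinearMap.toContinuousLinearMap
    { toFun := conj, map_add' := conj_add, map_smul' := conj_smul }

@[simp] theorem conjL_apply (x : Cl m) : conjL m x = conj x := rfl

@[simp] theorem conj_zero : conj (0 : Cl m) = 0 := (conjL m).map_zero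
@[simp] theorem conj_sub (x y : Cl m) : conj (x - y) = conj x - conj y := (conjL m).map_sub x y
@[simp] theorem conj_sum {ι : Type*} (s : Finset ι) (x : ι → Cl m) :
    conj (∑ i ∈ s, x i) = ∑ i ∈ s, conj (x i) := map_sum (conjL m) x s
@[simp] theorem conj_one : conj (1 : Cl m) = 1 := by
  ext T
  rw [coeff_conj, coeff_one]
  split_ifs with h
  · subst h; simp [sgn]
  · simp

@[fun_prop] theorem continuous_conj : Continuous (conj : Cl m → Cl m) := (conjL m).continuous

theorem inner_eq_sum (x y : Cl m) : inner ℝ x y = ∑ T, x.coeff T * y.coeff T := by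
  rw [show inner ℝ x y = ∑ T, inner ℝ (x.coeff T) (y.coeff T) from PiLp.inner_apply _ _]
  exact Finset.sum_congr rfl fun T _ => by simp [mul_comm]

/-- Only equal indices contribute at ∅. This identity turns Clifford-valued inner products into real
ones by taking scalar parts. -/
theorem coeff_empty_conj_mul (x y : Cl m) : (conj x * y).coeff ∅ = inner ℝ x y := by
  rw [inner_eq_sum, coeff_mul]
  refine Finset.sum_congr rfl fun A _ => ?_
  rw [coeff_conj, show A ∆ ∅ = A from symmDiff_bot A]
  linear_combination (x.coeff A * y.coeff A) * sgn_mul_self A A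

theorem norm_conj (x : Cl m) : ‖conj x‖ = ‖x‖ := by
  have h : ‖conj x‖ ^ 2 = ‖x‖ ^ 2 := by
    rw [← real_inner_self_eq_norm_sq, ← real_inner_self_eq_norm_sq, inner_eq_sum, inner_eq_sum]
    refine Finset.sum_congr rfl fun T _ => ?_
    rw [coeff_conj]
    linear_combination (x.coeff T * x.coeff T) * sgn_mul_self T T
  exact (pow_left_inj₀ (norm_nonneg _) (norm_nonneg _) two_ne_zero).1 h

/-- Left multiplication by x has left multiplication by the conjugate of x as its adjoint;
`inner_mul_right_conj` is the right-handed version. -/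
theorem inner_mul_left (x y z : Cl m) : inner ℝ (x * y) z = inner ℝ y (conj x * z) := by
  rw [← coeff_empty_conj_mul, ← coeff_empty_conj_mul, conj_mul, mul_assoc]

theorem coeff_empty_mul_comm (x y : Cl m) : (x * y).coeff ∅ = (y * x).coeff ∅ := by
  simp only [coeff_mul, show ∀ A : Finset (Fin m), A ∆ ∅ = A from symmDiff_bot]
  exact Finset.sum_congr rfl fun A _ => by ring

theorem inner_mul_right_conj (x y z : Cl m) : inner ℝ (x * y) z = inner ℝ x (z * conj y) := by
  rw [← coeff_empty_conj_mul, ← coeff_empty_conj_mul, conj_mul, mul_assoc, coeff_empty_mul_comm,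
    mul_assoc]

theorem gen_mul_gen (i j : Fin m) :
    (gen i : Cl m) * gen j = sgn {i} {j} • ofCoeff fun T => if T = {i} ∆ {j} then 1 else 0 := by
  ext T
  rw [coeff_mul, Finset.sum_eq_single {i}]
  · have h : ({i} : Finset (Fin m)) ∆ T = {j} ↔ T = {i} ∆ {j} := by
      constructor
      · intro h; rw [← h, symmDiff_symmDiff_cancel_left]
      · intro h; rw [h, symmDiff_symmDiff_cancel_left]
    by_cases h1 : T = {i} ∆ {j}
    · simp [gen, h1]
    · simp [gen, h1, mt h.1 h1]
  · intro A _ hA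
    simp [gen, hA]
  · simp

theorem gen_mul_self (i : Fin m) : (gen i : Cl m) * gen i = -1 := by
  ext T
  rw [gen_mul_gen]
  have h0 : (-1 : Cl m) = (-1 : ℝ) • (1 : Cl m) := by simp
  rw [h0, coeff_smul, coeff_smul, coeff_one, coeff_ofCoeff,
    show ({i} : Finset (Fin m)) ∆ {i} = ∅ from symmDiff_self _]
  simp [sgn_eq_prod]

theorem gen_anticomm {i j : Fin m} (h : i ≠ j) : (gen i : Cl m) * gen j = -(gen j * gen i) := by
  rw [gen_mul_gen, gen_mul_gen, symmDiff_comm ({j} : Finset (Fin m)) {i}, ← neg_smul]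
  congr 1
  simp only [sgn_eq_prod, Finset.prod_singleton]
  rcases lt_or_gt_of_ne h with h | h
  · simp [h.not_ge, h.le]
  · simp [h.not_ge, h.le]

theorem conj_gen (i : Fin m) : conj (gen i : Cl m) = -gen i := by
  ext T
  have h0 : (-gen i : Cl m) = (-1 : ℝ) • gen i := by simp
  rw [h0, coeff_conj, coeff_smul]
  simp only [gen, coeff_ofCoeff]
  split_ifs with h
  · subst h; simp [sgn_eq_prod]
  · simp

end Cl

/-! ### Paravectors and their multiplicative norm. -/

variable {m : ℕ}

/-- The embedding of paravectors as a continuous linear map. -/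
def toClL (m : ℕ) : E m →L[ℝ] Cl m :=
  LinearMap.toContinuousLinearMap
    { toFun := toCl
      map_add' := fun x y => by
        simp only [toCl, PiLp.add_apply, add_smul, Finset.sum_add_distrib]
        abel
      map_smul' := fun r x => by
        simp only [toCl, PiLp.smul_apply, smul_eq_mul, mul_smul, smul_add, Finset.smul_sum,
          RingHom.id_apply] }

@[simp] theorem toClL_apply (x : E m) : toClL m x = toCl x := rfl

@[fun_prop] theorem continuous_toCl : Continuous (toCl : E m → Cl m) := (toClL m).continuous

@[simp] theorem toCl_zero : toCl (0 : E m) = 0 := (toClL m).map_zero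
theorem toCl_sub (x y : E m) : toCl (x - y) = toCl x - toCl y := (toClL m).map_sub x y
theorem toCl_smul (r : ℝ) (x : E m) : toCl (r • x) = r • toCl x := (toClL m).map_smul r x

/-- The basis vector `e_i` of `ℝ^{m+1}`. -/
abbrev basisVec (i : Fin (m + 1)) : E m := EuclideanSpace.single i 1

theorem toCl_basisVec_zero : toCl (basisVec (0 : Fin (m + 1))) = 1 := by
  simp [toCl]

theorem toCl_basisVec_succ (i : Fin m) : toCl (basisVec i.succ) = Cl.gen i := by
  simp [toCl]

theorem sum_smul_basisVec (x : E m) : ∑ i, x i • basisVec i = x := by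
  ext j
  simp [basisVec, Pi.single_apply]

theorem toCl_eq_sum (x : E m) : toCl x = ∑ i, x i • toCl (basisVec i) := by
  conv_lhs => rw [← sum_smul_basisVec x, ← toClL_apply, map_sum]
  simp

/-- By bilinearity this need only be checked on basis vectors, where it amounts to the defining
anticommutation relations. -/
theorem conj_toCl_mul_add (x y : E m) :
    Cl.conj (toCl x) * toCl y + Cl.conj (toCl y) * toCl x = (2 * inner ℝ x y) • (1 : Cl m) := by
  have hb : ∀ i j : Fin (m + 1), Cl.conj (toCl (basisVec i)) * toCl (basisVec j)
      + Cl.conj (toCl (basisVec j)) * toCl (basisVec i : E m)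
      = (2 * if i = j then (1 : ℝ) else 0) • (1 : Cl m) := by
    intro i j
    refine Fin.cases ?_ (fun i => ?_) i <;> refine Fin.cases ?_ (fun j => ?_) j
    · simp [toCl_basisVec_zero, two_smul]
    · simp [toCl_basisVec_zero, toCl_basisVec_succ, Cl.conj_gen, (Fin.succ_ne_zero j).symm]
    · simp [toCl_basisVec_zero, toCl_basisVec_succ, Cl.conj_gen, Fin.succ_ne_zero i]
    · simp only [toCl_basisVec_succ, Cl.conj_gen, Fin.succ_inj]
      split_ifs with h
      · subst h; simp [Cl.gen_mul_self, two_smul]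
      · rw [neg_mul, neg_mul, Cl.gen_anticomm h]; simp
  rw [toCl_eq_sum x, toCl_eq_sum y]
  simp only [Cl.conj_sum, Cl.conj_smul, Finset.sum_mul, Finset.mul_sum, smul_mul_assoc,
    mul_smul_comm, Finset.smul_sum]
  rw [Finset.sum_comm (f := fun i j => y i • x j • _), ← Finset.sum_add_distrib]
  have : inner ℝ x y = ∑ i, ∑ j, x i * y j * if i = j then (1 : ℝ) else 0 := by
    rw [PiLp.inner_apply]
    refine Finset.sum_congr rfl fun i _ => ?_
    simp [mul_comm]
  rw [this, Finset.mul_sum, Finset.sum_smul]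
  refine Finset.sum_congr rfl fun i _ => ?_
  rw [← Finset.sum_add_distrib, Finset.mul_sum, Finset.sum_smul]
  refine Finset.sum_congr rfl fun j _ => ?_
  rw [smul_comm (y j) (x i), ← smul_add, ← smul_add, hb, smul_smul, smul_smul]
  congr 1
  ring

theorem conj_toCl_mul_self (x : E m) :
    Cl.conj (toCl x) * toCl x = (‖x‖ ^ 2) • (1 : Cl m) := by
  have h := conj_toCl_mul_add x x
  rw [← two_smul ℝ, mul_smul, real_inner_self_eq_norm_sq] at h
  exact smul_right_injective _ (two_ne_zero (α := ℝ)) h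

/-- The conjugation of paravectors is the linear map `x ↦ 2 x_0 - x`. -/
theorem conj_toCl (x : E m) : Cl.conj (toCl x) = (2 * x 0) • (1 : Cl m) - toCl x := by
  simp only [toCl, Cl.conj_add, Cl.conj_smul, Cl.conj_sum, Cl.conj_one, Cl.conj_gen, smul_neg,
    Finset.sum_neg_distrib, mul_smul, two_smul]
  abel

theorem toCl_mul_conj_self (x : E m) :
    toCl x * Cl.conj (toCl x) = (‖x‖ ^ 2) • (1 : Cl m) := by
  rw [← conj_toCl_mul_self, conj_toCl, mul_sub, sub_mul, mul_smul_comm, smul_mul_assoc, one_mul,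
    mul_one]

/-- A paravector times its conjugate is the scalar ‖x‖², so multiplication by it is ‖x‖ times an
isometry. For products of arbitrary Clifford numbers the bound used is `norm_mul_le_mulBound`. -/
theorem norm_toCl_mul (x : E m) (c : Cl m) : ‖toCl x * c‖ = ‖x‖ * ‖c‖ := by
  have h : ‖toCl x * c‖ ^ 2 = (‖x‖ * ‖c‖) ^ 2 := by
    rw [← real_inner_self_eq_norm_sq, Cl.inner_mul_left, ← mul_assoc, conj_toCl_mul_self,
      smul_one_mul, inner_smul_right, real_inner_self_eq_norm_sq, mul_pow]
  exact (pow_left_inj₀ (norm_nonneg _) (by positivity) two_ne_zero).1 h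

theorem norm_mul_toCl (x : E m) (c : Cl m) : ‖c * toCl x‖ = ‖x‖ * ‖c‖ := by
  have h : ‖c * toCl x‖ ^ 2 = (‖x‖ * ‖c‖) ^ 2 := by
    rw [← real_inner_self_eq_norm_sq, Cl.inner_mul_right_conj, mul_assoc, toCl_mul_conj_self,
      mul_smul_comm, mul_one, inner_smul_right, real_inner_self_eq_norm_sq, mul_pow]
  exact (pow_left_inj₀ (norm_nonneg _) (by positivity) two_ne_zero).1 h

theorem norm_one_cl : ‖(1 : Cl m)‖ = 1 := by
  have h : ‖(1 : Cl m)‖ ^ 2 = 1 := by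
    rw [← real_inner_self_eq_norm_sq, ← Cl.coeff_empty_conj_mul, mul_one, Cl.conj_one,
      Cl.coeff_one, if_pos rfl]
  exact (pow_eq_one_iff_of_nonneg (norm_nonneg _) two_ne_zero).1 h

theorem norm_toCl (x : E m) : ‖toCl x‖ = ‖x‖ := by
  have := norm_toCl_mul x 1
  rwa [mul_one, norm_one_cl, mul_one] at this

theorem sum_conj_basisVec_mul :
    ∑ i, Cl.conj (toCl (basisVec i : E m)) * toCl (basisVec i) = ((m : ℝ) + 1) • (1 : Cl m) := by
  simp [conj_toCl_mul_self, Nat.cast_smul_eq_nsmul, add_smul]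

theorem sum_basisVec_mul_conj :
    ∑ i, toCl (basisVec i : E m) * Cl.conj (toCl (basisVec i)) = ((m : ℝ) + 1) • (1 : Cl m) := by
  simp [toCl_mul_conj_self, Nat.cast_smul_eq_nsmul, add_smul]

theorem inner_toCl (x y : E m) : inner ℝ (toCl x) (toCl y) = inner ℝ x y :=
  (LinearIsometry.mk (toClL m).toLinearMap norm_toCl).inner_map_map x y

/-! ### Monogenicity of the Cauchy and Szegő kernels. -/

theorem inv_pow_norm_eq_rpow {F : Type*} [NormedAddCommGroup F] (n : ℕ) (w : F) :
    (‖w‖ ^ n)⁻¹ = (‖w‖ ^ 2) ^ (-((n : ℝ) / 2)) := by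
  rw [Real.rpow_neg (by positivity), ← Real.rpow_natCast, ← Real.rpow_natCast,
    ← Real.rpow_mul (norm_nonneg _)]
  congr 2
  push_cast
  ring

/-- The Cauchy kernel `conj y / |y| ^ (m + 1)`. -/
def cauchyKernel (y : E m) : Cl m := (‖y‖ ^ (m + 1))⁻¹ • Cl.conj (toCl y)

/-- The Dirac operator acting from the right. -/
def rightDirac (g : E m → Cl m) (x : E m) : Cl m :=
  ∑ i : Fin (m + 1), fderiv ℝ g x (basisVec i) * toCl (basisVec i)

theorem dirac_eq (f : E m → Cl m) (x : E m) :
    dirac f x = ∑ i : Fin (m + 1), toCl (basisVec i) * fderiv ℝ f x (basisVec i) := rfl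

theorem hasFDerivAt_rpow_smul {N : E m → ℝ} {A : E m → Cl m} {N' : E m →L[ℝ] ℝ}
    {A' : E m →L[ℝ] Cl m} {x : E m} (p : ℝ) (hN : HasFDerivAt N N' x) (hA : HasFDerivAt A A' x)
    (h0 : N x ≠ 0) :
    HasFDerivAt (fun y => (N y) ^ p • A y)
      ((N x) ^ p • A' + ((p * (N x) ^ (p - 1)) • N').smulRight (A x)) x :=
  (hN.rpow_const (Or.inl h0)).smul hA

theorem sum_inner_smul_basisVec (v : E m) :
    ∑ i, inner ℝ v (basisVec i) • toCl (basisVec i) = toCl v := by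
  rw [toCl_eq_sum v]
  refine Finset.sum_congr rfl fun i _ => ?_
  rw [EuclideanSpace.inner_single_right]
  simp

/-- The squared norm is smooth and nonzero off the origin, so this form can be differentiated by the
rule for real powers. -/
theorem cauchyKernel_eq : (cauchyKernel : E m → Cl m) =
    fun y => (‖y‖ ^ 2) ^ (-(((m + 1 : ℕ) : ℝ) / 2)) • Cl.conj (toCl y) := by
  funext y
  rw [cauchyKernel, inv_pow_norm_eq_rpow]

theorem hasFDerivAt_conj_toCl (x : E m) :
    HasFDerivAt (fun y : E m => Cl.conj (toCl y)) ((Cl.conjL m).comp (toClL m)) x :=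
  ((Cl.conjL m).comp (toClL m)).hasFDerivAt

/-- Differentiating the conjugate contributes the factor m + 1, differentiating the power of ‖y‖²
the factor 2p with p = -(m+1)/2; they cancel. -/
theorem rightDirac_cauchyKernel {y : E m} (hy : y ≠ 0) : rightDirac cauchyKernel y = 0 := by
  have h0 : ‖y‖ ^ 2 ≠ 0 := by positivity
  have hd := hasFDerivAt_rpow_smul (-(((m + 1 : ℕ) : ℝ) / 2))
    (hasStrictFDerivAt_norm_sq y).hasFDerivAt (hasFDerivAt_conj_toCl y) h0
  rw [rightDirac, cauchyKernel_eq, hd.fderiv]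
  set p : ℝ := -(((m + 1 : ℕ) : ℝ) / 2) with hp
  simp only [add_apply, smul_apply,
    ContinuousLinearMap.smulRight_apply, ContinuousLinearMap.comp_apply, toClL_apply,
    Cl.conjL_apply, innerSL_apply_apply, add_mul, Finset.sum_add_distrib, smul_mul_assoc,
    ← Finset.smul_sum, sum_conj_basisVec_mul]
  have h2 : ∑ i, (((p * (‖y‖ ^ 2) ^ (p - 1)) • 2 • inner ℝ y (basisVec i)) •
      (Cl.conj (toCl y) * toCl (basisVec i))) =
      ((2 * p * (‖y‖ ^ 2) ^ (p - 1)) * ‖y‖ ^ 2) • (1 : Cl m) := by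
    rw [mul_smul, ← conj_toCl_mul_self, ← sum_inner_smul_basisVec y, Finset.mul_sum,
      Finset.smul_sum, sum_inner_smul_basisVec]
    refine Finset.sum_congr rfl fun i _ => ?_
    rw [mul_smul_comm, smul_smul, smul_eq_mul, nsmul_eq_mul]
    congr 1
    push_cast
    ring
  rw [h2, smul_smul, ← add_smul, Real.rpow_sub_one h0, hp]
  convert zero_smul ℝ (1 : Cl m) using 2
  field_simp
  push_cast
  ring

theorem contDiffAt_cauchyKernel {y : E m} (hy : y ≠ 0) : ContDiffAt ℝ 1 cauchyKernel y := by
  rw [cauchyKernel_eq]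
  have h0 : ‖y‖ ^ 2 ≠ 0 := by positivity
  exact ((contDiff_norm_sq ℝ).contDiffAt.rpow_const_of_ne h0).smul
    ((Cl.conjL m).comp (toClL m)).contDiff.contDiffAt

theorem norm_sq_one_sub (a x : E m) :
    ‖1 - Cl.conj (toCl a) * toCl x‖ ^ 2 = 1 - 2 * inner ℝ a x + ‖a‖ ^ 2 * ‖x‖ ^ 2 := by
  have h1 : inner ℝ (1 : Cl m) (Cl.conj (toCl a) * toCl x) = inner ℝ a x := by
    rw [real_inner_comm, Cl.inner_mul_left, Cl.conj_conj, mul_one, inner_toCl, real_inner_comm]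
  rw [norm_sub_sq_real, norm_one_cl, h1, norm_mul_toCl, Cl.norm_conj, norm_toCl]
  ring

theorem norm_sq_one_sub_pos {a x : E m} (ha : ‖a‖ < 1) (hx : ‖x‖ ≤ 1) :
    0 < ‖1 - Cl.conj (toCl a) * toCl x‖ ^ 2 := by
  rw [norm_sq_one_sub]
  have h1 := real_inner_le_norm a x
  have h2 : ‖a‖ * ‖x‖ < 1 := by nlinarith [norm_nonneg a, norm_nonneg x]
  nlinarith

theorem szego_eq (a : E m) : szego a =
    fun x => (1 - 2 * inner ℝ a x + ‖a‖ ^ 2 * ‖x‖ ^ 2) ^ (-(((m + 1 : ℕ) : ℝ) / 2)) •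
      (1 - Cl.conj (toCl x) * toCl a) := by
  funext x
  rw [szego, inv_pow_norm_eq_rpow, norm_sq_one_sub, Cl.conj_sub, Cl.conj_mul, Cl.conj_conj,
    Cl.conj_one]

theorem hasFDerivAt_one_sub_conj_mul (a x : E m) :
    HasFDerivAt (fun y : E m => 1 - Cl.conj (toCl y) * toCl a)
      (-(((Cl.mulL m).flip (toCl a)).comp ((Cl.conjL m).comp (toClL m)))) x :=
  ((((Cl.mulL m).flip (toCl a)).comp ((Cl.conjL m).comp (toClL m))).hasFDerivAt).const_sub 1

theorem hasFDerivAt_szego_quadratic (a x : E m) :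
    HasFDerivAt (fun x : E m => 1 - 2 * inner ℝ a x + ‖a‖ ^ 2 * ‖x‖ ^ 2)
      (-((2 : ℝ) • innerSL ℝ a) + (‖a‖ ^ 2) • ((2 : ℝ) • innerSL ℝ x)) x := by
  have h1 : HasFDerivAt (fun x : E m => (2 : ℝ) * inner ℝ a x) ((2 : ℝ) • innerSL ℝ a) x :=
    ((innerSL ℝ a).hasFDerivAt).const_smul (2 : ℝ)
  have h2 := (hasStrictFDerivAt_norm_sq x).hasFDerivAt.const_smul (‖a‖ ^ 2)
  rw [← Nat.cast_smul_eq_nsmul ℝ] at h2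
  exact (h1.const_sub 1).add h2

/-- Let N = |1 - conj(a) x|² and p = -(m+1)/2. The linear factor contributes -(m+1) N^p a. The power
contributes -2p N^p a, by the identity `h3` in the proof. The sum is 0. -/
theorem dirac_szego {a x : E m} (ha : ‖a‖ < 1) (hx : ‖x‖ ≤ 1) : dirac (szego a) x = 0 := by
  have hpos := norm_sq_one_sub_pos ha hx
  rw [norm_sq_one_sub] at hpos
  have hd := hasFDerivAt_rpow_smul (-(((m + 1 : ℕ) : ℝ) / 2))
    (hasFDerivAt_szego_quadratic a x) (hasFDerivAt_one_sub_conj_mul a x) hpos.ne'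
  rw [dirac_eq, szego_eq, hd.fderiv]
  set p : ℝ := -(((m + 1 : ℕ) : ℝ) / 2) with hp
  set N : ℝ := 1 - 2 * inner ℝ a x + ‖a‖ ^ 2 * ‖x‖ ^ 2 with hN
  simp only [add_apply, smul_apply,
    neg_apply, ContinuousLinearMap.flip_apply, Cl.mulL_apply,
    ContinuousLinearMap.smulRight_apply, ContinuousLinearMap.comp_apply, toClL_apply,
    Cl.conjL_apply, innerSL_apply_apply, mul_add, Finset.sum_add_distrib, mul_smul_comm,
    mul_neg, ← mul_assoc, smul_neg, Finset.sum_neg_distrib,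
    ← Finset.smul_sum, ← Finset.sum_mul, sum_basisVec_mul_conj]
  have h2 : ∑ i, (((p * N ^ (p - 1)) • (-((2 : ℝ) • inner ℝ a (basisVec i))
        + ‖a‖ ^ 2 • (2 : ℝ) • inner ℝ x (basisVec i))) •
      (toCl (basisVec i) * (1 - Cl.conj (toCl x) * toCl a))) =
      (2 * p * N ^ (p - 1)) • ((toCl (‖a‖ ^ 2 • x - a)) * (1 - Cl.conj (toCl x) * toCl a)) := by
    rw [← sum_inner_smul_basisVec (‖a‖ ^ 2 • x - a), Finset.sum_mul, Finset.smul_sum]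
    refine Finset.sum_congr rfl fun i _ => ?_
    rw [smul_mul_assoc, smul_smul, smul_smul, inner_sub_left, real_inner_smul_left]
    congr 1
    simp only [smul_eq_mul]
    ring
  have h3 : (toCl (‖a‖ ^ 2 • x - a)) * (1 - Cl.conj (toCl x) * toCl a) = -(N • toCl a) := by
    have e1 : toCl a * (Cl.conj (toCl x) * toCl a + Cl.conj (toCl a) * toCl x)
      = (2 * inner ℝ a x) • toCl a := by
      rw [conj_toCl_mul_add, mul_smul_comm, mul_one, real_inner_comm]
    rw [mul_add, ← mul_assoc (toCl a) (Cl.conj (toCl a)), toCl_mul_conj_self, smul_one_mul,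
      ← mul_assoc] at e1
    rw [toCl_sub, toCl_smul, sub_mul, mul_sub, mul_sub, mul_one, mul_one, ← mul_assoc, ← mul_assoc,
      smul_mul_assoc, toCl_mul_conj_self, hN, add_smul, sub_smul, ← e1, one_smul, smul_mul_assoc,
      smul_one_mul, smul_smul]
    abel
  rw [h2, h3, smul_neg, smul_smul, smul_one_mul, smul_smul, ← neg_add, ← add_smul]
  rw [Real.rpow_sub_one hpos.ne', hp]
  convert neg_zero (G := Cl m)
  convert zero_smul ℝ (toCl a) using 2
  field_simp
  push_cast
  ring

theorem contDiffAt_szego {a x : E m} (ha : ‖a‖ < 1) (hx : ‖x‖ ≤ 1) :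
    ContDiffAt ℝ 1 (szego a) x := by
  have hpos := norm_sq_one_sub_pos ha hx
  rw [norm_sq_one_sub] at hpos
  rw [szego_eq]
  have hN : ContDiff ℝ 1 fun x : E m => 1 - 2 * inner ℝ a x + ‖a‖ ^ 2 * ‖x‖ ^ 2 :=
    (contDiff_const.sub (contDiff_const.mul (innerSL ℝ a).contDiff)).add
      (contDiff_const.mul (contDiff_norm_sq ℝ))
  refine (hN.contDiffAt.rpow_const_of_ne hpos.ne').smul ?_
  exact (contDiff_const.sub
      (((Cl.mulL m).flip (toCl a)).comp ((Cl.conjL m).comp (toClL m))).contDiff).contDiffAt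

/-- On the unit sphere the conjugate of the Szegő kernel is the Cauchy kernel times the normal. -/
theorem conj_szego_of_norm_eq_one (b : E m) {η : E m} (hη : ‖η‖ = 1) :
    Cl.conj (szego b η) = cauchyKernel (η - b) * toCl η := by
  have h1 : 1 - Cl.conj (toCl b) * toCl η = Cl.conj (toCl (η - b)) * toCl η := by
    rw [toCl_sub, Cl.conj_sub, sub_mul, conj_toCl_mul_self, hη]
    simp
  rw [szego, Cl.conj_smul, Cl.conj_conj, h1, norm_mul_toCl, Cl.norm_conj, norm_toCl, hη, one_mul,
    cauchyKernel, smul_mul_assoc]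

/-! ### Polar coordinates on ℝ^{m+1}. -/

/-- The unit sphere `S^m`. -/
abbrev Sph (m : ℕ) : Type := Metric.sphere (0 : E m) 1

/-- The surface measure of the unit sphere. -/
abbrev surf (m : ℕ) : Measure (Sph m) := (volume : Measure (E m)).toSphere

theorem norm_coe_sph (η : Sph m) : ‖(η : E m)‖ = 1 := by simp

theorem norm_smul_sph {r : ℝ} (hr : 0 ≤ r) (η : Sph m) : ‖r • (η : E m)‖ = r := by
  rw [norm_smul, norm_coe_sph, mul_one, Real.norm_of_nonneg hr]

theorem integral_eq_polar {Φ : E m → Cl m} (hΦ : Integrable Φ) :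
    ∫ y, Φ y = ∫ r in Ioi (0 : ℝ), r ^ m • ∫ η, Φ (r • (η : E m)) ∂(surf m) := by
  have hdim : Module.finrank ℝ (E m) - 1 = m := by simp
  have hmp := (volume : Measure (E m)).measurePreserving_homeomorphUnitSphereProd
  have hem := Homeomorph.measurableEmbedding (homeomorphUnitSphereProd (E m))
  rw [hdim] at hmp
  have hsub : ∀ x : ({(0 : E m)}ᶜ : Set (E m)),
      Φ ((homeomorphUnitSphereProd (E m) x).2.1 • (homeomorphUnitSphereProd (E m) x).1.1) = Φ x := by
    intro x
    have := congrArg Subtype.val ((homeomorphUnitSphereProd (E m)).symm_apply_apply x)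
    rw [homeomorphUnitSphereProd_symm_apply_coe] at this
    rw [this]
  have hint : Integrable (fun p : Sph m × Ioi (0 : ℝ) => Φ (p.2.1 • p.1.1))
      ((surf m).prod (.volumeIoiPow m)) := by
    rw [← hmp.integrable_comp_emb hem]
    simp only [Function.comp_def, hsub]
    exact (integrableOn_iff_comap_subtypeVal (measurableSet_singleton _).compl).1 hΦ.integrableOn
  calc
    ∫ y, Φ y = ∫ x : ({(0 : E m)}ᶜ : Set (E m)), Φ x ∂(volume.comap Subtype.val) := by
      rw [integral_subtype_comap (measurableSet_singleton _).compl Φ, restrict_compl_singleton]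
    _ = ∫ p : Sph m × Ioi (0 : ℝ), Φ (p.2.1 • p.1.1) ∂((surf m).prod (.volumeIoiPow m)) := by
      rw [← hmp.integral_comp hem]
      simp only [hsub]
    _ = ∫ r : Ioi (0 : ℝ), ∫ η : Sph m, Φ (r.1 • η.1) ∂(surf m) ∂(.volumeIoiPow m) :=
      integral_prod_symm _ hint
    _ = _ := by
      simp only [Measure.volumeIoiPow, ENNReal.ofReal]
      rw [integral_withDensity_eq_integral_smul,
        integral_subtype_comap measurableSet_Ioi
          fun a : ℝ => Real.toNNReal (a ^ m) • ∫ η : Sph m, Φ (a • η.1) ∂(surf m),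
        setIntegral_congr_fun measurableSet_Ioi fun _ hx => ?_]
      · rw [NNReal.smul_def, Real.coe_toNNReal _ (pow_nonneg hx.out.le _)]
      · exact (measurable_subtype_coe.pow_const _).real_toNNReal

/-! ### Integration by parts against cutoffs, in place of Stokes' theorem. -/

theorem continuous_smul_of_tsupport {X F : Type*} [TopologicalSpace X] [NormedAddCommGroup F]
    [NormedSpace ℝ F] {χ : X → ℝ} {h : X → F} {U : Set X} (hU : IsOpen U) (hχ : Continuous χ)
    (hsupp : tsupport χ ⊆ U) (hh : ContinuousOn h U) : Continuous fun y => χ y • h y :=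
  continuous_of_tsupport fun _ hx =>
    hχ.continuousAt.smul (hh.continuousAt (hU.mem_nhds (hsupp (tsupport_smul_subset_left χ h hx))))

theorem integrable_smul_of_tsupport {F : Type*} [NormedAddCommGroup F]
    [NormedSpace ℝ F] {χ : E m → ℝ} {h : E m → F} {U : Set (E m)} (hU : IsOpen U)
    (hχ : Continuous χ) (hc : HasCompactSupport χ)
    (hsupp : tsupport χ ⊆ U) (hh : ContinuousOn h U) : Integrable fun y => χ y • h y :=
  (continuous_smul_of_tsupport hU hχ hsupp hh).integrable_of_hasCompactSupport hc.smul_right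

/-- The divergence ∑ ∂_i (G e_i F) is (G D) F + G (D F), which vanishes on U. This is its weak form;
the support of χ keeps everything inside U. -/
theorem integral_gradient_eq_zero {U : Set (E m)} (hU : IsOpen U) {χ : E m → ℝ} {F G : E m → Cl m}
    (hχ : ContDiff ℝ 1 χ) (hc : HasCompactSupport χ) (hsupp : tsupport χ ⊆ U)
    (hF : ContDiffOn ℝ 1 F U) (hG : ContDiffOn ℝ 1 G U) (hDF : ∀ y ∈ U, dirac F y = 0)
    (hDG : ∀ y ∈ U, rightDirac G y = 0) :
    ∫ y, ∑ i, fderiv ℝ χ y (basisVec i) • (G y * toCl (basisVec i) * F y) = 0 := by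
  have hFd : ∀ y ∈ U, HasFDerivAt F (fderiv ℝ F y) y := fun y hy =>
    ((hF.differentiableOn one_ne_zero).differentiableAt (hU.mem_nhds hy)).hasFDerivAt
  have hGd : ∀ y ∈ U, HasFDerivAt G (fderiv ℝ G y) y := fun y hy =>
    ((hG.differentiableOn one_ne_zero).differentiableAt (hU.mem_nhds hy)).hasFDerivAt
  have hF' : ContinuousOn (fderiv ℝ F) U := hF.continuousOn_fderiv_of_isOpen hU le_rfl
  have hG' : ContinuousOn (fderiv ℝ G) U := hG.continuousOn_fderiv_of_isOpen hU le_rfl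
  have hFc := hF.continuousOn
  have hGc := hG.continuousOn
  let H : Fin (m + 1) → E m → Cl m := fun i y => G y * toCl (basisVec i) * F y
  let H' : Fin (m + 1) → E m → Cl m := fun i y =>
    fderiv ℝ G y (basisVec i) * toCl (basisVec i) * F y
      + G y * (toCl (basisVec i) * fderiv ℝ F y (basisVec i))
  have hHc : ∀ i, ContinuousOn (H i) U := fun i => (hGc.mul continuousOn_const).mul hFc
  have hH'c : ∀ i, ContinuousOn (H' i) U := fun i =>
    (((hG'.clm_apply continuousOn_const).mul continuousOn_const).mul hFc).add
      (hGc.mul (continuousOn_const.mul (hF'.clm_apply continuousOn_const)))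
  have hHd : ∀ i, ∀ y ∈ U, HasLineDerivAt ℝ (H i) (H' i y) y (basisVec i) := by
    intro i y hy
    have h1 : HasFDerivAt (fun y => Cl.mulL m (G y) (toCl (basisVec i) * F y))
        (((Cl.mulL m).precompR (E m) (G y)
          (((Cl.mulL m) (toCl (basisVec i))).comp (fderiv ℝ F y))) +
          (Cl.mulL m).precompL (E m) (fderiv ℝ G y) (toCl (basisVec i) * F y)) y :=
      (Cl.mulL m).hasFDerivAt_of_bilinear (hGd y hy)
        (((Cl.mulL m) (toCl (basisVec i))).hasFDerivAt.comp y (hFd y hy))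
    have h2 := h1.hasLineDerivAt (basisVec i)
    simp only [Cl.mulL_apply, ← mul_assoc] at h2
    convert! h2 using 1
    simp [H', mul_assoc, add_comm]
  have hχ' : ∀ i, Continuous fun y => fderiv ℝ χ y (basisVec i) := fun i =>
    (hχ.continuous_fderiv one_ne_zero).clm_apply continuous_const
  have hχs : ∀ i, tsupport (fun y => fderiv ℝ χ y (basisVec i)) ⊆ tsupport χ := fun i =>
    tsupport_fderiv_apply_subset ℝ _
  have i1 : ∀ i, Integrable fun y => fderiv ℝ χ y (basisVec i) • H i y := fun i =>
    integrable_smul_of_tsupport hU (hχ' i) (hc.of_isClosed_subset (isClosed_tsupport _) (hχs i))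
      ((hχs i).trans hsupp) (hHc i)
  have i2 : ∀ i, Integrable fun y => χ y • H' i y := fun i =>
    integrable_smul_of_tsupport hU hχ.continuous hc hsupp (hH'c i)
  have i3 : ∀ i, Integrable fun y => χ y • H i y := fun i =>
    integrable_smul_of_tsupport hU hχ.continuous hc hsupp (hHc i)
  have key : ∀ i, ∫ y, χ y • H' i y = -∫ y, fderiv ℝ χ y (basisVec i) • H i y := fun i =>
    integral_bilinear_hasLineDerivAt_right_eq_neg_left_of_integrable
      (B := ContinuousLinearMap.lsmul ℝ ℝ) (i1 i) (i2 i) (i3 i)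
      (fun y _ => ((hχ.differentiable one_ne_zero) y).hasFDerivAt.hasLineDerivAt _)
      (fun y hy => hHd i y (hsupp hy))
  rw [integral_finsetSum _ fun i _ => i1 i]
  have : ∑ i, ∫ y, χ y • H' i y = 0 := by
    rw [← integral_finsetSum _ fun i _ => i2 i]
    refine integral_eq_zero_of_ae (Eventually.of_forall fun y => ?_)
    by_cases hy : y ∈ U
    · have h1 := hDF y hy
      have h2 := hDG y hy
      rw [dirac_eq] at h1
      rw [rightDirac] at h2
      simp only [H', ← Finset.smul_sum, Finset.sum_add_distrib, ← Finset.mul_sum, ← Finset.sum_mul,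
        h1, h2, zero_mul, mul_zero, add_zero, smul_zero, Pi.zero_apply]
    · have : χ y = 0 := image_eq_zero_of_notMem_tsupport fun h => hy (hsupp h)
      simp [this]
  rw [Finset.sum_congr rfl fun i _ => key i, Finset.sum_neg_distrib, neg_eq_zero] at this
  exact this

/-- If the integrals of `Φ` against radial test functions supported in a shell are the multiples
`(∫ r g(r) dr) C`, then the spherical integrals of `Φ` are determined in the shell. -/
theorem sphere_integral_eq_of_radial {Φ : E m → Cl m} {ρ R : ℝ} (hρ : 0 ≤ ρ) {C : Cl m}
    (hΦ : ContinuousOn Φ {y | ‖y‖ ∈ Ioo ρ R})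
    (h : ∀ g : ℝ → ℝ, Continuous g → HasCompactSupport g → tsupport g ⊆ Ioo ρ R →
      ∫ y, g ‖y‖ • Φ y = (∫ r, r * g r) • C) {r : ℝ} (hr : r ∈ Ioo ρ R) :
    r ^ m • ∫ η, Φ (r • (η : E m)) ∂(surf m) = r • C := by
  have hpos : ∀ {r : ℝ}, r ∈ Ioo ρ R → 0 < r := fun hr => hρ.trans_lt hr.1
  have hM : ContinuousOn (fun r : ℝ => ∫ η, Φ (r • (η : E m)) ∂(surf m)) (Ioo ρ R) := by
    refine continuousOn_integral_of_compact_support (k := univ) isCompact_univ ?_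
      (fun p x _ hx => absurd (mem_univ x) hx)
    refine hΦ.comp (by fun_prop) ?_
    rintro ⟨r, η⟩ ⟨hr, -⟩
    show ‖r • (η : E m)‖ ∈ Ioo ρ R
    rwa [norm_smul_sph (hpos hr).le]
  have hA : ContinuousOn (fun r : ℝ => r ^ m • ∫ η, Φ (r • (η : E m)) ∂(surf m)) (Ioo ρ R) :=
    (continuousOn_id.pow m).smul hM
  have hB : ContinuousOn (fun r : ℝ => r • C) (Ioo ρ R) := continuousOn_id.smul continuousOn_const
  have hAB := hA.sub hB
  -- The difference of the two sides annihilates all test functions, so it is 0 almost everywhere,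
  -- and everywhere by continuity.
  have hae := isOpen_Ioo.ae_eq_zero_of_integral_contDiff_smul_eq_zero (μ := volume)
    (hAB.locallyIntegrableOn measurableSet_Ioo) ?_
  · have := Measure.eqOn_open_of_ae_eq (μ := volume) (U := Ioo ρ R)
      ((ae_restrict_iff' measurableSet_Ioo).2 (hae.mono fun x hx hxU => sub_eq_zero.1 (hx hxU)))
      isOpen_Ioo hA hB
    exact this hr
  · intro g hg hgc hgs
    have hU : IsOpen {y : E m | ‖y‖ ∈ Ioo ρ R} := isOpen_Ioo.preimage continuous_norm
    have hg0 : ∀ r ∉ Ioo ρ R, g r = 0 := fun r hr =>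
      image_eq_zero_of_notMem_tsupport fun h => hr (hgs h)
    have hsub : tsupport (fun y : E m => g ‖y‖) ⊆ (fun y : E m => ‖y‖) ⁻¹' tsupport g :=
      closure_minimal (fun y hy => subset_tsupport _ hy)
        ((isClosed_tsupport _).preimage continuous_norm)
    have hcs : HasCompactSupport fun y : E m => g ‖y‖ := by
      refine HasCompactSupport.of_support_subset_isCompact (isCompact_closedBall (0 : E m) R) ?_
      intro y hy
      rw [mem_closedBall_zero_iff]
      by_contra hcon
      exact hy (hg0 _ fun hh => hcon hh.2.le)
    have hint : Integrable fun y : E m => g ‖y‖ • Φ y :=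
      integrable_smul_of_tsupport hU (hg.continuous.comp continuous_norm) hcs
        (fun y hy => hgs (hsub hy)) hΦ
    have h1 := h g hg.continuous hgc hgs
    rw [integral_eq_polar hint] at h1
    have h2 : ∫ r in Ioi (0 : ℝ), r ^ m • ∫ η, g ‖r • (η : E m)‖ • Φ (r • (η : E m)) ∂(surf m)
        = ∫ r, g r • (r ^ m • ∫ η, Φ (r • (η : E m)) ∂(surf m)) := by
      refine (setIntegral_congr_fun measurableSet_Ioi fun r (hr : r ∈ Ioi 0) => ?_).trans
        (setIntegral_eq_integral_of_forall_compl_eq_zero fun r hr => ?_)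
      · simp only [norm_smul_sph (le_of_lt hr), integral_smul]
        rw [smul_comm]
      · rw [hg0 r fun hh => hr (hpos hh), zero_smul]
    rw [h2] at h1
    have h3 : (∫ r, r * g r) • C = ∫ r, g r • (r • C) := by
      rw [← integral_smul_const]
      refine integral_congr_ae (Eventually.of_forall fun r => ?_)
      simp only [smul_smul, mul_comm]
    simp only [Pi.sub_apply, smul_sub]
    rw [integral_sub, h1, h3, sub_self]
    · exact (continuous_smul_of_tsupport isOpen_Ioo hg.continuous hgs
        hA).integrable_of_hasCompactSupport hgc.smul_right
    · exact (continuous_smul_of_tsupport isOpen_Ioo hg.continuous hgs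
        hB).integrable_of_hasCompactSupport hgc.smul_right

/-- The gradient 2 g(‖y‖) y reproduces the radial factor in the sphere integrals, so that
integration by parts against χ tests these integrals against g. -/
theorem exists_radial_cutoff {ρ R : ℝ} (hR : 0 < R) {g : ℝ → ℝ}
    (hg : Continuous g) (hgc : HasCompactSupport g) (hgs : tsupport g ⊆ Ioo ρ R) :
    ∃ χ : E m → ℝ, ContDiff ℝ 1 χ ∧ HasCompactSupport χ ∧ tsupport χ ⊆ Metric.ball 0 R ∧
      (∀ y, ‖y‖ ≤ ρ → χ y = -(2 * ∫ r, r * g r)) ∧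
      ∀ y v, fderiv ℝ χ y v = 2 * g ‖y‖ * inner ℝ y v := by
  -- The gap between R₁ and R keeps the closed support of χ inside the open ball.
  obtain ⟨R₁, hR₁, hR₁g⟩ : ∃ R₁ < R, ∀ r, R₁ < r → g r = 0 := by
    rcases (tsupport g).eq_empty_or_nonempty with h | h
    · exact ⟨R - 1, by linarith, fun r _ => image_eq_zero_of_notMem_tsupport (by simp [h])⟩
    · obtain ⟨s, hs, hmax⟩ := hgc.exists_isGreatest h
      exact ⟨s, (hgs hs).2, fun r hr => image_eq_zero_of_notMem_tsupport fun h' =>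
        absurd (hmax h') (not_le.2 hr)⟩
  have hcont : Continuous fun t : ℝ => g (√t) := hg.comp Real.continuous_sqrt
  -- Composing with ‖y‖² instead of ‖y‖ keeps χ differentiable at the origin. The integrand is
  -- continuous on all of ℝ because `√` is continuous and 0 on the negative numbers.
  let κ : ℝ → ℝ := fun s => ∫ t in (R ^ 2)..s, g (√t)
  have hκ : ∀ s, HasDerivAt κ (g (√s)) s := fun s =>
    intervalIntegral.integral_hasDerivAt_right (hcont.intervalIntegrable _ _)
      (hcont.stronglyMeasurableAtFilter _ _) hcont.continuousAt
  have hκ1 : ContDiff ℝ 1 κ := by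
    rw [contDiff_one_iff_deriv]
    refine ⟨fun s => (hκ s).differentiableAt, ?_⟩
    rwa [show deriv κ = fun s => g (√s) from funext fun s => (hκ s).deriv]
  have hval : ∀ t, 0 ≤ t → κ (t ^ 2) = -∫ r in t..R, 2 * (r * g r) := by
    intro t ht
    have h1 : ∀ r ∈ uIcc t R, HasDerivAt (fun r => κ (r ^ 2)) (2 * (r * g r)) r := by
      intro r hr
      have hr0 : 0 ≤ r := (le_min ht hR.le).trans hr.1
      have h := (hκ (r ^ 2)).comp r (hasDerivAt_pow 2 r)
      rw [Real.sqrt_sq hr0] at h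
      convert! h using 1
      norm_num
      ring
    have hc : Continuous fun r : ℝ => 2 * (r * g r) := by fun_prop
    rw [intervalIntegral.integral_eq_sub_of_hasDerivAt h1 (hc.intervalIntegrable _ _)]
    simp [κ]
  refine ⟨fun y => κ (‖y‖ ^ 2), hκ1.comp (contDiff_norm_sq ℝ), ?_, ?_, ?_, ?_⟩
  · refine HasCompactSupport.of_support_subset_isCompact (isCompact_closedBall (0 : E m) R) ?_
    intro y hy
    rw [mem_closedBall_zero_iff]
    by_contra hcon
    refine hy ?_
    show κ (‖y‖ ^ 2) = 0
    rw [hval _ (norm_nonneg _), intervalIntegral.integral_congr (g := fun _ => (0 : ℝ))]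
    · simp
    · intro r hr
      rw [not_le] at hcon
      rw [uIcc_of_ge hcon.le] at hr
      simp [hR₁g r (hR₁.trans_le hr.1)]
  · have hsub : tsupport (fun y : E m => κ (‖y‖ ^ 2)) ⊆ Metric.closedBall 0 R₁ := by
      refine closure_minimal ?_ Metric.isClosed_closedBall
      intro y hy
      rw [mem_closedBall_zero_iff]
      by_contra hcon
      refine hy ?_
      show κ (‖y‖ ^ 2) = 0
      rw [hval _ (norm_nonneg _), intervalIntegral.integral_congr (g := fun _ => (0 : ℝ))]
      · simp
      · intro r hr
        rw [not_le] at hcon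
        simp [hR₁g r ((lt_min hcon hR₁).trans_le hr.1)]
    exact hsub.trans (Metric.closedBall_subset_ball hR₁)
  · intro y hy
    show κ (‖y‖ ^ 2) = _
    rw [hval _ (norm_nonneg _), intervalIntegral.integral_eq_integral_of_support_subset,
      integral_const_mul]
    intro r hr
    have hr' : r ∈ Ioo ρ R := by
      by_contra hcon
      refine hr ?_
      simp [image_eq_zero_of_notMem_tsupport fun h => hcon (hgs h)]
    exact ⟨hy.trans_lt hr'.1, hr'.2.le⟩
  · intro y v
    have h := (hκ (‖y‖ ^ 2)).comp_hasFDerivAt y (hasStrictFDerivAt_norm_sq y).hasFDerivAt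
    rw [show (fun y : E m => κ (‖y‖ ^ 2)) = κ ∘ fun y => ‖y‖ ^ 2 from rfl, h.fderiv,
      Real.sqrt_sq (norm_nonneg _)]
    simp
    ring

/-! ### Cauchy's theorem and the Cauchy integral formula. -/

theorem sum_inner_smul_mul (A B : Cl m) (t : ℝ) (v : E m) :
    ∑ i, (t * inner ℝ v (basisVec i)) • (A * toCl (basisVec i) * B) = t • (A * toCl v * B) := by
  rw [← sum_inner_smul_basisVec v, Finset.mul_sum, Finset.sum_mul, Finset.smul_sum]
  refine Finset.sum_congr rfl fun i _ => ?_
  rw [mul_smul_comm, smul_mul_assoc, smul_smul]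

theorem sphere_integral_eq_zero_of_monogenic {R : ℝ} {F G : E m → Cl m}
    (hF : IsLeftMonogenicOn F (Metric.ball 0 R)) (hG : ContDiffOn ℝ 1 G (Metric.ball 0 R))
    (hDG : ∀ y ∈ Metric.ball 0 R, rightDirac G y = 0) {r : ℝ} (hr : r ∈ Ioo 0 R) :
    ∫ η, G (r • (η : E m)) * toCl (r • (η : E m)) * F (r • (η : E m)) ∂(surf m) = 0 := by
  have hR : 0 < R := hr.1.trans hr.2
  have h := sphere_integral_eq_of_radial (Φ := fun y : E m => G y * toCl y * F y) (C := 0)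
    le_rfl ?_ ?_ hr
  · rw [smul_zero] at h
    exact (smul_eq_zero.1 h).resolve_left (pow_ne_zero _ hr.1.ne')
  · refine ((hG.continuousOn.mul continuous_toCl.continuousOn).mul hF.1.continuousOn).mono ?_
    intro y hy
    rw [mem_ball_zero_iff]
    exact hy.2
  · intro g hg hgc hgs
    obtain ⟨χ, h1, h2, h3, -, h5⟩ := exists_radial_cutoff (m := m) hR hg hgc hgs
    have := integral_gradient_eq_zero Metric.isOpen_ball h1 h2 h3 hF.1 hG hF.2 hDG
    simp only [h5, sum_inner_smul_mul] at this
    simp only [mul_smul] at this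
    rw [integral_smul] at this
    rw [smul_zero]
    exact (smul_eq_zero.1 this).resolve_left two_ne_zero

theorem rightDirac_comp_sub (G : E m → Cl m) (x y : E m) :
    rightDirac (fun y => G (y - x)) y = rightDirac G (y - x) := by
  simp only [rightDirac, fderiv_comp_sub]

theorem dirac_comp_add (F : E m → Cl m) (x y : E m) :
    dirac (fun y => F (x + y)) y = dirac F (x + y) := by
  simp only [dirac, fderiv_comp_add_left]

/-- Cauchy's theorem with the pole x removed: from a cutoff centred at 0 a multiple of one centred
at x is subtracted, so that the difference vanishes near x. The sphere integral around 0 is thereby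
expressed by a shell integral around x. -/
theorem sphere_integral_cauchyKernel {R R₀ : ℝ} {F : E m → Cl m}
    (hF : IsLeftMonogenicOn F (Metric.ball 0 R)) {x : E m} (hR₀ : 0 < R₀) (hx : ‖x‖ + R₀ ≤ R)
    {g₀ : ℝ → ℝ} (hg₀ : Continuous g₀) (hg₀c : HasCompactSupport g₀)
    (hg₀s : tsupport g₀ ⊆ Ioo (R₀ / 2) R₀) (hg₀i : ∫ r, r * g₀ r ≠ 0) {r : ℝ}
    (hr : r ∈ Ioo ‖x‖ R) :
    r ^ m • ∫ η, cauchyKernel (r • (η : E m) - x) * toCl (r • (η : E m)) * F (r • (η : E m))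
      ∂(surf m)
    = r • (∫ r, r * g₀ r)⁻¹ • ∫ z, g₀ ‖z‖ • (cauchyKernel z * toCl z * F (x + z)) := by
  set c₀ := ∫ r, r * g₀ r with hc₀
  -- Testing only on radii above ρ > ‖x‖ makes χ constant on a neighbourhood of x.
  obtain ⟨ρ, hρ1, hρ2⟩ := exists_between hr.1
  have hR : 0 < R := (norm_nonneg x).trans_lt (hr.1.trans hr.2)
  have hU : IsOpen (Metric.ball (0 : E m) R \ {x}) := Metric.isOpen_ball.sdiff isClosed_singleton
  have hG : ContDiffOn ℝ 1 (fun y : E m => cauchyKernel (y - x)) (Metric.ball 0 R \ {x}) :=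
    fun y hy => ((contDiffAt_cauchyKernel (sub_ne_zero.2 hy.2)).comp y
      (contDiffAt_id.sub contDiffAt_const)).contDiffWithinAt
  have hDG : ∀ y ∈ Metric.ball (0 : E m) R \ {x},
      rightDirac (fun y : E m => cauchyKernel (y - x)) y = 0 := fun y hy => by
    rw [rightDirac_comp_sub, rightDirac_cauchyKernel (sub_ne_zero.2 hy.2)]
  have hFU := hF.1.mono (sdiff_subset (s := Metric.ball (0 : E m) R) (t := {x}))
  have hΦc : ∀ w : E m, ContinuousOn (fun y : E m => cauchyKernel (y - x) * toCl (y - w) * F y)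
      (Metric.ball 0 R \ {x}) := fun w =>
    (hG.continuousOn.mul (by fun_prop)).mul hFU.continuousOn
  refine sphere_integral_eq_of_radial
    (Φ := fun y : E m => cauchyKernel (y - x) * toCl y * F y) ((norm_nonneg x).trans hρ1.le)
    ?_ ?_ ⟨hρ2, hr.2⟩
  · have := hΦc 0
    simp only [sub_zero] at this
    refine this.mono ?_
    intro y hy
    refine ⟨mem_ball_zero_iff.2 hy.2, ?_⟩
    rintro rfl
    exact lt_asymm hρ1 hy.1
  · intro g hg hgc hgs
    obtain ⟨χ, h1, h2, h3, h4, h5⟩ := exists_radial_cutoff (m := m) hR hg hgc hgs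
    obtain ⟨χ₀, k1, k2, k3, k4, k5⟩ := exists_radial_cutoff (m := m) hR₀ hg₀ hg₀c hg₀s
    set I := ∫ r, r * g r with hI
    have hχ₀ : ContDiff ℝ 1 fun y : E m => χ₀ (y - x) := k1.comp (contDiff_id.sub contDiff_const)
    have hfd : ∀ y v, fderiv ℝ (fun y : E m => χ y - (I / c₀) * χ₀ (y - x)) y v
        = 2 * g ‖y‖ * inner ℝ y v + (-(I / c₀) * (2 * g₀ ‖y - x‖)) * inner ℝ (y - x) v := by
      intro y v
      have e1 := (h1.differentiable one_ne_zero y).hasFDerivAt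
      have e2 := (k1.differentiable one_ne_zero (y - x)).hasFDerivAt.comp y
        ((hasFDerivAt_id y).sub_const x)
      have e3 := e1.sub (e2.const_mul (I / c₀))
      have e4 : fderiv ℝ (fun y : E m => χ y - (I / c₀) * χ₀ (y - x)) y = _ := e3.fderiv
      rw [e4]
      simp only [sub_apply, smul_apply, ContinuousLinearMap.comp_apply,
        ContinuousLinearMap.id_apply, h5, k5, smul_eq_mul]
      ring
    have hsub0 : tsupport (fun y : E m => χ₀ (y - x)) ⊆ Metric.ball x R₀ := by
      have : tsupport (fun y : E m => χ₀ (y - x)) ⊆ (fun y => y - x) ⁻¹' tsupport χ₀ :=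
        closure_minimal (fun y hy => subset_tsupport _ hy)
          ((isClosed_tsupport _).preimage (continuous_id.sub continuous_const))
      intro y hy
      have := k3 (this hy)
      rwa [mem_ball_zero_iff, ← dist_eq_norm] at this
    have hball : Metric.ball x R₀ ⊆ Metric.ball 0 R := by
      refine Metric.ball_subset_ball' ?_
      rw [dist_zero_right]
      linarith
    have hsupp : tsupport (fun y : E m => χ y - (I / c₀) * χ₀ (y - x)) ⊆
        Metric.ball 0 R \ {x} := by
      intro y hy
      refine ⟨?_, ?_⟩
      · have hmem : y ∈ tsupport χ ∪ tsupport (fun y : E m => χ₀ (y - x)) := by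
          refine closure_minimal ?_ ((isClosed_tsupport _).union (isClosed_tsupport _)) hy
          intro z hz
          by_contra hcon
          rw [mem_union, not_or] at hcon
          refine hz ?_
          have z1 := image_eq_zero_of_notMem_tsupport hcon.1
          have z2 := image_eq_zero_of_notMem_tsupport hcon.2
          simp only [z1, z2, mul_zero, sub_zero]
        rcases hmem with h | h
        · exact h3 h
        · exact hball (hsub0 h)
      · rintro rfl
        refine (notMem_tsupport_iff_eventuallyEq.2 ?_) hy
        have n1 : ∀ᶠ z in 𝓝 y, ‖z‖ < ρ := continuous_norm.continuousAt.eventually_lt_const hρ1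
        have n2 : ∀ᶠ z in 𝓝 y, ‖z - y‖ < R₀ / 2 :=
          (continuous_norm.comp (continuous_id.sub continuous_const)).continuousAt.eventually_lt_const
            (by simpa using half_pos hR₀)
        filter_upwards [n1, n2] with z z1 z2
        -- Near x the two cutoffs have the values -2 I and -2 c₀, which explains the coefficient I /
        -- c₀.
        rw [h4 z z1.le, k4 _ z2.le, Pi.zero_apply, ← hc₀]
        field_simp
        ring
    have hcs : HasCompactSupport (fun y : E m => χ y - (I / c₀) * χ₀ (y - x)) := by
      refine HasCompactSupport.of_support_subset_isCompact (isCompact_closedBall (0 : E m) R) ?_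
      exact (subset_tsupport _).trans (hsupp.trans
        (sdiff_subset.trans Metric.ball_subset_closedBall))
    have key := integral_gradient_eq_zero hU (h1.sub (contDiff_const.mul hχ₀)) hcs hsupp
      hFU hG (fun y hy => hF.2 y hy.1) hDG
    simp only [hfd, add_smul, Finset.sum_add_distrib, sum_inner_smul_mul] at key
    have hgn : ∀ w : E m, Continuous fun y : E m => ‖y - w‖ := fun w => by fun_prop
    have hts : ∀ (q : ℝ → ℝ) (w : E m), tsupport (fun y : E m => q ‖y - w‖) ⊆
        (fun y : E m => ‖y - w‖) ⁻¹' tsupport q := fun q w =>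
      closure_minimal (fun y hy => subset_tsupport _ hy) ((isClosed_tsupport _).preimage (hgn w))
    have hts1 : tsupport (fun y : E m => g ‖y - 0‖) ⊆ Metric.ball 0 R \ {x} := by
      intro y hy
      have hh := hgs (hts g 0 hy)
      simp only [sub_zero] at hh
      refine ⟨mem_ball_zero_iff.2 hh.2, ?_⟩
      rintro rfl
      exact lt_asymm hρ1 hh.1
    have hts2 : tsupport (fun y : E m => g₀ ‖y - x‖) ⊆ Metric.ball 0 R \ {x} := by
      intro y hy
      have hh := hg₀s (hts g₀ x hy)
      refine ⟨hball (by rw [Metric.mem_ball, dist_eq_norm]; exact hh.2), ?_⟩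
      rintro rfl
      simp only [sub_self, norm_zero, mem_Ioo] at hh
      linarith [hh.1]
    have hcs' : ∀ q : E m → ℝ, tsupport q ⊆ Metric.ball 0 R \ {x} → HasCompactSupport q :=
      fun q hq => HasCompactSupport.of_support_subset_isCompact (isCompact_closedBall (0 : E m) R)
        ((subset_tsupport _).trans (hq.trans (sdiff_subset.trans Metric.ball_subset_closedBall)))
    have int1 : Integrable fun y : E m => g ‖y‖ • (cauchyKernel (y - x) * toCl y * F y) := by
      have := integrable_smul_of_tsupport hU (hg.comp (hgn 0)) (hcs' _ hts1) hts1 (hΦc 0)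
      simpa using this
    have int2 : Integrable fun y : E m =>
        g₀ ‖y - x‖ • (cauchyKernel (y - x) * toCl (y - x) * F y) :=
      integrable_smul_of_tsupport hU (hg₀.comp (hgn x)) (hcs' _ hts2) hts2 (hΦc x)
    simp only [mul_smul] at key
    have int3 : Integrable fun y : E m => (2 : ℝ) • g ‖y‖ • (cauchyKernel (y - x) * toCl y * F y) :=
      int1.smul (2 : ℝ)
    have int4 : Integrable fun y : E m => (-(I / c₀)) • (2 : ℝ) •
        g₀ ‖y - x‖ • (cauchyKernel (y - x) * toCl (y - x) * F y) :=
      (int2.smul (2 : ℝ)).smul (-(I / c₀))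
    rw [integral_add int3 int4, integral_smul,
      integral_smul, integral_smul] at key
    have htr : ∫ y : E m, g₀ ‖y - x‖ • (cauchyKernel (y - x) * toCl (y - x) * F y)
        = ∫ z, g₀ ‖z‖ • (cauchyKernel z * toCl z * F (x + z)) := by
      rw [← integral_sub_right_eq_self (fun z : E m =>
        g₀ ‖z‖ • (cauchyKernel z * toCl z * F (x + z))) x]
      simp
    rw [htr] at key
    rw [smul_comm (-(I / c₀)) (2 : ℝ), ← smul_add] at key
    have key2 := (smul_eq_zero.1 key).resolve_left two_ne_zero
    rw [neg_smul, ← sub_eq_add_neg, sub_eq_zero] at key2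
    rw [key2, smul_smul, div_eq_mul_inv]

theorem surf_univ_ne_zero : surf m univ ≠ 0 := by
  rw [Ne, Measure.measure_univ_eq_zero]
  exact Measure.toSphere_ne_zero _

instance : IsProbabilityMeasure (sphereMeasure m) := ⟨by
  rw [sphereMeasure, Measure.smul_apply, smul_eq_mul,
    ENNReal.inv_mul_cancel surf_univ_ne_zero (measure_ne_top _ _)]⟩

theorem surf_real_univ_pos : 0 < (surf m).real univ :=
  ENNReal.toReal_pos surf_univ_ne_zero (measure_ne_top _ _)

theorem integral_sphereMeasure {F : Type*} [NormedAddCommGroup F] [NormedSpace ℝ F]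
    (Φ : Sph m → F) :
    ∫ η, Φ η ∂(sphereMeasure m) = ((surf m).real univ)⁻¹ • ∫ η, Φ η ∂(surf m) := by
  rw [sphereMeasure, integral_smul_measure, ENNReal.toReal_inv, Measure.real]

theorem cauchyKernel_mul_toCl (z : E m) :
    cauchyKernel z * toCl z = ((‖z‖ ^ (m + 1))⁻¹ * ‖z‖ ^ 2) • (1 : Cl m) := by
  rw [cauchyKernel, smul_mul_assoc, conj_toCl_mul_self, smul_smul]

theorem cauchyKernel_smul {r : ℝ} (hr : 0 < r) (z : E m) :
    r ^ m • cauchyKernel (r • z) = cauchyKernel z := by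
  rw [cauchyKernel, cauchyKernel, toCl_smul, Cl.conj_smul, smul_smul, smul_smul, norm_smul,
    Real.norm_of_nonneg hr.le]
  congr 1
  rw [mul_pow, mul_inv]
  field_simp
  ring

/-- A shell avoids the pole. The particular weight is immaterial, because it cancels between
`sphere_integral_cauchyKernel` and `integral_radial_eq`. -/
theorem exists_shell_bump {R₀ : ℝ} (hR₀ : 0 < R₀) :
    ∃ g₀ : ℝ → ℝ, Continuous g₀ ∧ HasCompactSupport g₀ ∧ tsupport g₀ ⊆ Ioo (R₀ / 2) R₀ ∧
      ∫ r, r * g₀ r ≠ 0 := by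
  let b : ContDiffBump (3 * R₀ / 4) :=
    ⟨R₀ / 16, R₀ / 8, by linarith, by linarith⟩
  have hb : tsupport b ⊆ Ioo (R₀ / 2) R₀ := by
    rw [b.tsupport_eq, Real.closedBall_eq_Icc]
    intro r hr
    simp only [b, mem_Icc] at hr
    constructor <;> linarith [hr.1, hr.2]
  have hb' : tsupport (fun r => r * b r) ⊆ Ioo (R₀ / 2) R₀ :=
    (tsupport_smul_subset_right (fun r : ℝ => r) b).trans hb
  refine ⟨b, b.continuous, b.hasCompactSupport, hb, ?_⟩
  refine (Continuous.integral_pos_of_hasCompactSupport_nonneg_nonzero (x := 3 * R₀ / 4)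
    (continuous_id.mul b.continuous) b.hasCompactSupport.mul_left ?_ ?_).ne'
  · intro r
    by_cases hr : r ∈ Ioo (R₀ / 2) R₀
    · exact mul_nonneg (by linarith [hr.1] : (0 : ℝ) ≤ r) b.nonneg
    · have := image_eq_zero_of_notMem_tsupport fun h => hr (hb' h)
      exact this.ge
  · have := b.one_of_mem_closedBall (x := 3 * R₀ / 4)
      (Metric.mem_closedBall_self b.rIn_pos.le)
    show 3 * R₀ / 4 * b (3 * R₀ / 4) ≠ 0
    rw [this]
    positivity

/-- The mean value property for the Cauchy kernel against a radial weight. -/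
theorem integral_radial_eq {R₀ : ℝ} {F : E m → Cl m}
    (hF : IsLeftMonogenicOn F (Metric.ball 0 R₀)) (hR₀ : 0 < R₀)
    {g₀ : ℝ → ℝ} (hg₀ : Continuous g₀) (hg₀c : HasCompactSupport g₀)
    (hg₀s : tsupport g₀ ⊆ Ioo (R₀ / 2) R₀) (hg₀i : ∫ r, r * g₀ r ≠ 0) :
    (∫ r, r * g₀ r)⁻¹ • ∫ z, g₀ ‖z‖ • (cauchyKernel z * toCl z * F z)
      = (surf m).real univ • F 0 := by
  set C := (∫ r, r * g₀ r)⁻¹ • ∫ z, g₀ ‖z‖ • (cauchyKernel z * toCl z * F z) with hC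
  have h1 : ∀ r ∈ Ioo 0 R₀, ∫ η, F (r • (η : E m)) ∂(surf m) = C := by
    intro r hr
    have h := sphere_integral_cauchyKernel hF (x := 0) hR₀ (by simp) hg₀ hg₀c hg₀s hg₀i
      (r := r) (by simpa using hr)
    simp only [sub_zero, zero_add, ← hC] at h
    simp only [cauchyKernel_mul_toCl, norm_smul_sph hr.1.le,
      smul_one_mul, integral_smul, smul_smul] at h
    have h2 : r ^ m * ((r ^ (m + 1))⁻¹ * r ^ 2) = r := by
      have := hr.1.ne'
      field_simp
      ring
    rw [h2] at h
    exact smul_right_injective _ hr.1.ne' h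
  have hc : ContinuousOn (fun r : ℝ => ∫ η, F (r • (η : E m)) ∂(surf m)) (Ioo (-R₀) R₀) := by
    refine continuousOn_integral_of_compact_support (k := univ) isCompact_univ ?_
      (fun p x _ hx => absurd (mem_univ x) hx)
    refine hF.1.continuousOn.comp (by fun_prop) ?_
    rintro ⟨r, η⟩ ⟨hr, -⟩
    rw [mem_ball_zero_iff]
    show ‖r • (η : E m)‖ < R₀
    rw [norm_smul, norm_coe_sph, mul_one]
    exact abs_lt.2 hr
  -- The sphere integrals equal C for all small positive radii; shrinking the sphere to its centre
  -- evaluates C.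
  have h0 : Tendsto (fun r : ℝ => ∫ η, F (r • (η : E m)) ∂(surf m)) (𝓝[>] 0)
      (𝓝 ((surf m).real univ • F 0)) := by
    have := (hc.continuousAt (Ioo_mem_nhds (by linarith : -R₀ < 0) hR₀)).tendsto
    simp only [zero_smul, integral_const] at this
    exact this.mono_left nhdsWithin_le_nhds
  have h2 : Tendsto (fun r : ℝ => ∫ η, F (r • (η : E m)) ∂(surf m)) (𝓝[>] 0) (𝓝 C) :=
    tendsto_const_nhds.congr' ((Ioo_mem_nhdsGT hR₀ |> Filter.mem_of_superset <| fun r hr =>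
      (h1 r hr).symm : _))
  exact tendsto_nhds_unique h2 h0

theorem IsLeftMonogenicOn.comp_add {F : E m → Cl m} {x : E m} {R R₀ : ℝ}
    (hF : IsLeftMonogenicOn F (Metric.ball 0 R)) (hx : ‖x‖ + R₀ ≤ R) :
    IsLeftMonogenicOn (fun z => F (x + z)) (Metric.ball 0 R₀) := by
  have hmaps : MapsTo (fun z => x + z) (Metric.ball 0 R₀) (Metric.ball 0 R) := by
    intro z hz
    rw [mem_ball_zero_iff] at hz ⊢
    exact (norm_add_le _ _).trans_lt (by linarith)
  refine ⟨hF.1.comp (contDiff_const.add contDiff_id).contDiffOn hmaps, fun z hz => ?_⟩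
  rw [dirac_comp_add, hF.2 _ (hmaps hz)]

/-- The Cauchy integral formula on the spheres centered at the origin. -/
theorem cauchy_formula {f : E m → Cl m} (hf : IsLeftMonogenicOn f (unitBall m)) {b : E m}
    (hb : ‖b‖ < 1) {r : ℝ} (hr : r ∈ Ioo (0 : ℝ) 1) :
    ∫ η, cauchyKernel ((η : E m) - b) * toCl (η : E m) * f (r • (η : E m)) ∂(sphereMeasure m)
      = f (r • b) := by
  have hrb : ‖r • b‖ < r := by
    rw [norm_smul, Real.norm_of_nonneg hr.1.le]
    nlinarith [hr.1]
  have hR₀ : 0 < 1 - ‖r • b‖ := by linarith [hr.2]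
  obtain ⟨g₀, h1, h2, h3, h4⟩ := exists_shell_bump hR₀
  have hx : ‖r • b‖ + (1 - ‖r • b‖) ≤ 1 := by linarith
  have h := sphere_integral_cauchyKernel (x := r • b) (r := r) hf hR₀ hx h1 h2 h3 h4 ⟨hrb, hr.2⟩
  have hloc := integral_radial_eq (hf.comp_add hx) hR₀ h1 h2 h3 h4
  rw [hloc, add_zero] at h
  have he : ∀ η : Sph m, cauchyKernel ((η : E m) - b) * toCl (η : E m) * f (r • (η : E m))
      = r⁻¹ • r ^ m • (cauchyKernel (r • (η : E m) - r • b) * toCl (r • (η : E m))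
        * f (r • (η : E m))) := by
    intro η
    rw [← cauchyKernel_smul hr.1 ((η : E m) - b), smul_sub, toCl_smul, mul_smul_comm,
      smul_mul_assoc, smul_mul_assoc, smul_mul_assoc, smul_comm (r ^ m) r, inv_smul_smul₀ hr.1.ne']
  simp only [he, integral_smul]
  rw [integral_sphereMeasure, smul_comm _ ((surf m).real univ)⁻¹,
    smul_comm _ ((surf m).real univ)⁻¹, h, inv_smul_smul₀ hr.1.ne',
    inv_smul_smul₀ surf_real_univ_pos.ne']

/-- The Cauchy integral vanishes at the exterior points. -/
theorem cauchy_formula_exterior {f : E m → Cl m} (hf : IsLeftMonogenicOn f (unitBall m)) {b : E m}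
    (hb : 1 < ‖b‖) {r : ℝ} (hr : r ∈ Ioo (0 : ℝ) 1) :
    ∫ η, cauchyKernel ((η : E m) - b) * toCl (η : E m) * f (r • (η : E m)) ∂(sphereMeasure m)
      = 0 := by
  have hrb : r < ‖r • b‖ := by
    rw [norm_smul, Real.norm_of_nonneg hr.1.le]
    nlinarith [hr.1]
  have hne : ∀ y ∈ Metric.ball (0 : E m) (min 1 ‖r • b‖), y - r • b ≠ 0 := by
    intro y hy h
    rw [mem_ball_zero_iff, lt_min_iff, sub_eq_zero.1 h] at hy
    exact lt_irrefl _ hy.2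
  have hsub : Metric.ball (0 : E m) (min 1 ‖r • b‖) ⊆ unitBall m :=
    Metric.ball_subset_ball (min_le_left _ _)
  have h := sphere_integral_eq_zero_of_monogenic (R := min 1 ‖r • b‖)
    (G := fun y => cauchyKernel (y - r • b)) ⟨hf.1.mono hsub, fun y hy => hf.2 y (hsub hy)⟩
    (fun y hy => ((contDiffAt_cauchyKernel (hne y hy)).comp y
      (contDiffAt_id.sub contDiffAt_const)).contDiffWithinAt)
    (fun y hy => by rw [rightDirac_comp_sub, rightDirac_cauchyKernel (hne y hy)])
    (r := r) ⟨hr.1, lt_min hr.2 hrb⟩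
  have he : ∀ η : Sph m, cauchyKernel ((η : E m) - b) * toCl (η : E m) * f (r • (η : E m))
      = r⁻¹ • r ^ m • (cauchyKernel (r • (η : E m) - r • b) * toCl (r • (η : E m))
        * f (r • (η : E m))) := by
    intro η
    rw [← cauchyKernel_smul hr.1 ((η : E m) - b), smul_sub, toCl_smul, mul_smul_comm,
      smul_mul_assoc, smul_mul_assoc, smul_mul_assoc, smul_comm (r ^ m) r, inv_smul_smul₀ hr.1.ne']
  simp only [he, integral_smul]
  rw [integral_sphereMeasure, h, smul_zero, smul_zero, smul_zero]

/-! ### The Poisson kernel and the Poisson integral. -/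

/-- The Poisson kernel of the unit ball. -/
def poisson (b : E m) (η : E m) : ℝ := (1 - ‖b‖ ^ 2) * (‖η - b‖ ^ (m + 1))⁻¹

theorem cauchyKernel_mul_toCl_sph (b : E m) (η : Sph m) :
    cauchyKernel ((η : E m) - b) * toCl (η : E m)
      = (‖(η : E m) - b‖ ^ (m + 1))⁻¹ • (1 - Cl.conj (toCl b) * toCl (η : E m)) := by
  rw [cauchyKernel, smul_mul_assoc, toCl_sub, Cl.conj_sub, sub_mul, conj_toCl_mul_self,
    norm_coe_sph]
  simp

/-- The unit sphere is an Apollonius sphere for b and its inverse point b / ‖b‖². -/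
theorem norm_sub_inversion {b : E m} (hb : b ≠ 0) (η : Sph m) :
    ‖b‖ * ‖(η : E m) - (‖b‖ ^ 2)⁻¹ • b‖ = ‖(η : E m) - b‖ := by
  have h0 : ‖b‖ ≠ 0 := norm_ne_zero_iff.2 hb
  have h : (‖b‖ * ‖(η : E m) - (‖b‖ ^ 2)⁻¹ • b‖) ^ 2 = ‖(η : E m) - b‖ ^ 2 := by
    rw [mul_pow, norm_sub_sq_real, norm_sub_sq_real, norm_coe_sph, norm_smul, inner_smul_right,
      Real.norm_of_nonneg (by positivity)]
    field_simp
    ring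
  exact (pow_left_inj₀ (by positivity) (norm_nonneg _) two_ne_zero).1 h

theorem sub_ne_zero_of_sph {b : E m} (hb : ‖b‖ < 1) (η : Sph m) : (η : E m) - b ≠ 0 := by
  intro h
  have := norm_coe_sph η
  rw [sub_eq_zero.1 h] at this
  exact hb.ne this

theorem continuous_inv_norm_pow {b : E m} (hb : ‖b‖ ≠ 1) :
    Continuous fun η : Sph m => (‖(η : E m) - b‖ ^ (m + 1))⁻¹ := by
  refine Continuous.inv₀ (by fun_prop) fun η => pow_ne_zero _ ?_
  rw [norm_ne_zero_iff, sub_ne_zero]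
  intro h
  exact hb (by rw [← h, norm_coe_sph])

theorem continuous_poisson {b : E m} (hb : ‖b‖ < 1) :
    Continuous fun η : Sph m => poisson b η :=
  continuous_const.mul (continuous_inv_norm_pow hb.ne)

theorem continuous_cauchyKernel_sph {b : E m} (hb : ‖b‖ ≠ 1) :
    Continuous fun η : Sph m => cauchyKernel ((η : E m) - b) * toCl (η : E m) := by
  simp only [cauchyKernel_mul_toCl_sph]
  exact (continuous_inv_norm_pow hb).smul (by fun_prop)

theorem continuous_dilate {f : E m → Cl m} (hf : IsLeftMonogenicOn f (unitBall m)) {r : ℝ}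
    (hr : r ∈ Ico (0 : ℝ) 1) : Continuous fun η : Sph m => f (r • (η : E m)) := by
  refine hf.1.continuousOn.comp_continuous (by fun_prop) fun η => ?_
  rw [unitBall, mem_ball_zero_iff, norm_smul_sph hr.1]
  exact hr.2

theorem integrable_sph {F : Type*} [NormedAddCommGroup F] {Φ : Sph m → F} (hΦ : Continuous Φ) :
    Integrable Φ (sphereMeasure m) :=
  hΦ.integrable_of_hasCompactSupport (HasCompactSupport.of_compactSpace _)

/-- The Poisson integral formula. -/
theorem poisson_formula {f : E m → Cl m} (hf : IsLeftMonogenicOn f (unitBall m)) {b : E m}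
    (hb : ‖b‖ < 1) {r : ℝ} (hr : r ∈ Ioo (0 : ℝ) 1) :
    ∫ η, poisson b (η : E m) • f (r • (η : E m)) ∂(sphereMeasure m) = f (r • b) := by
  have hc := cauchy_formula hf hb hr
  rcases eq_or_ne b 0 with rfl | hb0
  · rw [← hc]
    refine integral_congr_ae (Eventually.of_forall fun η => ?_)
    simp only [cauchyKernel_mul_toCl_sph]
    simp [poisson]
  · have hn0 : 0 < ‖b‖ := norm_pos_iff.2 hb0
    have hb' : 1 < ‖(‖b‖ ^ 2)⁻¹ • b‖ := by
      rw [norm_smul, Real.norm_of_nonneg (by positivity)]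
      have : (‖b‖ ^ 2)⁻¹ * ‖b‖ = ‖b‖⁻¹ := by field_simp
      rw [this]
      exact (one_lt_inv₀ hn0).2 hb
    have he := cauchy_formula_exterior hf hb' hr
    have hfc := continuous_dilate hf ⟨hr.1.le, hr.2⟩
    have i1 : Integrable (fun η : Sph m => cauchyKernel ((η : E m) - b) * toCl (η : E m)
        * f (r • (η : E m))) (sphereMeasure m) :=
      integrable_sph ((continuous_cauchyKernel_sph hb.ne).mul hfc)
    have i2 : Integrable (fun η : Sph m => (‖b‖ ^ 2 * (‖b‖ ^ (m + 1))⁻¹) •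
        (cauchyKernel ((η : E m) - (‖b‖ ^ 2)⁻¹ • b) * toCl (η : E m) * f (r • (η : E m))))
        (sphereMeasure m) :=
      integrable_sph (((continuous_cauchyKernel_sph hb'.ne').mul hfc).const_smul
        (‖b‖ ^ 2 * (‖b‖ ^ (m + 1))⁻¹))
    -- The Poisson kernel is the Cauchy kernel at b minus a multiple of the one at the inverse
    -- point, with the factor that cancels the terms conj(b) η. The second kernel integrates to 0
    -- because its pole lies outside the ball.
    have hP : ∀ η : Sph m, poisson b (η : E m) • f (r • (η : E m))
        = cauchyKernel ((η : E m) - b) * toCl (η : E m) * f (r • (η : E m))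
          - (‖b‖ ^ 2 * (‖b‖ ^ (m + 1))⁻¹) • (cauchyKernel ((η : E m) - (‖b‖ ^ 2)⁻¹ • b)
            * toCl (η : E m) * f (r • (η : E m))) := by
      intro η
      rw [cauchyKernel_mul_toCl_sph, cauchyKernel_mul_toCl_sph, poisson, ← norm_sub_inversion hb0 η,
        toCl_smul, Cl.conj_smul, ← smul_mul_assoc, ← sub_mul, smul_smul]
      have hk : ‖b‖ ^ 2 * (‖b‖ ^ (m + 1))⁻¹ * (‖(η : E m) - (‖b‖ ^ 2)⁻¹ • b‖ ^ (m + 1))⁻¹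
          = ((‖b‖ * ‖(η : E m) - (‖b‖ ^ 2)⁻¹ • b‖) ^ (m + 1))⁻¹ * ‖b‖ ^ 2 := by
        rw [mul_pow, mul_inv]
        ring
      rw [hk, mul_smul _ (‖b‖ ^ 2) (_ : Cl m), ← smul_sub, smul_sub (‖b‖ ^ 2),
        smul_mul_assoc (‖b‖ ^ 2)⁻¹, smul_smul (‖b‖ ^ 2),
        mul_inv_cancel₀ (by positivity : ‖b‖ ^ 2 ≠ 0), one_smul, sub_sub_sub_cancel_right,
        mul_comm (1 - ‖b‖ ^ 2), mul_smul, smul_mul_assoc, sub_mul, one_mul, smul_one_mul, sub_smul,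
        one_smul]
    simp only [hP]
    rw [integral_sub i1 i2, integral_smul, he, smul_zero, sub_zero, hc]

theorem isLeftMonogenicOn_const (c : Cl m) (U : Set (E m)) :
    IsLeftMonogenicOn (fun _ => c) U :=
  ⟨contDiffOn_const, fun x _ => by simp [dirac]⟩

theorem integral_poisson {b : E m} (hb : ‖b‖ < 1) :
    ∫ η : Sph m, poisson b (η : E m) ∂(sphereMeasure m) = 1 := by
  have h := poisson_formula (isLeftMonogenicOn_const (1 : Cl m) (unitBall m)) hb
    (r := 1 / 2) ⟨by norm_num, by norm_num⟩
  rw [integral_smul_const] at h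
  have h1 : ((∫ η : Sph m, poisson b (η : E m) ∂(sphereMeasure m)) - 1) • (1 : Cl m) = 0 := by
    rw [sub_smul, h, one_smul, sub_self]
  exact sub_eq_zero.1 ((smul_eq_zero.1 h1).resolve_right one_ne_zero)

theorem poisson_nonneg {b : E m} (hb : ‖b‖ < 1) (η : E m) : 0 ≤ poisson b η := by
  have : 0 ≤ 1 - ‖b‖ ^ 2 := by nlinarith [norm_nonneg b]
  exact mul_nonneg this (by positivity)

/-! ### Monotonicity and comparison of the L² means. -/

theorem poisson_symm {t : ℝ} (η ζ : Sph m) :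
    poisson (t • (η : E m)) (ζ : E m) = poisson (t • (ζ : E m)) (η : E m) := by
  have h : ‖(ζ : E m) - t • (η : E m)‖ = ‖(η : E m) - t • (ζ : E m)‖ := by
    refine (pow_left_inj₀ (norm_nonneg _) (norm_nonneg _) two_ne_zero).1 ?_
    rw [norm_sub_sq_real, norm_sub_sq_real, norm_smul, norm_smul, norm_coe_sph, norm_coe_sph,
      inner_smul_right, inner_smul_right, real_inner_comm]
  rw [poisson, poisson, h, norm_smul, norm_smul, norm_coe_sph, norm_coe_sph]

theorem norm_smul_sph_lt {t : ℝ} (ht : t ∈ Ico (0 : ℝ) 1) (η : Sph m) : ‖t • (η : E m)‖ < 1 := by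
  rw [norm_smul_sph ht.1]
  exact ht.2

theorem continuous_poisson_prod {t : ℝ} (ht : t ∈ Ico (0 : ℝ) 1) :
    Continuous fun p : Sph m × Sph m => poisson (t • (p.1 : E m)) (p.2 : E m) := by
  unfold poisson
  refine Continuous.mul (by fun_prop) (Continuous.inv₀ (by fun_prop) fun p => pow_ne_zero _ ?_)
  exact norm_ne_zero_iff.2 (sub_ne_zero_of_sph (norm_smul_sph_lt ht p.1) p.2)

/-- Dilation by t acts on sphere values as the Poisson operator, which is self-adjoint because its
kernel is symmetric; Fubini does the rest. -/
theorem inner_dilate_symm {f g : E m → Cl m} (hf : IsLeftMonogenicOn f (unitBall m))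
    (hg : IsLeftMonogenicOn g (unitBall m)) {t r s : ℝ} (ht : t ∈ Ico (0 : ℝ) 1)
    (hr : r ∈ Ioo (0 : ℝ) 1) (hs : s ∈ Ioo (0 : ℝ) 1) :
    ∫ η : Sph m, inner ℝ (f ((r * t) • (η : E m))) (g (s • (η : E m))) ∂(sphereMeasure m)
      = ∫ η : Sph m, inner ℝ (f (r • (η : E m))) (g ((s * t) • (η : E m)))
        ∂(sphereMeasure m) := by
  have hfc := continuous_dilate hf ⟨hr.1.le, hr.2⟩
  have hgc := continuous_dilate hg ⟨hs.1.le, hs.2⟩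
  have h1 : ∀ η : Sph m, inner ℝ (f ((r * t) • (η : E m))) (g (s • (η : E m)))
      = ∫ ζ : Sph m, poisson (t • (η : E m)) (ζ : E m) *
        inner ℝ (f (r • (ζ : E m))) (g (s • (η : E m))) ∂(sphereMeasure m) := by
    intro η
    rw [mul_smul, ← poisson_formula hf (norm_smul_sph_lt ht η) hr, real_inner_comm]
    have hi : Integrable (fun ζ : Sph m => poisson (t • (η : E m)) (ζ : E m) • f (r • (ζ : E m)))
        (sphereMeasure m) :=
      integrable_sph ((continuous_poisson (norm_smul_sph_lt ht η)).smul hfc)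
    rw [← integral_inner hi]
    refine integral_congr_ae (Eventually.of_forall fun ζ => ?_)
    simp only [inner_smul_right, real_inner_comm]
  have h2 : ∀ ζ : Sph m, inner ℝ (f (r • (ζ : E m))) (g ((s * t) • (ζ : E m)))
      = ∫ η : Sph m, poisson (t • (η : E m)) (ζ : E m) *
        inner ℝ (f (r • (ζ : E m))) (g (s • (η : E m))) ∂(sphereMeasure m) := by
    intro ζ
    rw [mul_smul, ← poisson_formula hg (norm_smul_sph_lt ht ζ) hs]
    have hi : Integrable (fun η : Sph m => poisson (t • (ζ : E m)) (η : E m) • g (s • (η : E m)))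
        (sphereMeasure m) :=
      integrable_sph ((continuous_poisson (norm_smul_sph_lt ht ζ)).smul hgc)
    rw [← integral_inner hi]
    refine integral_congr_ae (Eventually.of_forall fun η => ?_)
    simp only [inner_smul_right, poisson_symm η ζ]
  simp only [h1, h2]
  refine integral_integral_swap ?_
  refine Continuous.integrable_of_hasCompactSupport ?_ (HasCompactSupport.of_compactSpace _)
  exact (continuous_poisson_prod ht).mul
    ((hfc.comp continuous_snd).inner (hgc.comp continuous_fst))

/-- Jensen's inequality for the probability density given by the Poisson kernel, obtained from the
nonnegativity of the variance of ‖f‖ about its mean c. -/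
theorem norm_sq_dilate_le {f : E m → Cl m} (hf : IsLeftMonogenicOn f (unitBall m)) {b : E m}
    (hb : ‖b‖ < 1) {r : ℝ} (hr : r ∈ Ioo (0 : ℝ) 1) :
    ‖f (r • b)‖ ^ 2
      ≤ ∫ ζ : Sph m, poisson b (ζ : E m) * ‖f (r • (ζ : E m))‖ ^ 2 ∂(sphereMeasure m) := by
  have hfc := (continuous_dilate hf ⟨hr.1.le, hr.2⟩).norm
  have hPc := continuous_poisson hb
  set c := ∫ ζ : Sph m, poisson b (ζ : E m) * ‖f (r • (ζ : E m))‖ ∂(sphereMeasure m) with hc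
  have h1 : ‖f (r • b)‖ ≤ c := by
    rw [← poisson_formula hf hb hr]
    refine (norm_integral_le_integral_norm _).trans_eq ?_
    refine integral_congr_ae (Eventually.of_forall fun ζ => ?_)
    simp only [norm_smul, Real.norm_of_nonneg (poisson_nonneg hb _)]
  have h2 : 0 ≤ ∫ ζ : Sph m, poisson b (ζ : E m) * (‖f (r • (ζ : E m))‖ - c) ^ 2
      ∂(sphereMeasure m) :=
    integral_nonneg fun ζ => mul_nonneg (poisson_nonneg hb _) (sq_nonneg _)
  have h3 : ∀ ζ : Sph m, poisson b (ζ : E m) * (‖f (r • (ζ : E m))‖ - c) ^ 2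
      = poisson b (ζ : E m) * ‖f (r • (ζ : E m))‖ ^ 2
        - (2 * c) * (poisson b (ζ : E m) * ‖f (r • (ζ : E m))‖) + c ^ 2 * poisson b (ζ : E m) := by
    intro ζ
    ring
  have i1 : Integrable (fun ζ : Sph m => poisson b (ζ : E m) * ‖f (r • (ζ : E m))‖ ^ 2)
      (sphereMeasure m) := integrable_sph (hPc.mul (hfc.pow 2))
  have i2 : Integrable (fun ζ : Sph m => (2 * c) * (poisson b (ζ : E m) * ‖f (r • (ζ : E m))‖))
      (sphereMeasure m) := integrable_sph (continuous_const.mul (hPc.mul hfc))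
  have i3 : Integrable (fun ζ : Sph m => c ^ 2 * poisson b (ζ : E m)) (sphereMeasure m) :=
    integrable_sph (continuous_const.mul hPc)
  have i4 : Integrable (fun ζ : Sph m => poisson b (ζ : E m) * ‖f (r • (ζ : E m))‖ ^ 2
      - (2 * c) * (poisson b (ζ : E m) * ‖f (r • (ζ : E m))‖)) (sphereMeasure m) := i1.sub i2
  simp only [h3] at h2
  rw [integral_add i4 i3, integral_sub i1 i2, integral_const_mul, integral_const_mul,
    integral_poisson hb, ← hc] at h2
  have h4 : ‖f (r • b)‖ ^ 2 ≤ c ^ 2 := pow_le_pow_left₀ (norm_nonneg _) h1 2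
  have h5 : ∀ x : ℝ, 0 ≤ x - 2 * c * c + c ^ 2 * 1 → c ^ 2 ≤ x := fun x hx => by linarith
  exact h4.trans (h5 _ h2)

/-- The square of the `L²` mean of `f` on the sphere of radius `r`. -/
def meanSq (f : E m → Cl m) (r : ℝ) : ℝ :=
  ∫ η : Sph m, ‖f (r • (η : E m))‖ ^ 2 ∂(sphereMeasure m)

/-- The pointwise Jensen bound is integrated over the sphere; by symmetry the Poisson kernel
integrates to 1 in its other variable as well. -/
theorem meanSq_mul_le {f : E m → Cl m} (hf : IsLeftMonogenicOn f (unitBall m)) {t r : ℝ}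
    (ht : t ∈ Ico (0 : ℝ) 1) (hr : r ∈ Ioo (0 : ℝ) 1) : meanSq f (r * t) ≤ meanSq f r := by
  have hfc := continuous_dilate hf ⟨hr.1.le, hr.2⟩
  have hrt : r * t ∈ Ico (0 : ℝ) 1 :=
    ⟨mul_nonneg hr.1.le ht.1, by nlinarith [hr.1, hr.2, ht.1, ht.2]⟩
  have hcp : Continuous fun p : Sph m × Sph m =>
      poisson (t • (p.1 : E m)) (p.2 : E m) * ‖f (r • (p.2 : E m))‖ ^ 2 :=
    (continuous_poisson_prod ht).mul ((hfc.comp continuous_snd).norm.pow 2)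
  have hip : Integrable (Function.uncurry fun η ζ : Sph m =>
      poisson (t • (η : E m)) (ζ : E m) * ‖f (r • (ζ : E m))‖ ^ 2)
      ((sphereMeasure m).prod (sphereMeasure m)) :=
    hcp.integrable_of_hasCompactSupport (HasCompactSupport.of_compactSpace _)
  calc meanSq f (r * t) ≤ ∫ η : Sph m, ∫ ζ : Sph m, poisson (t • (η : E m)) (ζ : E m)
        * ‖f (r • (ζ : E m))‖ ^ 2 ∂(sphereMeasure m) ∂(sphereMeasure m) := by
        refine integral_mono (integrable_sph ((continuous_dilate hf hrt).norm.pow 2))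
          hip.integral_prod_left fun η => ?_
        simp only [mul_smul]
        exact norm_sq_dilate_le hf (norm_smul_sph_lt ht η) hr
    _ = ∫ ζ : Sph m, ∫ η : Sph m, poisson (t • (η : E m)) (ζ : E m)
        * ‖f (r • (ζ : E m))‖ ^ 2 ∂(sphereMeasure m) ∂(sphereMeasure m) :=
        integral_integral_swap hip
    _ = meanSq f r := by
        refine integral_congr_ae (Eventually.of_forall fun ζ => ?_)
        simp only [integral_mul_const, fun η => poisson_symm (t := t) η ζ,
          integral_poisson (norm_smul_sph_lt ht ζ), one_mul]

theorem meanSq_mono {f : E m → Cl m} (hf : IsLeftMonogenicOn f (unitBall m)) {r s : ℝ}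
    (hr : r ∈ Ioo (0 : ℝ) 1) (hs : s ∈ Ioo (0 : ℝ) 1) (hrs : r ≤ s) :
    meanSq f r ≤ meanSq f s := by
  rcases hrs.eq_or_lt with rfl | h
  · exact le_rfl
  · have := meanSq_mul_le hf (t := r / s) ⟨(div_pos hr.1 hs.1).le, (div_lt_one hs.1).2 h⟩ hs
    rwa [mul_div_cancel₀ _ hs.1.ne'] at this

/-- Let t be the geometric mean of r and s. Since r/t = t/s, `inner_dilate_symm` turns the mixed
inner product into the mean at t, which is at least the mean at r. -/
theorem meanSq_le_inner {f : E m → Cl m} (hf : IsLeftMonogenicOn f (unitBall m)) {r s : ℝ}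
    (hr : r ∈ Ioo (0 : ℝ) 1) (hs : s ∈ Ioo (0 : ℝ) 1) (hrs : r < s) :
    meanSq f r ≤ ∫ η : Sph m, inner ℝ (f (r • (η : E m))) (f (s • (η : E m)))
      ∂(sphereMeasure m) := by
  set t := √(r * s) with ht
  have hrs0 : 0 < r * s := mul_pos hr.1 hs.1
  have ht0 : 0 < t := Real.sqrt_pos.2 hrs0
  have htt : t * t = r * s := Real.mul_self_sqrt hrs0.le
  have hrt : r < t := Real.lt_sqrt_of_sq_lt (by nlinarith [hr.1])
  have hts : t < s := (Real.sqrt_lt' hs.1).2 (by nlinarith [hs.1])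
  have ht1 : t ∈ Ioo (0 : ℝ) 1 := ⟨ht0, hts.trans hs.2⟩
  have h := inner_dilate_symm hf hf (t := r / t) (r := t) (s := s)
    ⟨(div_pos hr.1 ht0).le, (div_lt_one ht0).2 hrt⟩ ht1 hs
  have e2 : s * (r / t) = t := by
    rw [← mul_div_assoc, div_eq_iff ht0.ne', htt, mul_comm]
  rw [mul_div_cancel₀ _ ht0.ne', e2] at h
  rw [h]
  refine (meanSq_mono hf hr ht1 hrt.le).trans_eq ?_
  simp only [real_inner_self_eq_norm_sq]
  rfl

theorem memLp_of_continuous {Φ : Sph m → Cl m} (hΦ : Continuous Φ) :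
    MemLp Φ 2 (sphereMeasure m) := by
  refine (hΦ.memLp_top_of_hasCompactSupport (HasCompactSupport.of_compactSpace _) _).mono_exponent
    le_top

theorem eLpNorm_dilate {f : E m → Cl m} (hf : IsLeftMonogenicOn f (unitBall m)) {r : ℝ}
    (hr : r ∈ Ioo (0 : ℝ) 1) :
    eLpNorm (fun η : Sph m => f (r • (η : E m))) 2 (sphereMeasure m)
      = ENNReal.ofReal (√(meanSq f r)) := by
  rw [(memLp_of_continuous (continuous_dilate hf ⟨hr.1.le, hr.2⟩)).eLpNorm_eq_integral_rpow_norm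
    two_ne_zero ENNReal.ofNat_ne_top, Real.sqrt_eq_rpow, meanSq]
  simp

/-! ### L² boundary functions. -/

theorem cauchySeq_of_norm_sq_le {H : Type*} [NormedAddCommGroup H] {x : ℕ → H} {u : ℕ → ℝ}
    (hu : BddAbove (range u)) (h : ∀ n k, n ≤ k → ‖x n - x k‖ ^ 2 ≤ u k - u n) : CauchySeq x := by
  have hmono : Monotone u := fun n k hnk => by
    have := h n k hnk
    nlinarith [sq_nonneg ‖x n - x k‖]
  have hlim := tendsto_atTop_ciSup hmono hu
  rw [Metric.cauchySeq_iff']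
  intro ε hε
  have hε2 : (⨆ i, u i) - ε ^ 2 < ⨆ i, u i := by
    have := pow_pos hε 2
    linarith
  obtain ⟨N, hN⟩ := (hlim.eventually_const_lt hε2).exists
  refine ⟨N, fun n hn => ?_⟩
  rw [dist_comm, dist_eq_norm]
  have h1 := h N n hn
  have h2 := le_ciSup hu n
  exact lt_of_pow_lt_pow_left₀ 2 hε.le (by linarith)

/-- A sequence of radii that increases to `1`. -/
def radius (n : ℕ) : ℝ := 1 - 1 / ((n : ℝ) + 2)

theorem radius_mem (n : ℕ) : radius n ∈ Ioo (0 : ℝ) 1 := by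
  have h : (0 : ℝ) < (n : ℝ) + 2 := by positivity
  have h1 : 1 / ((n : ℝ) + 2) < 1 := by
    rw [div_lt_one h]
    linarith [(Nat.cast_nonneg n : (0 : ℝ) ≤ n)]
  have h2 : 0 < 1 / ((n : ℝ) + 2) := by positivity
  exact ⟨by unfold radius; linarith, by unfold radius; linarith⟩

theorem radius_strictMono : StrictMono radius := by
  intro n k h
  have h' : (n : ℝ) < k := Nat.cast_lt.2 h
  unfold radius
  have : 1 / ((k : ℝ) + 2) < 1 / ((n : ℝ) + 2) :=
    one_div_lt_one_div_of_lt (by positivity) (by linarith)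
  linarith

theorem tendsto_radius : Tendsto radius atTop (𝓝 1) := by
  have h : Tendsto (fun n : ℕ => 1 / ((n : ℝ) + 2)) atTop (𝓝 0) := by
    have := (tendsto_one_div_add_atTop_nhds_zero_nat (𝕜 := ℝ)).comp (tendsto_add_atTop_nat 1)
    refine this.congr fun n => ?_
    simp only [Function.comp_apply]
    push_cast
    ring
  have h1 := h.const_sub 1
  rwa [sub_zero] at h1

theorem meanSq_nonneg (f : E m → Cl m) (r : ℝ) : 0 ≤ meanSq f r :=
  integral_nonneg fun _ => sq_nonneg _

theorem sqrt_meanSq_le {f : E m → Cl m} (hf : MemHardy f) {r : ℝ} (hr : r ∈ Ioo (0 : ℝ) 1) :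
    √(meanSq f r) ≤ (hardyNorm f).toReal := by
  have h : ENNReal.ofReal (√(meanSq f r)) ≤ hardyNorm f := by
    rw [← eLpNorm_dilate hf.1 hr]
    exact le_iSup₂ (f := fun r _ => eLpNorm (fun η : Sph m => f (r • (η : E m))) 2
      (sphereMeasure m)) r hr
  rw [← ENNReal.toReal_ofReal (Real.sqrt_nonneg _)]
  exact ENNReal.toReal_mono hf.2.ne h

theorem meanSq_le {f : E m → Cl m} (hf : MemHardy f) {r : ℝ} (hr : r ∈ Ioo (0 : ℝ) 1) :
    meanSq f r ≤ (hardyNorm f).toReal ^ 2 := by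
  rw [← Real.sq_sqrt (meanSq_nonneg f r)]
  exact pow_le_pow_left₀ (Real.sqrt_nonneg _) (sqrt_meanSq_le hf hr) 2

/-- The restriction of `f` to the sphere of radius `radius n`, as an element of `L²`. -/
def dilateLp {f : E m → Cl m} (hf : IsLeftMonogenicOn f (unitBall m)) (n : ℕ) :
    Lp (Cl m) 2 (sphereMeasure m) :=
  (memLp_of_continuous (continuous_dilate hf ⟨(radius_mem n).1.le, (radius_mem n).2⟩)).toLp _

theorem norm_dilateLp {f : E m → Cl m} (hf : IsLeftMonogenicOn f (unitBall m)) (n : ℕ) :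
    ‖dilateLp hf n‖ = √(meanSq f (radius n)) := by
  rw [dilateLp, Lp.norm_toLp, eLpNorm_dilate hf (radius_mem n),
    ENNReal.toReal_ofReal (Real.sqrt_nonneg _)]

theorem inner_dilateLp {f : E m → Cl m} (hf : IsLeftMonogenicOn f (unitBall m)) (n k : ℕ) :
    inner ℝ (dilateLp hf n) (dilateLp hf k) =
      ∫ η : Sph m, inner ℝ (f (radius n • (η : E m))) (f (radius k • (η : E m)))
        ∂(sphereMeasure m) := by
  rw [L2.inner_def]
  refine integral_congr_ae ?_
  filter_upwards [MemLp.coeFn_toLp (memLp_of_continuous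
    (continuous_dilate hf ⟨(radius_mem n).1.le, (radius_mem n).2⟩)),
    MemLp.coeFn_toLp (memLp_of_continuous
    (continuous_dilate hf ⟨(radius_mem k).1.le, (radius_mem k).2⟩))] with η h1 h2
  rw [dilateLp, dilateLp, h1, h2]

/-- Expanding the square and using `meanSq_le_inner`, the squared distance of two dilates is at most
the difference of their means. The means increase and are bounded by the squared Hardy norm. -/
theorem exists_tendsto_dilateLp {f : E m → Cl m} (hf : MemHardy f) :
    ∃ φ : Lp (Cl m) 2 (sphereMeasure m), Tendsto (dilateLp hf.1) atTop (𝓝 φ) := by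
  refine cauchySeq_tendsto_of_complete (cauchySeq_of_norm_sq_le
    (u := fun n => meanSq f (radius n)) ?_ ?_)
  · refine ⟨(hardyNorm f).toReal ^ 2, ?_⟩
    rintro _ ⟨n, rfl⟩
    exact meanSq_le hf (radius_mem n)
  · intro n k hnk
    rcases hnk.eq_or_lt with rfl | h
    · simp
    · rw [norm_sub_sq_real, norm_dilateLp, norm_dilateLp, Real.sq_sqrt (meanSq_nonneg _ _),
        Real.sq_sqrt (meanSq_nonneg _ _), inner_dilateLp]
      have := meanSq_le_inner hf.1 (radius_mem n) (radius_mem k) (radius_strictMono h)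
      linarith

/-- The means increase with the radius, so the supremum is the limit along `radius`. -/
theorem hardyNorm_eq_of_tendsto {f : E m → Cl m} (hf : MemHardy f)
    {φ : Lp (Cl m) 2 (sphereMeasure m)} (hφ : Tendsto (dilateLp hf.1) atTop (𝓝 φ)) :
    (hardyNorm f).toReal = ‖φ‖ := by
  have hn := hφ.norm
  simp only [norm_dilateLp] at hn
  refine le_antisymm ?_ ?_
  · have h : hardyNorm f ≤ ENNReal.ofReal ‖φ‖ := by
      refine iSup₂_le fun r hr => ?_
      rw [eLpNorm_dilate hf.1 hr]
      refine ENNReal.ofReal_le_ofReal (ge_of_tendsto hn ?_)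
      filter_upwards [tendsto_radius.eventually_const_lt hr.2] with n hn
      exact Real.sqrt_le_sqrt (meanSq_mono hf.1 hr (radius_mem n) hn.le)
    exact ENNReal.toReal_le_of_le_ofReal (norm_nonneg _) h
  · exact le_of_tendsto' hn fun n => sqrt_meanSq_le hf (radius_mem n)

/-- A continuous kernel on the compact sphere is bounded, and on a probability space the L¹ norm is
at most the L² norm. -/
theorem tendsto_integral_mul {K : Sph m → Cl m} (hK : Continuous K)
    {ψ : ℕ → Lp (Cl m) 2 (sphereMeasure m)} {φ : Lp (Cl m) 2 (sphereMeasure m)}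
    (hψ : Tendsto ψ atTop (𝓝 φ)) :
    Tendsto (fun n => ∫ η, K η * ψ n η ∂(sphereMeasure m)) atTop
      (𝓝 (∫ η, K η * φ η ∂(sphereMeasure m))) := by
  obtain ⟨C, hC⟩ := isCompact_univ.exists_bound_of_continuousOn hK.continuousOn
  have hint : ∀ ψ : Lp (Cl m) 2 (sphereMeasure m),
      Integrable (fun η => K η * ψ η) (sphereMeasure m) := by
    intro ψ
    have h1 : Integrable ψ (sphereMeasure m) := (Lp.memLp ψ).integrable one_le_two
    refine Integrable.mono' (h1.norm.const_mul (Cl.mulBound m * C))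
      (hK.aestronglyMeasurable.mul h1.aestronglyMeasurable) (Eventually.of_forall fun η => ?_)
    refine (Cl.norm_mul_le_mulBound _ _).trans ?_
    exact mul_le_mul_of_nonneg_right
      (mul_le_mul_of_nonneg_left (hC η (mem_univ _)) Cl.mulBound_nonneg) (norm_nonneg _)
  rw [tendsto_iff_norm_sub_tendsto_zero] at hψ ⊢
  have hb : ∀ n, ‖(∫ η, K η * ψ n η ∂(sphereMeasure m)) - ∫ η, K η * φ η ∂(sphereMeasure m)‖
      ≤ Cl.mulBound m * C * ‖ψ n - φ‖ := by
    intro n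
    have h1 : Integrable (ψ n - φ : Lp (Cl m) 2 (sphereMeasure m)) (sphereMeasure m) :=
      (Lp.memLp (ψ n - φ)).integrable one_le_two
    have hC0 : 0 ≤ C := by
      obtain ⟨η⟩ : Nonempty (Sph m) :=
        (NormedSpace.sphere_nonempty.2 zero_le_one : (Metric.sphere (0 : E m) 1).Nonempty).to_subtype
      exact (norm_nonneg _).trans (hC η (mem_univ _))
    rw [← integral_sub (hint _) (hint _)]
    calc ‖∫ η, (K η * ψ n η - K η * φ η) ∂(sphereMeasure m)‖
        ≤ ∫ η, Cl.mulBound m * C * ‖(ψ n - φ : Lp (Cl m) 2 (sphereMeasure m)) η‖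
          ∂(sphereMeasure m) := by
          refine norm_integral_le_of_norm_le (h1.norm.const_mul _) ?_
          filter_upwards [Lp.coeFn_sub (ψ n) φ] with η hη
          rw [hη, Pi.sub_apply, ← mul_sub]
          refine (Cl.norm_mul_le_mulBound _ _).trans ?_
          exact mul_le_mul_of_nonneg_right
            (mul_le_mul_of_nonneg_left (hC η (mem_univ _)) Cl.mulBound_nonneg) (norm_nonneg _)
      _ = Cl.mulBound m * C * (eLpNorm (ψ n - φ : Lp (Cl m) 2 (sphereMeasure m)) 1
          (sphereMeasure m)).toReal := by
          rw [integral_const_mul, integral_norm_eq_lintegral_enorm h1.aestronglyMeasurable,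
            eLpNorm_one_eq_lintegral_enorm]
      _ ≤ Cl.mulBound m * C * ‖ψ n - φ‖ := by
          refine mul_le_mul_of_nonneg_left ?_ (mul_nonneg Cl.mulBound_nonneg hC0)
          rw [Lp.norm_def]
          exact ENNReal.toReal_mono (Lp.eLpNorm_ne_top _)
            (eLpNorm_le_eLpNorm_of_exponent_le one_le_two h1.aestronglyMeasurable)
  refine squeeze_zero (fun n => norm_nonneg _) hb ?_
  simpa using hψ.const_mul (Cl.mulBound m * C)

theorem tendsto_integral_mul_dilate {K : Sph m → Cl m} (hK : Continuous K) {f : E m → Cl m}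
    (hf : MemHardy f) {φ : Lp (Cl m) 2 (sphereMeasure m)}
    (hφ : Tendsto (dilateLp hf.1) atTop (𝓝 φ)) :
    Tendsto (fun n => ∫ η, K η * f (radius n • (η : E m)) ∂(sphereMeasure m)) atTop
      (𝓝 (∫ η, K η * φ η ∂(sphereMeasure m))) := by
  refine (tendsto_integral_mul hK hφ).congr fun n => integral_congr_ae ?_
  filter_upwards [MemLp.coeFn_toLp (memLp_of_continuous
    (continuous_dilate hf.1 ⟨(radius_mem n).1.le, (radius_mem n).2⟩))] with η h
  rw [dilateLp, h]

theorem tendsto_apply_radius {f : E m → Cl m} (hf : MemHardy f) {b : E m} (hb : ‖b‖ < 1) :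
    Tendsto (fun n => f (radius n • b)) atTop (𝓝 (f b)) := by
  have h1 : ContinuousAt f b :=
    hf.1.1.continuousOn.continuousAt (Metric.isOpen_ball.mem_nhds (mem_ball_zero_iff.2 hb))
  have h2 : Tendsto (fun n => radius n • b) atTop (𝓝 b) := by
    simpa using tendsto_radius.smul_const b
  exact h1.tendsto.comp h2

theorem eq_poisson_integral {f : E m → Cl m} (hf : MemHardy f)
    {φ : Lp (Cl m) 2 (sphereMeasure m)} (hφ : Tendsto (dilateLp hf.1) atTop (𝓝 φ)) {b : E m}
    (hb : ‖b‖ < 1) : f b = ∫ η : Sph m, poisson b (η : E m) • φ η ∂(sphereMeasure m) := by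
  have hc : Continuous fun η : Sph m => poisson b (η : E m) • (1 : Cl m) :=
    (continuous_poisson hb).smul continuous_const
  have h := tendsto_integral_mul_dilate hc hf hφ
  simp only [smul_one_mul, poisson_formula hf.1 hb (radius_mem _)] at h
  exact tendsto_nhds_unique (tendsto_apply_radius hf hb) h

theorem eq_cauchy_integral {f : E m → Cl m} (hf : MemHardy f)
    {φ : Lp (Cl m) 2 (sphereMeasure m)} (hφ : Tendsto (dilateLp hf.1) atTop (𝓝 φ)) {b : E m}
    (hb : ‖b‖ < 1) : f b = ∫ η : Sph m, Cl.conj (szego b η) * φ η ∂(sphereMeasure m) := by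
  have h := tendsto_integral_mul_dilate (continuous_cauchyKernel_sph hb.ne) hf hφ
  simp only [cauchy_formula hf.1 hb (radius_mem _)] at h
  simp only [conj_szego_of_norm_eq_one b (norm_coe_sph _)]
  exact tendsto_nhds_unique (tendsto_apply_radius hf hb) h

/-! ### Lebesgue points and nontangential limits (Fatou's theorem). -/

/-- The spherical cap with center `η` and radius `r`. -/
def cap (η : Sph m) (r : ℝ) : Set (Sph m) := {ζ | ‖(ζ : E m) - η‖ ≤ r}

theorem measurableSet_cap (η : Sph m) (r : ℝ) : MeasurableSet (cap η r) :=
  (isClosed_le (f := fun ζ : Sph m => ‖(ζ : E m) - η‖) (by fun_prop)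
    continuous_const).measurableSet

/-- The Poisson kernel at (1 - r) η has integral 1 and is at least r (2r)^{-(m+1)} on the cap. This
yields the cap estimate without computing surface area. -/
theorem measureReal_cap_le (η : Sph m) {r : ℝ} (hr : r ∈ Ioo (0 : ℝ) 1) :
    (sphereMeasure m).real (cap η r) ≤ 2 ^ (m + 1) * r ^ m := by
  have hr0 := hr.1
  have hx : ‖(1 - r) • (η : E m)‖ < 1 := norm_smul_sph_lt ⟨by linarith [hr.2], by linarith⟩ η
  have hc := continuous_poisson hx
  have h1 : ∫ ζ in cap η r, (2 ^ (m + 1) * r ^ m)⁻¹ ∂(sphereMeasure m) ≤ 1 := by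
    refine le_of_le_of_eq ?_ (integral_poisson hx)
    refine (setIntegral_mono_on (integrable_const _).integrableOn
      (integrable_sph hc).integrableOn (measurableSet_cap η r) ?_).trans
      (setIntegral_le_integral (integrable_sph hc)
        (Eventually.of_forall fun ζ => poisson_nonneg hx _))
    intro ζ hζ
    have hd : ‖(ζ : E m) - (1 - r) • (η : E m)‖ ≤ 2 * r := by
      have : (ζ : E m) - (1 - r) • (η : E m) = ((ζ : E m) - η) + r • (η : E m) := by
        rw [sub_smul, one_smul]; abel
      rw [this]
      refine (norm_add_le _ _).trans ?_
      rw [norm_smul_sph hr0.le]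
      have : ‖(ζ : E m) - η‖ ≤ r := hζ
      linarith
    have hpos : 0 < ‖(ζ : E m) - (1 - r) • (η : E m)‖ := norm_pos_iff.2 (sub_ne_zero_of_sph hx ζ)
    rw [poisson, norm_smul_sph (by linarith [hr.2])]
    have h2 : r ≤ 1 - (1 - r) ^ 2 := by nlinarith [hr.2]
    have h3 : 0 ≤ 1 - (1 - r) ^ 2 := hr0.le.trans h2
    calc (2 ^ (m + 1) * r ^ m)⁻¹ = r * ((2 * r) ^ (m + 1))⁻¹ := by
          rw [mul_pow, pow_succ r]
          field_simp
      _ ≤ _ := by gcongr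
  rw [integral_const, smul_eq_mul, measureReal_restrict_apply_univ] at h1
  rwa [← div_eq_mul_inv, div_le_one (by positivity)] at h1

/-- `η` is a Lebesgue point of `φ`, quantitatively. -/
def IsLebesguePoint (φ : Sph m → Cl m) (η : Sph m) : Prop :=
  ∀ ε > 0, ∃ δ > 0, ∀ r ∈ Ioc (0 : ℝ) δ, ∫ ζ in cap η r, ‖φ ζ - φ η‖ ∂(sphereMeasure m) ≤ ε * r ^ m

/-- The measure is pushed forward to the ambient Euclidean space, where Besicovitch differentiation
holds; closed balls pull back to caps. Averages become r^m-bounds through the upper estimate of the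
cap measure. -/
theorem ae_isLebesguePoint {φ : Sph m → Cl m} (hφ : Integrable φ (sphereMeasure m)) :
    ∀ᵐ η ∂(sphereMeasure m), IsLebesguePoint φ η := by
  let μ : Measure (E m) := Measure.map Subtype.val (sphereMeasure m)
  have hemb : MeasurableEmbedding (Subtype.val : Sph m → E m) :=
    MeasurableEmbedding.subtype_coe Metric.isClosed_sphere.measurableSet
  have : IsProbabilityMeasure μ := Measure.isProbabilityMeasure_map hemb.measurable.aemeasurable
  let ψ : E m → Cl m := Function.extend Subtype.val φ 0
  have hψ : ∀ η : Sph m, ψ η = φ η := fun η => Subtype.val_injective.extend_apply φ 0 η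
  have hint : Integrable ψ μ := by
    rw [hemb.integrable_map_iff]
    exact hφ.congr (Eventually.of_forall fun η => (hψ η).symm)
  have hae := ae_of_ae_map hemb.measurable.aemeasurable
    ((Besicovitch.vitaliFamily μ).ae_tendsto_average_norm_sub hint.locallyIntegrable)
  filter_upwards [hae] with η hη ε hε
  have h1 := hη.comp (Besicovitch.tendsto_filterAt μ (η : E m))
  have hε' : 0 < ε / 2 ^ (m + 1) := by positivity
  have h2 := (h1.eventually_le_const hε').and (Ioo_mem_nhdsGT (zero_lt_one' ℝ))
  obtain ⟨δ, hδ, hδ2⟩ := (mem_nhdsGT_iff_exists_Ioc_subset (a := (0 : ℝ))).1 h2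
  refine ⟨δ, hδ, fun r hr => ?_⟩
  obtain ⟨h3, h4⟩ := hδ2 hr
  simp only [Function.comp_apply] at h3
  have hpre : (Subtype.val : Sph m → E m) ⁻¹' Metric.closedBall (η : E m) r = cap η r := by
    ext ζ
    rw [mem_preimage, Metric.mem_closedBall, dist_eq_norm]
    rfl
  have h5 := measure_smul_setAverage (μ := μ) (s := Metric.closedBall (η : E m) r)
    (fun y => ‖ψ y - ψ η‖) (measure_ne_top _ _)
  rw [hemb.setIntegral_map, hpre, Measure.real, hemb.map_apply, hpre, ← Measure.real] at h5
  simp only [hψ] at h5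
  rw [← h5, smul_eq_mul]
  calc (sphereMeasure m).real (cap η r) * _
      ≤ (2 ^ (m + 1) * r ^ m) * (ε / 2 ^ (m + 1)) := by
        refine mul_le_mul (measureReal_cap_le η h4) ?_ ?_ (by have := h4.1; positivity)
        · simpa only [hψ] using h3
        · rw [average_eq]
          exact smul_nonneg (by positivity) (integral_nonneg fun _ => norm_nonneg _)
    _ = ε * r ^ m := by field_simp

/-- A dyadic majorant for kernels with the size of the Poisson kernel. -/
theorem le_dyadic_sum {P t d K δ : ℝ} {n : ℕ} (ht : 0 < t) (hδ : 0 < δ) (hK : 2 ≤ K)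
    (h1 : P * t ^ m ≤ 2) (h2 : P * d ^ (m + 1) ≤ K * t) (hn : δ ≤ 2 ^ (n + 1) * t) :
    P ≤ (∑ k ∈ Finset.range (n + 1), if d ≤ 2 ^ k * t then
        K * 2 ^ (m + 1) * (2 ^ (k * (m + 1)) * t ^ m)⁻¹ else 0)
      + K * 2 ^ (m + 1) * (δ ^ (m + 1))⁻¹ * t := by
  have hK0 : 0 < K := by linarith
  have hnn : ∀ k ∈ Finset.range (n + 1), 0 ≤ if d ≤ 2 ^ k * t then
        K * 2 ^ (m + 1) * (2 ^ (k * (m + 1)) * t ^ m)⁻¹ else 0 := by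
    intro k _
    split_ifs <;> positivity
  have hlast : 0 ≤ K * 2 ^ (m + 1) * (δ ^ (m + 1))⁻¹ * t := by positivity
  by_cases hdn : d ≤ 2 ^ n * t
  · have hex : ∃ k, d ≤ 2 ^ k * t := ⟨n, hdn⟩
    classical
    -- With k the least scale whose cap contains the point, one term of the sum already dominates P:
    -- the bound `h1` serves k = 0, and `h2` with d > 2^{k-1} t serves k > 0.
    set k := Nat.find hex with hk
    have hkd : d ≤ 2 ^ k * t := Nat.find_spec hex
    have hkn : k ≤ n := Nat.find_min' hex hdn
    have hsingle := Finset.single_le_sum hnn (Finset.mem_range.2 (Nat.lt_succ_of_le hkn))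
    rw [if_pos hkd] at hsingle
    refine le_trans ?_ (le_add_of_le_of_nonneg hsingle hlast)
    rw [← div_eq_mul_inv, le_div_iff₀ (by positivity)]
    rcases Nat.eq_zero_or_pos k with h0 | hpos
    · rw [h0, zero_mul, pow_zero, one_mul]
      have : (1 : ℝ) ≤ 2 ^ (m + 1) := one_le_pow₀ one_le_two
      nlinarith
    · obtain ⟨j, hj⟩ := Nat.exists_eq_succ_of_ne_zero hpos.ne'
      have hjd : 2 ^ j * t < d := not_le.1 (Nat.find_min hex (by omega))
      rcases le_or_gt P 0 with hP | hP
      · exact (mul_nonpos_of_nonpos_of_nonneg hP (by positivity)).trans (by positivity)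
      · have h3 : P * (2 ^ j * t) ^ (m + 1) ≤ K * t :=
          (mul_le_mul_of_nonneg_left (pow_le_pow_left₀ (by positivity) hjd.le _) hP.le).trans h2
        have h4 : P * (2 ^ (k * (m + 1)) * t ^ m) * t
            = 2 ^ (m + 1) * (P * (2 ^ j * t) ^ (m + 1)) := by
          rw [hj, Nat.succ_eq_add_one, pow_mul, mul_pow, pow_succ 2 j, mul_pow, pow_succ t]
          ring
        have h5 : P * (2 ^ (k * (m + 1)) * t ^ m) * t ≤ (K * 2 ^ (m + 1)) * t := by
          rw [h4, mul_right_comm, mul_comm _ (2 ^ (m + 1) : ℝ)]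
          exact mul_le_mul_of_nonneg_left h3 (by positivity)
        exact le_of_mul_le_mul_right h5 ht
  · refine le_trans ?_ (le_add_of_nonneg_left (Finset.sum_nonneg hnn))
    rw [not_le] at hdn
    rcases le_or_gt P 0 with hP | hP
    · exact hP.trans hlast
    · have hδd : δ ≤ 2 * d := by
        rw [pow_succ] at hn
        linarith
      have h3 : P * (δ / 2) ^ (m + 1) ≤ K * t :=
        (mul_le_mul_of_nonneg_left (pow_le_pow_left₀ (by positivity) (by linarith) _) hP.le).trans h2
      rw [div_pow, ← mul_div_assoc, div_le_iff₀ (by positivity)] at h3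
      have : K * 2 ^ (m + 1) * (δ ^ (m + 1))⁻¹ * t = (K * t * 2 ^ (m + 1)) / δ ^ (m + 1) := by
        field_simp
      rw [this, le_div_iff₀ (by positivity)]
      exact h3

/-- In the approach region ‖x - η‖ is at most α ‖ζ - x‖, so ‖ζ - η‖ is at most (1 + α) ‖ζ - x‖. This
is where the aperture enters. -/
theorem poisson_le_of_mem_approachRegion {α : ℝ} (hα : 1 < α) {η ζ : Sph m} {x : E m}
    (hx : x ∈ approachRegion α (η : E m)) :
    poisson x (ζ : E m) * (1 - ‖x‖) ^ m ≤ 2 ∧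
    poisson x (ζ : E m) * ‖(ζ : E m) - η‖ ^ (m + 1)
      ≤ (2 * (1 + α) ^ (m + 1)) * (1 - ‖x‖) := by
  obtain ⟨hx1, hx2⟩ := hx
  have ht : 0 < 1 - ‖x‖ := by linarith
  have hd : 1 - ‖x‖ ≤ ‖(ζ : E m) - x‖ := by
    have := norm_sub_norm_le (ζ : E m) x
    rwa [norm_coe_sph] at this
  have hpos : 0 < ‖(ζ : E m) - x‖ := ht.trans_le hd
  have hnum : 1 - ‖x‖ ^ 2 ≤ 2 * (1 - ‖x‖) := by nlinarith [sq_nonneg (1 - ‖x‖)]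
  have hnum0 : 0 ≤ 1 - ‖x‖ ^ 2 := by nlinarith [norm_nonneg x]
  constructor
  · rw [poisson, ← div_eq_mul_inv, div_mul_eq_mul_div, div_le_iff₀ (by positivity)]
    calc (1 - ‖x‖ ^ 2) * (1 - ‖x‖) ^ m ≤ (2 * (1 - ‖x‖)) * (1 - ‖x‖) ^ m := by gcongr
      _ = 2 * (1 - ‖x‖) ^ (m + 1) := by ring
      _ ≤ _ := by gcongr
  · have hζη : ‖(ζ : E m) - η‖ ≤ (1 + α) * ‖(ζ : E m) - x‖ := by
      have : ‖(ζ : E m) - η‖ ≤ ‖(ζ : E m) - x‖ + ‖x - η‖ := by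
        rw [← sub_add_sub_cancel (ζ : E m) x η]
        exact norm_add_le _ _
      nlinarith
    rw [poisson, ← div_eq_mul_inv, div_mul_eq_mul_div, div_le_iff₀ (by positivity)]
    calc (1 - ‖x‖ ^ 2) * ‖(ζ : E m) - η‖ ^ (m + 1)
        ≤ (2 * (1 - ‖x‖)) * ((1 + α) * ‖(ζ : E m) - x‖) ^ (m + 1) := by gcongr
      _ = _ := by rw [mul_pow]; ring

theorem integrable_poisson_mul {x : E m} (hx : ‖x‖ < 1) {w : Sph m → ℝ}
    (hw : Integrable w (sphereMeasure m)) :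
    Integrable (fun ζ : Sph m => poisson x (ζ : E m) * w ζ) (sphereMeasure m) := by
  have hPc := continuous_poisson hx
  obtain ⟨C, hC⟩ := isCompact_univ.exists_bound_of_continuousOn hPc.continuousOn
  exact hw.bdd_mul (c := C) hPc.aestronglyMeasurable
    (Eventually.of_forall fun ζ => hC ζ (mem_univ _))

theorem integrable_poisson_smul {x : E m} (hx : ‖x‖ < 1) {ψ : Sph m → Cl m}
    (hψ : Integrable ψ (sphereMeasure m)) :
    Integrable (fun ζ : Sph m => poisson x (ζ : E m) • ψ ζ) (sphereMeasure m) := by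
  have hPc := continuous_poisson hx
  obtain ⟨C, hC⟩ := isCompact_univ.exists_bound_of_continuousOn hPc.continuousOn
  exact hψ.bdd_smul C hPc.aestronglyMeasurable (Eventually.of_forall fun ζ => hC ζ (mem_univ _))

/-- At scale k the kernel bound and the Lebesgue point bound multiply to A ε 2^{-k}; the geometric
series sums to at most 2 A ε, and the remaining term is proportional to t. -/
theorem integral_le_of_dyadic_majorant {w P : Sph m → ℝ} (hw : Integrable w (sphereMeasure m))
    (hw0 : ∀ ζ, 0 ≤ w ζ) (hPw : Integrable (fun ζ => P ζ * w ζ) (sphereMeasure m)) {η : Sph m}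
    {t δ ε A : ℝ} {n : ℕ} (ht : 0 < t) (hA : 0 < A) (hε : 0 < ε) (hn : 2 ^ n * t ≤ δ)
    (hδw : ∀ r ∈ Ioc (0 : ℝ) δ, ∫ ζ in cap η r, w ζ ∂(sphereMeasure m) ≤ ε * r ^ m)
    (hP : ∀ ζ : Sph m, P ζ ≤ (∑ k ∈ Finset.range (n + 1), if ‖(ζ : E m) - η‖ ≤ 2 ^ k * t then
        A * (2 ^ (k * (m + 1)) * t ^ m)⁻¹ else 0) + A * (δ ^ (m + 1))⁻¹ * t) :
    ∫ ζ, P ζ * w ζ ∂(sphereMeasure m)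
      ≤ A * ε * 2 + A * (δ ^ (m + 1))⁻¹ * t * ∫ ζ, w ζ ∂(sphereMeasure m) := by
  have hmaj : ∀ ζ : Sph m, P ζ * w ζ ≤
      (∑ k ∈ Finset.range (n + 1), (cap η (2 ^ k * t)).indicator
        (fun ζ => A * (2 ^ (k * (m + 1)) * t ^ m)⁻¹ * w ζ) ζ)
      + A * (δ ^ (m + 1))⁻¹ * t * w ζ := by
    intro ζ
    refine (mul_le_mul_of_nonneg_right (hP ζ) (hw0 ζ)).trans_eq ?_
    rw [add_mul, Finset.sum_mul]
    congr 1
    refine Finset.sum_congr rfl fun k _ => ?_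
    by_cases hk : ‖(ζ : E m) - η‖ ≤ 2 ^ k * t
    · rw [if_pos hk, indicator_of_mem (show ζ ∈ cap η (2 ^ k * t) from hk)]
    · rw [if_neg hk, indicator_of_notMem (show ζ ∉ cap η (2 ^ k * t) from hk), zero_mul]
  have hint : ∀ k ∈ Finset.range (n + 1), Integrable (fun ζ => (cap η (2 ^ k * t)).indicator
        (fun ζ => A * (2 ^ (k * (m + 1)) * t ^ m)⁻¹ * w ζ) ζ) (sphereMeasure m) := fun k _ =>
    (hw.const_mul _).indicator (measurableSet_cap η _)
  have hint1 := integrable_finsetSum _ hint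
  have hint2 := hw.const_mul (A * (δ ^ (m + 1))⁻¹ * t)
  refine (integral_mono hPw (hint1.add hint2) hmaj).trans ?_
  rw [integral_add' hint1 hint2, integral_finsetSum _ hint, integral_const_mul]
  refine add_le_add_left ?_ _
  have hgeom : ∑ k ∈ Finset.range (n + 1), A * ε * (1 / 2 : ℝ) ^ k ≤ A * ε * 2 := by
    rw [← Finset.mul_sum]
    exact mul_le_mul_of_nonneg_left (sum_geometric_two_le _) (by positivity)
  refine (Finset.sum_le_sum fun k hk => ?_).trans hgeom
  rw [integral_indicator (measurableSet_cap η _), integral_const_mul]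
  have hkn : k ≤ n := Nat.lt_succ_iff.1 (Finset.mem_range.1 hk)
  have hkt : 2 ^ k * t ∈ Ioc 0 δ :=
    ⟨by positivity, (mul_le_mul_of_nonneg_right (pow_le_pow_right₀ one_le_two hkn) ht.le).trans hn⟩
  calc A * (2 ^ (k * (m + 1)) * t ^ m)⁻¹ * ∫ ζ in cap η (2 ^ k * t), w ζ ∂(sphereMeasure m)
      ≤ A * (2 ^ (k * (m + 1)) * t ^ m)⁻¹ * (ε * (2 ^ k * t) ^ m) :=
        mul_le_mul_of_nonneg_left (hδw _ hkt) (by positivity)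
    _ = A * ε * (1 / 2) ^ k := by
        rw [mul_pow, pow_mul, pow_succ ((2 : ℝ) ^ k), one_div, inv_pow]
        field_simp

theorem dist_poisson_integral_le {φ : Sph m → Cl m} (hφ : Integrable φ (sphereMeasure m)) (c : Cl m)
    {x : E m} (hx : ‖x‖ < 1) :
    dist (∫ ζ : Sph m, poisson x (ζ : E m) • φ ζ ∂(sphereMeasure m)) c
      ≤ ∫ ζ : Sph m, poisson x (ζ : E m) * ‖φ ζ - c‖ ∂(sphereMeasure m) := by
  have h1 : c = ∫ ζ : Sph m, poisson x (ζ : E m) • c ∂(sphereMeasure m) := by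
    rw [integral_smul_const, integral_poisson hx, one_smul]
  rw [dist_eq_norm]
  conv_lhs => rw [h1, ← integral_sub (integrable_poisson_smul hx hφ)
    (integrable_poisson_smul hx (integrable_const _))]
  refine (norm_integral_le_integral_norm _).trans_eq ?_
  refine integral_congr_ae (Eventually.of_forall fun ζ => ?_)
  simp only [← smul_sub, norm_smul, Real.norm_of_nonneg (poisson_nonneg hx _)]

theorem tendsto_poisson_integral {φ : Sph m → Cl m} (hφ : Integrable φ (sphereMeasure m))
    {η : Sph m} (hη : IsLebesguePoint φ η) :
    HasNontangentialLimit (fun x => ∫ ζ : Sph m, poisson x (ζ : E m) • φ ζ ∂(sphereMeasure m))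
      (η : E m) (φ η) := by
  intro α hα
  set K : ℝ := 2 * (1 + α) ^ (m + 1) with hK
  have hK2 : 2 ≤ K := by
    have : (1 : ℝ) ≤ (1 + α) ^ (m + 1) := one_le_pow₀ (by linarith)
    linarith
  have hwi : Integrable (fun ζ => ‖φ ζ - φ η‖) (sphereMeasure m) :=
    (hφ.sub (integrable_const _)).norm
  set W := ∫ ζ, ‖φ ζ - φ η‖ ∂(sphereMeasure m)
  set A := K * 2 ^ (m + 1)
  have hA0 : 0 < A := by positivity
  rw [Metric.tendsto_nhds]
  intro ε hε
  have hε'0 : 0 < ε / (4 * A) := by positivity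
  obtain ⟨δ, hδ, hδw⟩ := hη _ hε'0
  have hev : ∀ᶠ x : E m in 𝓝 (η : E m), 1 - ‖x‖ < δ ∧
      A * (δ ^ (m + 1))⁻¹ * (1 - ‖x‖) * W < ε / 2 := by
    have hc : Tendsto (fun x : E m => 1 - ‖x‖) (𝓝 (η : E m)) (𝓝 0) := by
      have : Continuous fun x : E m => 1 - ‖x‖ := by fun_prop
      simpa using this.tendsto (η : E m)
    have hc2 := (hc.const_mul (A * (δ ^ (m + 1))⁻¹)).mul_const W
    rw [mul_zero, zero_mul] at hc2
    exact (hc.eventually_lt_const hδ).and (hc2.eventually_lt_const (half_pos hε))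
  filter_upwards [nhdsWithin_le_nhds hev, self_mem_nhdsWithin] with x ⟨hx1, hx2⟩ hx
  have hxn : ‖x‖ < 1 := hx.1
  have ht0 : 0 < 1 - ‖x‖ := by linarith
  -- The largest dyadic scale not exceeding δ: caps up to it obey the Lebesgue point bound, and
  -- beyond it the kernel is of size t.
  obtain ⟨n, hn1, hn2⟩ := exists_nat_pow_near (x := δ / (1 - ‖x‖)) (y := (2 : ℝ))
    ((one_le_div ht0).2 hx1.le) one_lt_two
  rw [le_div_iff₀ ht0] at hn1
  rw [div_lt_iff₀ ht0] at hn2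
  have hbound := integral_le_of_dyadic_majorant hwi (fun _ => norm_nonneg _)
    (integrable_poisson_mul hxn hwi) ht0 hA0 hε'0 hn1 hδw fun ζ => by
      obtain ⟨p1, p2⟩ := poisson_le_of_mem_approachRegion hα (ζ := ζ) hx
      exact le_dyadic_sum ht0 hδ hK2 p1 p2 hn2.le
  have hε2 : A * (ε / (4 * A)) * 2 = ε / 2 := by
    field_simp
    norm_num
  rw [hε2] at hbound
  refine (dist_poisson_integral_le hφ _ hxn).trans_lt (hbound.trans_lt ?_)
  linarith

/-- Radial approach stays in the region of aperture 2. Nontriviality of this filter makes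
nontangential limits unique. -/
theorem nonempty_sph_nhdsWithin_approachRegion (η : Sph m) :
    (𝓝[approachRegion 2 (η : E m)] (η : E m)).NeBot := by
  have h : Tendsto (fun n => radius n • (η : E m)) atTop (𝓝[approachRegion 2 (η : E m)] η) := by
    refine tendsto_nhdsWithin_iff.2 ⟨?_, Eventually.of_forall fun n => ?_⟩
    · simpa using tendsto_radius.smul_const (η : E m)
    · have hn := radius_mem n
      have h1 : ‖radius n • (η : E m) - η‖ = 1 - radius n := by
        have : radius n • (η : E m) - η = -((1 - radius n) • (η : E m)) := by
          rw [sub_smul, one_smul]; abel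
        rw [this, norm_neg, norm_smul_sph (by linarith [hn.2])]
      refine ⟨norm_smul_sph_lt ⟨hn.1.le, hn.2⟩ η, ?_⟩
      rw [h1, norm_smul_sph hn.1.le]
      linarith [hn.2]
  exact h.neBot

theorem HasNontangentialLimit.boundaryValue_eq {f : E m → Cl m} {η : Sph m} {v : Cl m}
    (h : HasNontangentialLimit f (η : E m) v) : boundaryValue f (η : E m) = v := by
  have hex : ∃ v, HasNontangentialLimit f (η : E m) v := ⟨v, h⟩
  rw [boundaryValue, dif_pos hex]
  have := nonempty_sph_nhdsWithin_approachRegion η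
  exact tendsto_nhds_unique (hex.choose_spec 2 one_lt_two) (h 2 one_lt_two)

theorem HasNontangentialLimit.congr {f g : E m → Cl m} {η : E m} {v : Cl m}
    (h : HasNontangentialLimit f η v) (hfg : EqOn f g (unitBall m)) :
    HasNontangentialLimit g η v := fun α hα =>
  (h α hα).congr' (eventually_mem_nhdsWithin.mono fun _ hx => hfg (mem_ball_zero_iff.2 hx.1))

/-- Fatou's theorem: the functions of the Hardy space have nontangential limits almost everywhere,
equal to their `L²` boundary values. -/
theorem boundaryValue_ae_eq {f : E m → Cl m} (hf : MemHardy f)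
    {φ : Lp (Cl m) 2 (sphereMeasure m)} (hφ : Tendsto (dilateLp hf.1) atTop (𝓝 φ)) :
    (fun η : Sph m => boundaryValue f (η : E m)) =ᵐ[sphereMeasure m] φ := by
  have hi : Integrable φ (sphereMeasure m) := (Lp.memLp φ).integrable one_le_two
  filter_upwards [ae_isLebesguePoint hi] with η hη
  refine ((tendsto_poisson_integral hi hη).congr fun _ hx => ?_).boundaryValue_eq
  exact (eq_poisson_integral hf hφ (mem_ball_zero_iff.1 hx)).symm

/-! ### The Hardy space as a right Clifford module. -/

/-- The boundary function of `f` on the sphere. -/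
def bv (f : E m → Cl m) (η : Sph m) : Cl m := boundaryValue f (η : E m)

theorem hasNontangentialLimit_congr {f g : E m → Cl m} (h : EqOn f g (unitBall m)) (η : E m)
    (v : Cl m) : HasNontangentialLimit f η v ↔ HasNontangentialLimit g η v :=
  ⟨fun hf => hf.congr h, fun hg => hg.congr h.symm⟩

theorem boundaryValue_congr {f g : E m → Cl m} (h : EqOn f g (unitBall m)) (η : E m) :
    boundaryValue f η = boundaryValue g η := by
  -- The boundary value is obtained by choice, so the two predicates must be equal, not merely
  -- equivalent at one value.
  have : HasNontangentialLimit f η = HasNontangentialLimit g η :=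
    funext fun v => propext (hasNontangentialLimit_congr h η v)
  unfold boundaryValue
  rw [this]

theorem smul_sph_mem_unitBall {r : ℝ} (hr : r ∈ Ioo (0 : ℝ) 1) (η : Sph m) :
    r • (η : E m) ∈ unitBall m :=
  mem_ball_zero_iff.2 (norm_smul_sph_lt ⟨hr.1.le, hr.2⟩ η)

theorem hardyNorm_congr {f g : E m → Cl m} (h : EqOn f g (unitBall m)) :
    hardyNorm f = hardyNorm g := by
  refine iSup_congr fun r => iSup_congr fun hr => ?_
  congr 1
  exact funext fun η => h (smul_sph_mem_unitBall hr η)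

theorem hardyInner_congr {f f' g g' : E m → Cl m} (hf : EqOn f f' (unitBall m))
    (hg : EqOn g g' (unitBall m)) : hardyInner f g = hardyInner f' g' := by
  unfold hardyInner
  simp only [boundaryValue_congr hf, boundaryValue_congr hg]

theorem IsLeftMonogenicOn.differentiableAt {f : E m → Cl m}
    (hf : IsLeftMonogenicOn f (unitBall m)) {x : E m} (hx : x ∈ unitBall m) :
    DifferentiableAt ℝ f x :=
  (hf.1.differentiableOn one_ne_zero).differentiableAt (Metric.isOpen_ball.mem_nhds hx)

theorem IsLeftMonogenicOn.congr {f g : E m → Cl m} (hf : IsLeftMonogenicOn f (unitBall m))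
    (h : EqOn f g (unitBall m)) : IsLeftMonogenicOn g (unitBall m) := by
  refine ⟨hf.1.congr fun x hx => (h hx).symm, fun x hx => ?_⟩
  have : f =ᶠ[𝓝 x] g := h.eventuallyEq_of_mem (Metric.isOpen_ball.mem_nhds hx)
  rw [← hf.2 x hx]
  simp only [dirac, this.fderiv_eq]

theorem MemHardy.congr {f g : E m → Cl m} (hf : MemHardy f) (h : EqOn f g (unitBall m)) :
    MemHardy g :=
  ⟨hf.1.congr h, by rw [← hardyNorm_congr h]; exact hf.2⟩

theorem IsLeftMonogenicOn.add {f g : E m → Cl m} (hf : IsLeftMonogenicOn f (unitBall m))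
    (hg : IsLeftMonogenicOn g (unitBall m)) : IsLeftMonogenicOn (f + g) (unitBall m) := by
  refine ⟨hf.1.add hg.1, fun x hx => ?_⟩
  have h := (fderiv_add (hf.differentiableAt hx) (hg.differentiableAt hx))
  rw [dirac_eq, h]
  simp only [add_apply, mul_add, Finset.sum_add_distrib]
  rw [← dirac_eq, ← dirac_eq, hf.2 x hx, hg.2 x hx, add_zero]

theorem IsLeftMonogenicOn.mul_const {f : E m → Cl m} (hf : IsLeftMonogenicOn f (unitBall m))
    (c : Cl m) : IsLeftMonogenicOn (fun x => f x * c) (unitBall m) := by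
  refine ⟨((Cl.mulL m).flip c).contDiff.comp_contDiffOn hf.1, fun x hx => ?_⟩
  have h : HasFDerivAt (fun x => f x * c) (((Cl.mulL m).flip c).comp (fderiv ℝ f x)) x :=
    ((Cl.mulL m).flip c).hasFDerivAt.comp x (hf.differentiableAt hx).hasFDerivAt
  rw [dirac_eq, h.fderiv]
  simp only [ContinuousLinearMap.comp_apply, ContinuousLinearMap.flip_apply, Cl.mulL_apply,
    ← mul_assoc, ← Finset.sum_mul]
  rw [← dirac_eq, hf.2 x hx, zero_mul]

theorem eLpNorm_dilate_le_hardyNorm (f : E m → Cl m) {r : ℝ} (hr : r ∈ Ioo (0 : ℝ) 1) :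
    eLpNorm (fun η : Sph m => f (r • (η : E m))) 2 (sphereMeasure m) ≤ hardyNorm f :=
  le_iSup₂ (f := fun r _ => eLpNorm (fun η : Sph m => f (r • (η : E m))) 2 (sphereMeasure m)) r hr

theorem hardyNorm_add_le {f g : E m → Cl m} (hf : IsLeftMonogenicOn f (unitBall m))
    (hg : IsLeftMonogenicOn g (unitBall m)) :
    hardyNorm (f + g) ≤ hardyNorm f + hardyNorm g := by
  refine iSup₂_le fun r hr => ?_
  exact (eLpNorm_add_le (continuous_dilate hf ⟨hr.1.le, hr.2⟩).aestronglyMeasurable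
    (continuous_dilate hg ⟨hr.1.le, hr.2⟩).aestronglyMeasurable one_le_two).trans
    (add_le_add (eLpNorm_dilate_le_hardyNorm f hr) (eLpNorm_dilate_le_hardyNorm g hr))

theorem hardyNorm_mul_const_le (f : E m → Cl m) (c : Cl m) :
    hardyNorm (fun x => f x * c) ≤ ENNReal.ofReal (Cl.mulBound m * ‖c‖) * hardyNorm f := by
  refine iSup₂_le fun r hr => ?_
  refine (eLpNorm_le_mul_eLpNorm_of_ae_le_mul (Eventually.of_forall fun η => ?_) 2).trans
    (mul_le_mul_right (eLpNorm_dilate_le_hardyNorm f hr) _)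
  refine (Cl.norm_mul_le_mulBound _ _).trans_eq ?_
  ring

theorem MemHardy.add {f g : E m → Cl m} (hf : MemHardy f) (hg : MemHardy g) : MemHardy (f + g) :=
  ⟨hf.1.add hg.1, (hardyNorm_add_le hf.1 hg.1).trans_lt (ENNReal.add_lt_top.2 ⟨hf.2, hg.2⟩)⟩

theorem MemHardy.mul_const {f : E m → Cl m} (hf : MemHardy f) (c : Cl m) :
    MemHardy fun x => f x * c :=
  ⟨hf.1.mul_const c, (hardyNorm_mul_const_le f c).trans_lt
    (ENNReal.mul_lt_top ENNReal.ofReal_lt_top hf.2)⟩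

theorem MemHardy.neg {f : E m → Cl m} (hf : MemHardy f) : MemHardy (-f) := by
  refine (hf.mul_const (-1)).congr fun x _ => ?_
  simp

theorem MemHardy.sub {f g : E m → Cl m} (hf : MemHardy f) (hg : MemHardy g) :
    MemHardy (f - g) := by
  rw [sub_eq_add_neg]
  exact hf.add hg.neg

theorem hardyNorm_le_of_bound {f : E m → Cl m} {C : ℝ} (hC : ∀ x ∈ unitBall m, ‖f x‖ ≤ C) :
    hardyNorm f ≤ ENNReal.ofReal C := by
  refine iSup₂_le fun r hr => ?_
  refine (eLpNorm_le_of_ae_bound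
    (Eventually.of_forall fun η => hC _ (smul_sph_mem_unitBall hr η))).trans_eq ?_
  simp

theorem memHardy_zero : MemHardy (0 : E m → Cl m) :=
  ⟨isLeftMonogenicOn_const 0 _, (hardyNorm_le_of_bound (C := 0) (by simp)).trans_lt (by simp)⟩

theorem MemHardy.sum {ι : Type*} (s : Finset ι) {f : ι → E m → Cl m}
    (hf : ∀ i ∈ s, MemHardy (f i)) : MemHardy (∑ i ∈ s, f i) := by
  classical
  induction s using Finset.induction_on with
  | empty => simpa using memHardy_zero
  | insert i s hi ih =>
    rw [Finset.sum_insert hi]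
    exact (hf i (Finset.mem_insert_self i s)).add
      (ih fun j hj => hf j (Finset.mem_insert_of_mem hj))

/-- Continuity on the compact closed ball gives boundedness, hence a finite Hardy norm. -/
theorem memHardy_of_contDiffAt {f : E m → Cl m}
    (hf : ∀ x : E m, ‖x‖ ≤ 1 → ContDiffAt ℝ 1 f x) (hD : ∀ x ∈ unitBall m, dirac f x = 0) :
    MemHardy f := by
  refine ⟨⟨fun x hx => (hf x (mem_ball_zero_iff.1 hx).le).contDiffWithinAt, hD⟩, ?_⟩
  obtain ⟨C, hC⟩ := (isCompact_closedBall (0 : E m) 1).exists_bound_of_continuousOn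
    (f := f) fun x hx => (hf x (mem_closedBall_zero_iff.1 hx)).continuousAt.continuousWithinAt
  exact (hardyNorm_le_of_bound fun x hx => hC x (Metric.ball_subset_closedBall hx)).trans_lt
    ENNReal.ofReal_lt_top

theorem memHardy_szego {a : E m} (ha : ‖a‖ < 1) : MemHardy (szego a) :=
  memHardy_of_contDiffAt (fun _ hx => contDiffAt_szego ha hx)
    fun _ hx => dirac_szego ha (mem_ball_zero_iff.1 hx).le

theorem bv_of_continuousAt {f : E m → Cl m} {η : Sph m} (hf : ContinuousAt f (η : E m)) :
    bv f η = f η :=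
  HasNontangentialLimit.boundaryValue_eq fun _ _ => hf.tendsto.mono_left nhdsWithin_le_nhds

theorem bv_szego {a : E m} (ha : ‖a‖ < 1) (η : Sph m) : bv (szego a) η = szego a η :=
  bv_of_continuousAt (contDiffAt_szego ha (norm_coe_sph η).le).continuousAt

theorem ae_hasNontangentialLimit {f : E m → Cl m} (hf : MemHardy f) :
    ∀ᵐ η : Sph m ∂(sphereMeasure m), HasNontangentialLimit f (η : E m) (bv f η) := by
  obtain ⟨φ, hφ⟩ := exists_tendsto_dilateLp hf
  have hi : Integrable φ (sphereMeasure m) := (Lp.memLp φ).integrable one_le_two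
  filter_upwards [ae_isLebesguePoint hi] with η hη
  have h := (tendsto_poisson_integral hi hη).congr (g := f)
    fun _ hx => (eq_poisson_integral hf hφ (mem_ball_zero_iff.1 hx)).symm
  rwa [bv, h.boundaryValue_eq]

theorem memLp_bv {f : E m → Cl m} (hf : MemHardy f) : MemLp (bv f) 2 (sphereMeasure m) := by
  obtain ⟨φ, hφ⟩ := exists_tendsto_dilateLp hf
  exact (memLp_congr_ae (boundaryValue_ae_eq hf hφ)).2 (Lp.memLp φ)

theorem hardyNorm_sq {f : E m → Cl m} (hf : MemHardy f) :
    (hardyNorm f).toReal ^ 2 = ∫ η, ‖bv f η‖ ^ 2 ∂(sphereMeasure m) := by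
  obtain ⟨φ, hφ⟩ := exists_tendsto_dilateLp hf
  rw [hardyNorm_eq_of_tendsto hf hφ, ← real_inner_self_eq_norm_sq, L2.inner_def]
  refine integral_congr_ae ?_
  filter_upwards [boundaryValue_ae_eq hf hφ] with η hη
  rw [← hη, real_inner_self_eq_norm_sq, bv]

/-! ### The Clifford-valued inner product, reproducing kernel and point evaluations. -/

theorem hardyInner_eq (f g : E m → Cl m) :
    hardyInner f g = ∫ η, Cl.conj (bv g η) * bv f η ∂(sphereMeasure m) := rfl

/-- The reproducing property of the Szegő kernel. -/
theorem hardyInner_szego {f : E m → Cl m} (hf : MemHardy f) {b : E m} (hb : ‖b‖ < 1) :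
    hardyInner f (szego b) = f b := by
  obtain ⟨φ, hφ⟩ := exists_tendsto_dilateLp hf
  rw [eq_cauchy_integral hf hφ hb, hardyInner_eq]
  refine integral_congr_ae ?_
  filter_upwards [boundaryValue_ae_eq hf hφ] with η hη
  rw [← hη, bv_szego hb, bv]

theorem bv_add {f g : E m → Cl m} (hf : MemHardy f) (hg : MemHardy g) :
    bv (f + g) =ᵐ[sphereMeasure m] bv f + bv g := by
  filter_upwards [ae_hasNontangentialLimit hf, ae_hasNontangentialLimit hg] with η h1 h2
  exact HasNontangentialLimit.boundaryValue_eq fun α hα => (h1 α hα).add (h2 α hα)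

theorem bv_sub {f g : E m → Cl m} (hf : MemHardy f) (hg : MemHardy g) :
    bv (f - g) =ᵐ[sphereMeasure m] bv f - bv g := by
  filter_upwards [ae_hasNontangentialLimit hf, ae_hasNontangentialLimit hg] with η h1 h2
  exact HasNontangentialLimit.boundaryValue_eq fun α hα => (h1 α hα).sub (h2 α hα)

theorem bv_mul_const {f : E m → Cl m} (hf : MemHardy f) (c : Cl m) :
    bv (fun x => f x * c) =ᵐ[sphereMeasure m] fun η => bv f η * c := by
  filter_upwards [ae_hasNontangentialLimit hf] with η h1
  exact HasNontangentialLimit.boundaryValue_eq fun α hα => (h1 α hα).mul_const c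

theorem integrable_conj_mul {f g : E m → Cl m} (hf : MemHardy f) (hg : MemHardy g) :
    Integrable (fun η => Cl.conj (bv g η) * bv f η) (sphereMeasure m) := by
  have h := (memLp_bv hg).norm.integrable_mul (memLp_bv hf).norm
  refine Integrable.mono' (h.const_mul (Cl.mulBound m)) ?_ (Eventually.of_forall fun η => ?_)
  · exact (Cl.continuous_conj.comp_aestronglyMeasurable (memLp_bv hg).1).mul (memLp_bv hf).1
  · refine (Cl.norm_mul_le_mulBound _ _).trans_eq ?_
    rw [Cl.norm_conj, Pi.mul_apply, mul_assoc]

theorem hardyInner_add_left {f g h : E m → Cl m} (hf : MemHardy f) (hg : MemHardy g)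
    (hh : MemHardy h) : hardyInner (f + g) h = hardyInner f h + hardyInner g h := by
  rw [hardyInner_eq, hardyInner_eq, hardyInner_eq,
    ← integral_add (integrable_conj_mul hf hh) (integrable_conj_mul hg hh)]
  refine integral_congr_ae ?_
  filter_upwards [bv_add hf hg] with η hη
  rw [hη, Pi.add_apply, mul_add]

theorem hardyInner_sub_left {f g h : E m → Cl m} (hf : MemHardy f) (hg : MemHardy g)
    (hh : MemHardy h) : hardyInner (f - g) h = hardyInner f h - hardyInner g h := by
  rw [hardyInner_eq, hardyInner_eq, hardyInner_eq,
    ← integral_sub (integrable_conj_mul hf hh) (integrable_conj_mul hg hh)]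
  refine integral_congr_ae ?_
  filter_upwards [bv_sub hf hg] with η hη
  rw [hη, Pi.sub_apply, mul_sub]

theorem hardyInner_mul_const_left {f h : E m → Cl m} (hf : MemHardy f) (hh : MemHardy h)
    (c : Cl m) : hardyInner (fun x => f x * c) h = hardyInner f h * c := by
  have h1 := ((Cl.mulL m).flip c).integral_comp_comm (integrable_conj_mul hf hh)
  simp only [ContinuousLinearMap.flip_apply, Cl.mulL_apply] at h1
  rw [hardyInner_eq, hardyInner_eq, ← h1]
  refine integral_congr_ae ?_
  filter_upwards [bv_mul_const hf c] with η hη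
  rw [hη, mul_assoc]

theorem conj_hardyInner {f g : E m → Cl m} (hf : MemHardy f) (hg : MemHardy g) :
    Cl.conj (hardyInner f g) = hardyInner g f := by
  have h1 := (Cl.conjL m).integral_comp_comm (integrable_conj_mul hf hg)
  simp only [Cl.conjL_apply, Cl.conj_mul, Cl.conj_conj] at h1
  rw [hardyInner_eq, hardyInner_eq, ← h1]

theorem hardyInner_mul_const_right {f h : E m → Cl m} (hf : MemHardy f) (hh : MemHardy h)
    (c : Cl m) : hardyInner f (fun x => h x * c) = Cl.conj c * hardyInner f h := by
  rw [← conj_hardyInner (hh.mul_const c) hf, hardyInner_mul_const_left hh hf, Cl.conj_mul,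
    conj_hardyInner hh hf]

theorem hardyInner_sub_right {f g h : E m → Cl m} (hf : MemHardy f) (hg : MemHardy g)
    (hh : MemHardy h) : hardyInner h (f - g) = hardyInner h f - hardyInner h g := by
  rw [← conj_hardyInner (hf.sub hg) hh, hardyInner_sub_left hf hg hh, Cl.conj_sub,
    conj_hardyInner hf hh, conj_hardyInner hg hh]

theorem hardyInner_zero_left (h : E m → Cl m) : hardyInner 0 h = 0 := by
  have : ∀ η, bv (0 : E m → Cl m) η = 0 := fun η => bv_of_continuousAt continuousAt_const
  rw [hardyInner_eq]
  simp [this]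

theorem hardyInner_sum_left {ι : Type*} (s : Finset ι) {f : ι → E m → Cl m}
    (hf : ∀ i ∈ s, MemHardy (f i)) {h : E m → Cl m} (hh : MemHardy h) :
    hardyInner (∑ i ∈ s, f i) h = ∑ i ∈ s, hardyInner (f i) h := by
  classical
  induction s using Finset.induction_on with
  | empty => simpa using hardyInner_zero_left h
  | insert i s hi ih =>
    have h1 := fun j hj => hf j (Finset.mem_insert_of_mem hj)
    rw [Finset.sum_insert hi, Finset.sum_insert hi, hardyInner_add_left
      (hf i (Finset.mem_insert_self i s)) (MemHardy.sum s h1) hh, ih h1]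

/-- The coefficient at `e_∅` as a continuous linear map. -/
def scalarPart (m : ℕ) : Cl m →L[ℝ] ℝ :=
  LinearMap.toContinuousLinearMap
    { toFun := fun x => x.coeff ∅, map_add' := fun _ _ => rfl, map_smul' := fun _ _ => rfl }

theorem scalarPart_apply (x : Cl m) : scalarPart m x = x.coeff ∅ := rfl

theorem scalarPart_conj (x : Cl m) : scalarPart m (Cl.conj x) = scalarPart m x := by
  rw [scalarPart_apply, scalarPart_apply, Cl.coeff_conj]
  simp [Cl.sgn]

theorem scalarPart_hardyInner {f g : E m → Cl m} (hf : MemHardy f) (hg : MemHardy g) :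
    scalarPart m (hardyInner f g) = ∫ η, inner ℝ (bv g η) (bv f η) ∂(sphereMeasure m) := by
  have h1 := (scalarPart m).integral_comp_comm (integrable_conj_mul hf hg)
  simp only [scalarPart_apply, Cl.coeff_empty_conj_mul] at h1
  rw [hardyInner_eq, scalarPart_apply, ← h1]

theorem hardyNorm_sq_eq {f : E m → Cl m} (hf : MemHardy f) :
    (hardyNorm f).toReal ^ 2 = scalarPart m (hardyInner f f) := by
  rw [hardyNorm_sq hf, scalarPart_hardyInner hf hf]
  simp only [real_inner_self_eq_norm_sq]

/-- Cauchy–Schwarz up to the factor `mulBound`, which accounts for the norm of the product under the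
integral. -/
theorem norm_hardyInner_le {f g : E m → Cl m} (hf : MemHardy f) (hg : MemHardy g) :
    ‖hardyInner f g‖ ≤ Cl.mulBound m * ((hardyNorm f).toReal * (hardyNorm g).toReal) := by
  have h1 := (memLp_bv hg).norm.integrable_mul (memLp_bv hf).norm
  have hcs : ∫ η, ‖bv g η‖ * ‖bv f η‖ ∂(sphereMeasure m)
      ≤ (hardyNorm g).toReal * (hardyNorm f).toReal := by
    have h := integral_mul_norm_le_Lp_mul_Lq (p := 2) (q := 2) (μ := sphereMeasure m)
      Real.HolderConjugate.two_two
      (by simpa using memLp_bv hg) (by simpa using memLp_bv hf)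
    refine h.trans_eq ?_
    simp only [Real.rpow_two]
    rw [← hardyNorm_sq hf, ← hardyNorm_sq hg, ← Real.sqrt_eq_rpow, ← Real.sqrt_eq_rpow,
      Real.sqrt_sq ENNReal.toReal_nonneg, Real.sqrt_sq ENNReal.toReal_nonneg]
  rw [mul_comm (hardyNorm f).toReal]
  refine le_trans ?_ (mul_le_mul_of_nonneg_left hcs Cl.mulBound_nonneg)
  rw [← integral_const_mul, hardyInner_eq]
  refine norm_integral_le_of_norm_le (h1.const_mul _) (Eventually.of_forall fun η => ?_)
  refine (Cl.norm_mul_le_mulBound _ _).trans_eq ?_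
  rw [Cl.norm_conj, mul_assoc]

/-- The squared norm sees only the scalar part of the inner product, so vanishing of that part is
enough for Pythagoras. -/
theorem hardyNorm_add_sq {f g : E m → Cl m} (hf : MemHardy f) (hg : MemHardy g)
    (h : scalarPart m (hardyInner f g) = 0) :
    (hardyNorm (f + g)).toReal ^ 2 = (hardyNorm f).toReal ^ 2 + (hardyNorm g).toReal ^ 2 := by
  have h2 : scalarPart m (hardyInner g f) = 0 := by
    rw [← conj_hardyInner hf hg, scalarPart_conj, h]
  have hfg := hf.add hg
  rw [hardyNorm_sq_eq hfg, hardyNorm_sq_eq hf, hardyNorm_sq_eq hg, hardyInner_add_left hf hg hfg,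
    ← conj_hardyInner hfg hf, ← conj_hardyInner hfg hg, map_add, scalarPart_conj, scalarPart_conj,
    hardyInner_add_left hf hg hf, hardyInner_add_left hf hg hg, map_add, map_add, h, h2, add_zero,
    zero_add]

/-- On the sphere |S_b(η)| = ‖η - b‖^{-m}, and the distance from b to the sphere is at least 1 -
‖b‖. -/
theorem hardyNorm_szego_le {b : E m} (hb : ‖b‖ < 1) :
    (hardyNorm (szego b)).toReal ≤ ((1 - ‖b‖) ^ m)⁻¹ := by
  have ht : 0 < 1 - ‖b‖ := by linarith
  refine (pow_le_pow_iff_left₀ ENNReal.toReal_nonneg (by positivity) two_ne_zero).1 ?_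
  rw [hardyNorm_sq (memHardy_szego hb)]
  have hb' : ∀ η : Sph m, ‖bv (szego b) η‖ ^ 2 ≤ (((1 - ‖b‖) ^ m)⁻¹) ^ 2 := by
    intro η
    refine pow_le_pow_left₀ (norm_nonneg _) ?_ 2
    have hd : 1 - ‖b‖ ≤ ‖(η : E m) - b‖ := by
      have := norm_sub_norm_le (η : E m) b
      rwa [norm_coe_sph] at this
    have hpos : 0 < ‖(η : E m) - b‖ := ht.trans_le hd
    rw [bv_szego hb, ← Cl.norm_conj, conj_szego_of_norm_eq_one b (norm_coe_sph η), norm_mul_toCl,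
      norm_coe_sph, one_mul, cauchyKernel, norm_smul, Cl.norm_conj, norm_toCl,
      Real.norm_of_nonneg (by positivity)]
    calc (‖(η : E m) - b‖ ^ (m + 1))⁻¹ * ‖(η : E m) - b‖ = (‖(η : E m) - b‖ ^ m)⁻¹ := by
          field_simp
          ring
      _ ≤ _ := by gcongr
  refine (integral_mono_of_nonneg (Eventually.of_forall fun _ => by positivity)
    (integrable_const _) (Eventually.of_forall hb')).trans_eq ?_
  simp

theorem norm_apply_le {f : E m → Cl m} (hf : MemHardy f) {b : E m} (hb : ‖b‖ < 1) :
    ‖f b‖ ≤ Cl.mulBound m * ((hardyNorm f).toReal * ((1 - ‖b‖) ^ m)⁻¹) := by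
  rw [← hardyInner_szego hf hb]
  refine (norm_hardyInner_le hf (memHardy_szego hb)).trans ?_
  exact mul_le_mul_of_nonneg_left (mul_le_mul_of_nonneg_left (hardyNorm_szego_le hb)
    ENNReal.toReal_nonneg) Cl.mulBound_nonneg

/-- A Cauchy sequence in the Hardy space that tends to zero pointwise on a dense set tends to zero
in norm. -/
theorem tendsto_hardyNorm_zero {g : ℕ → E m → Cl m} (hg : ∀ n, MemHardy (g n))
    (hcauchy : ∀ ε > 0, ∃ N, ∀ n ≥ N, ∀ k ≥ N, (hardyNorm (g n - g k)).toReal ≤ ε)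
    {D : Set (E m)} (hD : Dense D)
    (h0 : ∀ b ∈ D, ‖b‖ < 1 → Tendsto (fun n => g n b) atTop (𝓝 0)) :
    Tendsto (fun n => hardyNorm (g n)) atTop (𝓝 0) := by
  -- Point evaluations are uniformly bounded on smaller balls, so the Cauchy property makes the
  -- convergence on D uniform there.
  have hunif : ∀ r < 1, ∀ ε > 0, ∃ N, ∀ k ≥ N, ∀ b : E m, ‖b‖ < r → ‖g k b‖ ≤ ε := by
    intro r hr ε hε
    have hM := Cl.mulBound_nonneg (m := m)
    set C := Cl.mulBound m * ((1 - r) ^ m)⁻¹ + 1 with hC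
    have hr' : 0 < 1 - r := by linarith
    have hC0 : 0 < C := by positivity
    obtain ⟨N, hN⟩ := hcauchy (ε / C) (by positivity)
    refine ⟨N, fun k hk b hb => ?_⟩
    have hDle : ∀ b ∈ D, ‖b‖ < r → ‖g k b‖ ≤ ε := by
      intro b hbD hbr
      have hb1 : ‖b‖ < 1 := hbr.trans hr
      have hl : Tendsto (fun j => ‖g k b - g j b‖) atTop (𝓝 ‖g k b - 0‖) :=
        (tendsto_const_nhds.sub (h0 b hbD hb1)).norm
      rw [sub_zero] at hl
      refine le_of_tendsto hl ?_
      filter_upwards [eventually_ge_atTop N] with j hj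
      refine (norm_apply_le ((hg k).sub (hg j)) hb1).trans ?_
      have h1 := hN k hk j hj
      have h2 : ((1 - ‖b‖) ^ m)⁻¹ ≤ ((1 - r) ^ m)⁻¹ := by
        have : 1 - r ≤ 1 - ‖b‖ := by linarith
        gcongr
      calc Cl.mulBound m * ((hardyNorm (g k - g j)).toReal * ((1 - ‖b‖) ^ m)⁻¹)
          ≤ Cl.mulBound m * ((ε / C) * ((1 - r) ^ m)⁻¹) := by gcongr
        _ = (Cl.mulBound m * ((1 - r) ^ m)⁻¹) * (ε / C) := by ring
        _ ≤ C * (ε / C) := by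
            refine mul_le_mul_of_nonneg_right ?_ (by positivity)
            rw [hC]; linarith
        _ = ε := by field_simp
    by_contra hcon
    rw [not_le] at hcon
    -- The set where the bound fails is open by continuity, so it would have to meet D.
    have hopen : IsOpen (Metric.ball (0 : E m) r ∩ (fun x => ‖g k x‖) ⁻¹' Ioi ε) :=
      (((hg k).1.1.continuousOn.mono (Metric.ball_subset_ball hr.le)).norm).isOpen_inter_preimage
        Metric.isOpen_ball isOpen_Ioi
    obtain ⟨x, hx1, hx2⟩ := hD.inter_open_nonempty _ hopen ⟨b, mem_ball_zero_iff.2 hb, hcon⟩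
    exact absurd (hDle x hx2 (mem_ball_zero_iff.1 hx1.1)) (not_le.2 hx1.2)
  rw [ENNReal.tendsto_nhds_zero]
  intro ε hε
  obtain ⟨δ, hδ0, hδ⟩ : ∃ δ : ℝ, 0 < δ ∧ ENNReal.ofReal δ + ENNReal.ofReal δ ≤ ε := by
    rcases eq_or_ne ε ∞ with rfl | hε'
    · exact ⟨1, one_pos, le_top⟩
    · have h := ENNReal.toReal_pos hε.ne' hε'
      refine ⟨ε.toReal / 2, by positivity, ?_⟩
      rw [← ENNReal.ofReal_add (by positivity) (by positivity), add_halves,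
        ENNReal.ofReal_toReal hε']
  obtain ⟨N, hN⟩ := hcauchy δ hδ0
  filter_upwards [eventually_ge_atTop N] with n hn
  refine iSup₂_le fun r hr => ?_
  obtain ⟨r', hr1, hr2⟩ := exists_between hr.2
  obtain ⟨N', hN'⟩ := hunif r' hr2 δ hδ0
  set k := max N N'
  -- For fixed r, the index k may depend on r: the difference is small by the Cauchy property
  -- uniformly in r, and g k is uniformly small on this sphere. The resulting bound does not depend
  -- on r.
  have hsplit : (fun η : Sph m => g n (r • (η : E m)))
      = (fun η : Sph m => (g n - g k) (r • (η : E m))) + fun η : Sph m => g k (r • (η : E m)) := by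
    funext η
    simp
  rw [hsplit]
  refine (eLpNorm_add_le
    (continuous_dilate ((hg n).sub (hg k)).1 ⟨hr.1.le, hr.2⟩).aestronglyMeasurable
    (continuous_dilate (hg k).1 ⟨hr.1.le, hr.2⟩).aestronglyMeasurable one_le_two).trans
    ((add_le_add ?_ ?_).trans hδ)
  · refine (eLpNorm_dilate_le_hardyNorm _ hr).trans ?_
    rw [← ENNReal.ofReal_toReal ((hg n).sub (hg k)).2.ne]
    exact ENNReal.ofReal_le_ofReal (hN n hn k (le_max_left _ _))
  · refine (eLpNorm_le_of_ae_bound (C := δ) (Eventually.of_forall fun η => ?_)).trans_eq (by simp)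
    exact hN' k (le_max_right _ _) _ (by rwa [norm_smul_sph hr.1.le])

/-! ### Components and Gram–Schmidt residuals -/

theorem hardyNorm_neg (f : E m → Cl m) : hardyNorm (-f) = hardyNorm f := by
  refine iSup_congr fun r => iSup_congr fun _ => ?_
  exact eLpNorm_neg (fun η : Sph m => f (r • (η : E m))) 2 (sphereMeasure m)

theorem hardyNorm_mul_smul_one {f : E m → Cl m} (hf : MemHardy f) {r : ℝ} (hr : 0 ≤ r) :
    (hardyNorm fun x => f x * r • (1 : Cl m)).toReal = r * (hardyNorm f).toReal := by
  rw [← pow_left_inj₀ ENNReal.toReal_nonneg (by positivity) two_ne_zero, mul_pow,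
    hardyNorm_sq_eq hf, hardyNorm_sq_eq (hf.mul_const _),
    hardyInner_mul_const_left hf (hf.mul_const _), hardyInner_mul_const_right hf hf, Cl.conj_smul,
    Cl.conj_one, mul_smul_comm, mul_one, smul_mul_assoc, one_mul, map_smul, map_smul]
  simp only [smul_eq_mul]
  ring

theorem component_eq_zero {β : E m → Cl m} (h : ¬IsUnit (hardyInner β β)) (f : E m → Cl m) :
    component β f = 0 := by
  funext x
  simp [component, Ring.inverse_non_unit _ h]

theorem MemHardy.component {β : E m → Cl m} (hβ : MemHardy β) (f : E m → Cl m) :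
    MemHardy (component β f) :=
  hβ.mul_const _

theorem hardyInner_component_left {β h : E m → Cl m} (hβ : MemHardy β) (hh : MemHardy h)
    (f : E m → Cl m) : hardyInner (component β f) h
      = hardyInner β h * (Ring.inverse (hardyInner β β) * hardyInner f β) :=
  hardyInner_mul_const_left hβ hh _

theorem hardyInner_component_self {β : E m → Cl m} (hβ : MemHardy β)
    (h : IsUnit (hardyInner β β)) (f : E m → Cl m) :
    hardyInner (component β f) β = hardyInner f β := by
  rw [hardyInner_component_left hβ hβ, Ring.mul_inverse_cancel_left _ _ h]

/-- If the square of β is not invertible the component is 0, so orthogonality to β is only required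
in the invertible case. -/
theorem hardyInner_component_right {β h : E m → Cl m} (hβ : MemHardy β) (hh : MemHardy h)
    (H : IsUnit (hardyInner β β) → hardyInner h β = 0) (f : E m → Cl m) :
    hardyInner h (component β f) = 0 := by
  by_cases hu : IsUnit (hardyInner β β)
  · exact (hardyInner_mul_const_right hh hβ _).trans (by rw [H hu, mul_zero])
  · rw [component_eq_zero hu, ← conj_hardyInner memHardy_zero hh, hardyInner_zero_left,
      Cl.conj_zero]

/-- The family `B_0, …, B_{n-1}` lies in the Hardy space, and those of its members that have an
invertible square are pairwise orthogonal. -/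
def IsOrthogonalFamily (B : ℕ → E m → Cl m) (n : ℕ) : Prop :=
  (∀ i < n, MemHardy (B i)) ∧ ∀ i < n, ∀ j < n, i ≠ j → IsUnit (hardyInner (B i) (B i)) →
    IsUnit (hardyInner (B j) (B j)) → hardyInner (B j) (B i) = 0

/-- The remainder `f - ∑_{i<n} B_i ⟨B_i, B_i⟩⁻¹ ⟨f, B_i⟩`. -/
def residual (B : ℕ → E m → Cl m) (f : E m → Cl m) (n : ℕ) : E m → Cl m :=
  f - ∑ i ∈ Finset.range n, component (B i) f

theorem gramSchmidt_eq (B : ℕ → E m → Cl m) (n : ℕ) (b : E m) :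
    gramSchmidt B n b = residual B (szego b) n := by
  funext x
  simp [gramSchmidt, residual]

theorem normalizedStep_eq (B : ℕ → E m → Cl m) (n : ℕ) (b : E m) :
    normalizedStep B n b = fun x => gramSchmidt B n b x *
      (hardyNorm (gramSchmidt B n b)).toReal⁻¹ • (1 : Cl m) := by
  funext x
  simp [normalizedStep]

section Residual

variable {B : ℕ → E m → Cl m} {f : E m → Cl m} {n : ℕ}

theorem MemHardy.residual (hf : MemHardy f) (hB : ∀ i < n, MemHardy (B i)) :
    MemHardy (residual B f n) :=
  hf.sub (MemHardy.sum _ fun i hi => (hB i (Finset.mem_range.1 hi)).component f)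

theorem hardyInner_residual (hf : MemHardy f) (hB : IsOrthogonalFamily B n) {i : ℕ} (hi : i < n)
    (hu : IsUnit (hardyInner (B i) (B i))) : hardyInner (residual B f n) (B i) = 0 := by
  have hc : ∀ j ∈ Finset.range n, MemHardy (component (B j) f) := fun j hj =>
    (hB.1 j (Finset.mem_range.1 hj)).component f
  rw [residual, hardyInner_sub_left hf (MemHardy.sum _ hc) (hB.1 i hi),
    hardyInner_sum_left _ hc (hB.1 i hi), Finset.sum_eq_single i,
    hardyInner_component_self (hB.1 i hi) hu, sub_self]
  · intro j hj hji
    have hj' := Finset.mem_range.1 hj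
    by_cases huj : IsUnit (hardyInner (B j) (B j))
    · rw [hardyInner_component_left (hB.1 j hj') (hB.1 i hi), hB.2 i hi j hj' hji.symm hu huj,
        zero_mul]
    · rw [component_eq_zero huj, hardyInner_zero_left]
  · exact fun h => absurd (Finset.mem_range.2 hi) h

theorem residual_eq_add {k : ℕ} (hnk : n ≤ k) :
    residual B f n = ∑ i ∈ Finset.Ico n k, component (B i) f + residual B f k := by
  rw [residual, residual, ← Finset.sum_range_add_sum_Ico _ hnk]
  abel

/-- The later remainder is orthogonal to every component subtracted between n and k. -/
theorem hardyNorm_residual_sq {k : ℕ} (hf : MemHardy f) (hB : IsOrthogonalFamily B k)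
    (hnk : n ≤ k) : (hardyNorm (residual B f n)).toReal ^ 2 =
      (hardyNorm (residual B f n - residual B f k)).toReal ^ 2
        + (hardyNorm (residual B f k)).toReal ^ 2 := by
  have hc : ∀ j ∈ Finset.Ico n k, MemHardy (component (B j) f) := fun j hj =>
    (hB.1 j (Finset.mem_Ico.1 hj).2).component f
  have hr := hf.residual hB.1
  rw [residual_eq_add hnk, add_sub_cancel_right]
  refine hardyNorm_add_sq (MemHardy.sum _ hc) hr ?_
  rw [hardyInner_sum_left _ hc hr, Finset.sum_eq_zero, map_zero]
  intro j hj
  have hj' := (Finset.mem_Ico.1 hj).2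
  rw [← conj_hardyInner hr (hc j hj), hardyInner_component_right (hB.1 j hj') hr
    (fun hu => hardyInner_residual hf hB hj' hu), Cl.conj_zero]

theorem hardyNorm_residual_le (hf : MemHardy f) (hB : IsOrthogonalFamily B n) :
    (hardyNorm (residual B f n)).toReal ≤ (hardyNorm f).toReal := by
  have h := hardyNorm_residual_sq hf hB (Nat.zero_le n)
  have h0 : residual B f 0 = f := by simp [residual]
  rw [h0] at h
  refine (pow_le_pow_iff_left₀ ENNReal.toReal_nonneg ENNReal.toReal_nonneg two_ne_zero).1 ?_
  rw [h]
  exact le_add_of_nonneg_left (sq_nonneg _)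

end Residual

section Step

variable {B : ℕ → E m → Cl m} {n : ℕ} {b : E m}

theorem memHardy_gramSchmidt (hB : ∀ i < n, MemHardy (B i)) (hb : ‖b‖ < 1) :
    MemHardy (gramSchmidt B n b) := by
  rw [gramSchmidt_eq]
  exact (memHardy_szego hb).residual hB

theorem memHardy_normalizedStep (hB : ∀ i < n, MemHardy (B i)) (hb : ‖b‖ < 1) :
    MemHardy (normalizedStep B n b) := by
  rw [normalizedStep_eq]
  exact (memHardy_gramSchmidt hB hb).mul_const _

/-- Only an inequality, because a step of norm 0 is normalized to 0 by the convention that the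
inverse of 0 is 0. -/
theorem hardyNorm_normalizedStep_le (hB : ∀ i < n, MemHardy (B i)) (hb : ‖b‖ < 1) :
    (hardyNorm (normalizedStep B n b)).toReal ≤ 1 := by
  rw [normalizedStep_eq, hardyNorm_mul_smul_one (memHardy_gramSchmidt hB hb)
    (inv_nonneg.2 ENNReal.toReal_nonneg)]
  exact inv_mul_le_one

theorem hardyInner_normalizedStep_left (hB : IsOrthogonalFamily B n) (hb : ‖b‖ < 1) {i : ℕ}
    (hi : i < n) (hu : IsUnit (hardyInner (B i) (B i))) :
    hardyInner (normalizedStep B n b) (B i) = 0 := by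
  rw [normalizedStep_eq,
    hardyInner_mul_const_left (memHardy_gramSchmidt hB.1 hb) (hB.1 i hi), gramSchmidt_eq,
    hardyInner_residual (memHardy_szego hb) hB hi hu, zero_mul]

/-- The subtracted components are orthogonal to g, so only the Szegő kernel contributes, and it
reproduces. This applies to remainders and to the polynomial test functions alike. -/
theorem hardyInner_gramSchmidt {g : E m → Cl m} (hg : MemHardy g) (hB : ∀ i < n, MemHardy (B i))
    (hb : ‖b‖ < 1)
    (h : ∀ i < n, IsUnit (hardyInner (B i) (B i)) → hardyInner g (B i) = 0) :
    hardyInner g (gramSchmidt B n b) = g b := by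
  have hc : ∀ j ∈ Finset.range n, MemHardy (component (B j) (szego b)) := fun j hj =>
    (hB j (Finset.mem_range.1 hj)).component _
  rw [gramSchmidt_eq, residual, hardyInner_sub_right (memHardy_szego hb) (MemHardy.sum _ hc) hg,
    hardyInner_szego hg hb, ← conj_hardyInner (MemHardy.sum _ hc) hg,
    hardyInner_sum_left _ hc hg, Finset.sum_eq_zero, Cl.conj_zero, sub_zero]
  intro i hi
  have hi' := Finset.mem_range.1 hi
  rw [← conj_hardyInner hg (hc i hi), hardyInner_component_right (hB i hi') hg (h i hi'),
    Cl.conj_zero]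

theorem hardyInner_normalizedStep {g : E m → Cl m} (hg : MemHardy g)
    (hB : ∀ i < n, MemHardy (B i)) (hb : ‖b‖ < 1)
    (h : ∀ i < n, IsUnit (hardyInner (B i) (B i)) → hardyInner g (B i) = 0) :
    hardyInner g (normalizedStep B n b)
      = (hardyNorm (gramSchmidt B n b)).toReal⁻¹ • g b := by
  rw [normalizedStep_eq, hardyInner_mul_const_right hg (memHardy_gramSchmidt hB hb),
    hardyInner_gramSchmidt hg hB hb h, Cl.conj_smul, Cl.conj_one, smul_mul_assoc, one_mul]

end Step

theorem tendsto_hardyInner {ψ : ℕ → E m → Cl m} {β g : E m → Cl m} (hψ : ∀ k, MemHardy (ψ k))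
    (hβ : MemHardy β) (hg : MemHardy g)
    (h : Tendsto (fun k => hardyNorm fun x => ψ k x - β x) atTop (𝓝 0)) :
    Tendsto (fun k => hardyInner g (ψ k)) atTop (𝓝 (hardyInner g β)) := by
  rw [tendsto_iff_norm_sub_tendsto_zero]
  have h' : Tendsto (fun k => (hardyNorm (ψ k - β)).toReal) atTop (𝓝 0) := by
    have := (ENNReal.tendsto_toReal ENNReal.zero_ne_top).comp h
    rwa [ENNReal.toReal_zero] at this
  refine squeeze_zero (fun _ => norm_nonneg _) (fun k => ?_)
    (by simpa using (h'.const_mul (hardyNorm g).toReal).const_mul (Cl.mulBound m))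
  rw [← hardyInner_sub_right (hψ k) hβ hg]
  exact norm_hardyInner_le hg ((hψ k).sub hβ)

theorem norm_lt_of_mem_freshPoints {a : ℕ → E m} {n : ℕ} {b : E m} (hb : b ∈ freshPoints a n) :
    ‖b‖ < 1 :=
  mem_ball_zero_iff.1 hb.1

theorem IsContinuation.memHardy {a : ℕ → E m} {B : ℕ → E m → Cl m} {n : ℕ} {b : E m}
    {β : E m → Cl m} (h : IsContinuation a B n b β) (hB : ∀ i < n, MemHardy (B i)) :
    MemHardy β := by
  rcases h with ⟨hb, h⟩ | ⟨_, h, _⟩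
  · exact (memHardy_normalizedStep hB (norm_lt_of_mem_freshPoints hb)).congr h.symm
  · exact h

/-- Gram–Schmidt gives the orthogonality at fresh points, and continuity of the inner product
carries it to the limits at repeated parameters. -/
theorem IsContinuation.hardyInner_eq_zero {a : ℕ → E m} {B : ℕ → E m → Cl m} {n : ℕ} {b : E m}
    {β : E m → Cl m} (h : IsContinuation a B n b β) (hB : IsOrthogonalFamily B n) {i : ℕ}
    (hi : i < n) (hu : IsUnit (hardyInner (B i) (B i))) : hardyInner (B i) β = 0 := by
  have key : ∀ s ∈ freshPoints a n, hardyInner (B i) (normalizedStep B n s) = 0 := by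
    intro s hs
    have hs' := norm_lt_of_mem_freshPoints hs
    rw [← conj_hardyInner (memHardy_normalizedStep hB.1 hs') (hB.1 i hi),
      hardyInner_normalizedStep_left hB hs' hi hu, Cl.conj_zero]
  rcases h with ⟨hb, h⟩ | ⟨_, hβ, s, hs, _, h⟩
  · rw [hardyInner_congr (fun _ _ => rfl) h, key b hb]
  · refine tendsto_nhds_unique (tendsto_hardyInner (fun k => memHardy_normalizedStep hB.1
      (norm_lt_of_mem_freshPoints (hs k))) hβ (hB.1 i hi) h) ?_
    simp only [key _ (hs _), tendsto_const_nhds]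

theorem IsTMSystem.isOrthogonalFamily {a : ℕ → E m} {B : ℕ → E m → Cl m} (h : IsTMSystem a B)
    (n : ℕ) : IsOrthogonalFamily B n := by
  induction n with
  | zero =>
    exact ⟨fun i hi => absurd hi (Nat.not_lt_zero i), fun i hi => absurd hi (Nat.not_lt_zero i)⟩
  | succ n ih =>
    have hn := (h n).memHardy ih.1
    have hmem : ∀ i < n + 1, MemHardy (B i) := fun i hi => by
      rcases (Nat.lt_succ_iff_lt_or_eq.1 hi) with hi | rfl
      · exact ih.1 i hi
      · exact hn
    refine ⟨hmem, fun i hi j hj hij hui huj => ?_⟩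
    rcases (Nat.lt_succ_iff_lt_or_eq.1 hi) with hi' | rfl
    · rcases (Nat.lt_succ_iff_lt_or_eq.1 hj) with hj' | rfl
      · exact ih.2 i hi' j hj' hij hui huj
      · rw [← conj_hardyInner (hmem i hi) hn, (h j).hardyInner_eq_zero ih hi' hui, Cl.conj_zero]
    · rcases (Nat.lt_succ_iff_lt_or_eq.1 hj) with hj' | rfl
      · exact (h i).hardyInner_eq_zero ih hj' huj
      · exact absurd rfl hij

/-! ### Monogenic functions of one complex variable -/

/-- The embedding `x + i y ↦ x + y e_l` of the complex numbers. -/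
def ofComplex (l : Fin m) : ℂ →ₐ[ℝ] Cl m := Complex.lift ⟨Cl.gen l, Cl.gen_mul_self l⟩

theorem ofComplex_apply (l : Fin m) (z : ℂ) :
    ofComplex l z = z.re • (1 : Cl m) + z.im • Cl.gen l := by
  rw [ofComplex, Complex.lift_apply, Complex.liftAux_apply, Algebra.algebraMap_eq_smul_one]

theorem ofComplex_I (l : Fin m) : ofComplex l Complex.I = Cl.gen l := by
  simp [ofComplex_apply]

theorem norm_ofComplex (l : Fin m) (z : ℂ) : ‖ofComplex l z‖ = ‖z‖ := by
  have h : Cl.conj (ofComplex l z) * ofComplex l z = ‖z‖ ^ 2 • (1 : Cl m) := by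
    have hc : Cl.conj (ofComplex l z) = ofComplex l (starRingEnd ℂ z) := by
      simp [ofComplex_apply, Cl.conj_add, Cl.conj_smul, Cl.conj_gen, Cl.conj_one]
    rw [hc, ← map_mul, ← Complex.normSq_eq_conj_mul_self, ofComplex_apply, Complex.ofReal_re,
      Complex.ofReal_im, zero_smul, add_zero, Complex.normSq_eq_norm_sq]
  have h2 := congrArg (fun x : Cl m => x.coeff ∅) h
  simp only [Cl.coeff_empty_conj_mul, real_inner_self_eq_norm_sq, Cl.coeff_smul, Cl.coeff_one,
    if_true, mul_one] at h2
  exact (pow_left_inj₀ (norm_nonneg _) (norm_nonneg _) two_ne_zero).1 h2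

/-- The complex coordinate `x_0 + i x_l`. -/
def planeCoord (l : Fin m) : E m →L[ℝ] ℂ :=
  Complex.ofRealCLM.comp (EuclideanSpace.proj 0) +
    (Complex.I • Complex.ofRealCLM).comp (EuclideanSpace.proj l.succ)

theorem planeCoord_apply (l : Fin m) (x : E m) :
    planeCoord l x = x 0 + Complex.I * x l.succ := rfl

/-- The monogenic function `q (x_0 + e_l x_l)`. -/
def planePoly (l : Fin m) (q : Polynomial ℂ) (x : E m) : Cl m :=
  ofComplex l (q.eval (planeCoord l x))

theorem hasFDerivAt_planePoly (l : Fin m) (q : Polynomial ℂ) (x : E m) :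
    HasFDerivAt (planePoly l q) ((LinearMap.toContinuousLinearMap (ofComplex l).toLinearMap).comp
      ((((ContinuousLinearMap.toSpanSingleton ℂ
        (q.derivative.eval (planeCoord l x))).restrictScalars ℝ)).comp (planeCoord l))) x := by
  have h1 : HasFDerivAt (fun z => q.eval z) ((ContinuousLinearMap.toSpanSingleton ℂ
        (q.derivative.eval (planeCoord l x))).restrictScalars ℝ) (planeCoord l x) :=
    (q.hasDerivAt (planeCoord l x)).hasFDerivAt.restrictScalars ℝ
  exact (LinearMap.toContinuousLinearMap (ofComplex l).toLinearMap).hasFDerivAt.comp x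
    (h1.comp x (planeCoord l).hasFDerivAt)

/-- Only ∂_0 and ∂_l act. They give q' and e_l q', and e_l e_l = -1 makes the two contributions
cancel: these are the Cauchy–Riemann equations in the plane of 1 and e_l. -/
theorem dirac_planePoly (l : Fin m) (q : Polynomial ℂ) (x : E m) :
    dirac (planePoly l q) x = 0 := by
  rw [dirac_eq, (hasFDerivAt_planePoly l q x).fderiv, Fin.sum_univ_succ, Finset.sum_eq_single l]
  · simp only [ContinuousLinearMap.comp_apply, planeCoord_apply,
      toCl_basisVec_zero, toCl_basisVec_succ]
    simp only [basisVec, LinearMap.coe_toContinuousLinearMap', AlgHom.toLinearMap_apply,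
      ContinuousLinearMap.coe_restrictScalars', ContinuousLinearMap.toSpanSingleton_apply,
      PiLp.single_apply, map_mul, smul_eq_mul]
    simp [ofComplex_I, ← mul_assoc, Cl.gen_mul_self, Fin.succ_ne_zero, (Fin.succ_ne_zero l).symm]
  · intro i _ hi
    have hi' : l.succ ≠ i.succ := fun h => hi (Fin.succ_injective _ h).symm
    have : planeCoord l (basisVec i.succ) = 0 := by
      simp [planeCoord_apply, basisVec, hi',
        (Fin.succ_ne_zero i).symm]
    simp [this]
  · simp

theorem contDiff_planePoly (l : Fin m) (q : Polynomial ℂ) : ContDiff ℝ 1 (planePoly l q) := by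
  have h1 : ContDiff ℝ 1 fun z : ℂ => q.eval z :=
    (q.differentiable.contDiff (n := 1)).restrict_scalars ℝ
  exact (LinearMap.toContinuousLinearMap (ofComplex l).toLinearMap).contDiff.comp
    (h1.comp (planeCoord l).contDiff)

theorem memHardy_planePoly (l : Fin m) (q : Polynomial ℂ) : MemHardy (planePoly l q) :=
  memHardy_of_contDiffAt (fun _ _ => (contDiff_planePoly l q).contDiffAt)
    fun x _ => dirac_planePoly l q x

theorem norm_planePoly (l : Fin m) (q : Polynomial ℂ) (x : E m) :
    ‖planePoly l q x‖ = ‖q.eval (planeCoord l x)‖ :=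
  norm_ofComplex _ _

theorem norm_le_sum_planeCoord (hm : 1 ≤ m) (x : E m) :
    ‖x‖ ≤ 2 * ∑ l : Fin m, ‖planeCoord l x‖ := by
  have h0 : |x 0| ≤ ∑ l : Fin m, ‖planeCoord l x‖ := by
    have h := Finset.single_le_sum (f := fun l : Fin m => ‖planeCoord l x‖)
      (fun _ _ => norm_nonneg _) (Finset.mem_univ ⟨0, hm⟩)
    refine le_trans ?_ h
    simpa [planeCoord_apply] using Complex.abs_re_le_norm (planeCoord (⟨0, hm⟩ : Fin m) x)
  have h1 : ∑ l : Fin m, |x l.succ| ≤ ∑ l : Fin m, ‖planeCoord l x‖ := by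
    refine Finset.sum_le_sum fun l _ => ?_
    simpa [planeCoord_apply] using Complex.abs_im_le_norm (planeCoord l x)
  have h2 : ‖x‖ ≤ ∑ i, |x i| := by
    rw [EuclideanSpace.norm_eq]
    refine Real.sqrt_le_iff.2 ⟨Finset.sum_nonneg fun _ _ => abs_nonneg _, ?_⟩
    simp only [Real.norm_eq_abs]
    exact Finset.sum_sq_le_sq_sum_of_nonneg fun _ _ => abs_nonneg _
  rw [Fin.sum_univ_succ] at h2
  linarith

/-- The largest of the m plane coordinates controls the whole vector; the factor 2 m comes from
`norm_le_sum_planeCoord`. -/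
theorem exists_norm_le_planeCoord (hm : 1 ≤ m) (x : E m) :
    ∃ l : Fin m, ‖x‖ ≤ 2 * m * ‖planeCoord l x‖ := by
  have hne : (Finset.univ : Finset (Fin m)).Nonempty := ⟨⟨0, hm⟩, Finset.mem_univ _⟩
  obtain ⟨l, _, hl⟩ := Finset.exists_max_image Finset.univ (fun l => ‖planeCoord l x‖) hne
  refine ⟨l, (norm_le_sum_planeCoord hm x).trans ?_⟩
  have := Finset.sum_le_card_nsmul Finset.univ (fun l => ‖planeCoord l x‖) _ hl
  rw [Finset.card_univ, Fintype.card_fin, nsmul_eq_mul] at this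
  linarith

/-! ### Interpolation -/

/-- The polynomial `∏_{j<n} (z - z_j) ^ K`, where `z_j` are the complex coordinates of `a_j`. -/
def nodePoly (a : ℕ → E m) (l : Fin m) (n K : ℕ) : Polynomial ℂ :=
  ∏ j ∈ Finset.range n, (Polynomial.X - Polynomial.C (planeCoord l (a j))) ^ K

theorem eval_nodePoly (a : ℕ → E m) (l : Fin m) (n K : ℕ) (z : ℂ) :
    (nodePoly a l n K).eval z = ∏ j ∈ Finset.range n, (z - planeCoord l (a j)) ^ K := by
  simp [nodePoly, Polynomial.eval_prod]

theorem nodePoly_dvd (a : ℕ → E m) (l : Fin m) (n : ℕ) {K K' : ℕ} (h : K ≤ K') :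
    nodePoly a l n K ∣ nodePoly a l n K' :=
  Finset.prod_dvd_prod_of_dvd _ _ fun _ _ => pow_dvd_pow _ h

/-- A factor whose node coincides with the coordinate of b gives equality. Any other stays away from
0 near b, while the coordinate of s - b tends to 0. -/
theorem eventually_le_norm_eval_nodePoly (a : ℕ → E m) (l : Fin m) (n K : ℕ) (b : E m) :
    ∀ᶠ s in 𝓝 b, ‖planeCoord l (s - b)‖ ^ (K * n)
      ≤ ‖(nodePoly a l n K).eval (planeCoord l s)‖ := by
  have h : ∀ j, ∀ᶠ s in 𝓝 b, ‖planeCoord l (s - b)‖ ≤ ‖planeCoord l s - planeCoord l (a j)‖ := by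
    intro j
    by_cases hj : planeCoord l b = planeCoord l (a j)
    · exact Eventually.of_forall fun s => by rw [map_sub, hj]
    · have h1 : Tendsto (fun s => ‖planeCoord l (s - b)‖) (𝓝 b) (𝓝 0) := by
        have : Continuous fun s => ‖planeCoord l (s - b)‖ := by fun_prop
        simpa using this.tendsto b
      have h2 : Tendsto (fun s => ‖planeCoord l s - planeCoord l (a j)‖) (𝓝 b)
          (𝓝 ‖planeCoord l b - planeCoord l (a j)‖) := by
        have : Continuous fun s => ‖planeCoord l s - planeCoord l (a j)‖ := by fun_prop
        exact this.tendsto b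
      exact (h1.eventually_lt h2 (norm_pos_iff.2 (sub_ne_zero.2 hj))).mono fun _ => le_of_lt
  filter_upwards [(Finset.eventually_all (Finset.range n)).2 fun j _ => h j] with s hs
  rw [eval_nodePoly, norm_prod, pow_mul]
  have := Finset.prod_le_prod (s := Finset.range n)
    (f := fun _ => ‖planeCoord l (s - b)‖ ^ K)
    (g := fun j => ‖(planeCoord l s - planeCoord l (a j)) ^ K‖) (fun _ _ => by positivity)
    (fun j hj => by rw [norm_pow]; exact pow_le_pow_left₀ (norm_nonneg _) (hs j hj) K)
  rwa [Finset.prod_const, Finset.card_range] at this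

theorem planePoly_eq_zero {l : Fin m} {q : Polynomial ℂ} {b : E m}
    (h : Polynomial.X - Polynomial.C (planeCoord l b) ∣ q) : planePoly l q b = 0 := by
  rw [planePoly, Polynomial.dvd_iff_isRoot.1 h, map_zero]

/-- Near a point `b` at which the test functions vanish to a high order, they vanish faster than
the norms of the Gram–Schmidt steps. -/
theorem tendsto_planePoly_normalizedStep (hm : 1 ≤ m) {a : ℕ → E m} {B : ℕ → E m → Cl m}
    {n K : ℕ} (hB : IsOrthogonalFamily B n)
    (hK : ∀ l q, nodePoly a l n K ∣ q → ∀ i < n, hardyInner (planePoly l q) (B i) = 0)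
    {b : E m} {s : ℕ → E m} (hs : ∀ k, ‖s k‖ < 1) (hsb : Tendsto s atTop (𝓝 b)) {l : Fin m}
    {q : Polynomial ℂ} (hq : nodePoly a l n K ∣ q)
    (hq' : (Polynomial.X - Polynomial.C (planeCoord l b)) ^ (K * n + 1) ∣ q) :
    Tendsto (fun k => hardyInner (planePoly l q) (normalizedStep B n (s k))) atTop (𝓝 0) := by
  set M : ℝ := ∑ l : Fin m, Cl.mulBound m * (hardyNorm (planePoly l (nodePoly a l n K))).toReal
    with hM
  have hstep : ∀ l' q', nodePoly a l' n K ∣ q' → ∀ k,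
      ‖hardyInner (planePoly l' q') (normalizedStep B n (s k))‖
        = (hardyNorm (gramSchmidt B n (s k))).toReal⁻¹ * ‖q'.eval (planeCoord l' (s k))‖ := by
    intro l' q' h k
    rw [hardyInner_normalizedStep (memHardy_planePoly l' q') hB.1 (hs k) (fun i hi _ =>
      hK l' q' h i hi), norm_smul, Real.norm_of_nonneg (inv_nonneg.2 ENNReal.toReal_nonneg),
      norm_planePoly]
  -- The inner product of the node polynomial with a function of norm at most 1 is bounded. This
  -- limits how fast ‖T_{s_k}‖ can tend to 0.
  have hbound : ∀ l' k, (hardyNorm (gramSchmidt B n (s k))).toReal⁻¹ *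
      ‖(nodePoly a l' n K).eval (planeCoord l' (s k))‖ ≤ M := by
    intro l' k
    rw [← hstep l' _ dvd_rfl k]
    refine (norm_hardyInner_le (memHardy_planePoly _ _)
      (memHardy_normalizedStep hB.1 (hs k))).trans ?_
    refine le_trans ?_ (Finset.single_le_sum (f := fun l : Fin m => Cl.mulBound m *
      (hardyNorm (planePoly l (nodePoly a l n K))).toReal)
      (fun _ _ => mul_nonneg Cl.mulBound_nonneg ENNReal.toReal_nonneg) (Finset.mem_univ l'))
    exact mul_le_mul_of_nonneg_left (mul_le_of_le_one_right ENNReal.toReal_nonneg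
      (hardyNorm_normalizedStep_le hB.1 (hs k))) Cl.mulBound_nonneg
  obtain ⟨t, rfl⟩ := hq'
  have hzero : Tendsto (fun k => (2 * m : ℝ) ^ (K * n) * M *
      (‖planeCoord l (s k - b)‖ * ‖t.eval (planeCoord l (s k))‖ * ‖planeCoord l‖ ^ (K * n)))
      atTop (𝓝 0) := by
    have : Continuous fun x => (2 * m : ℝ) ^ (K * n) * M *
      (‖planeCoord l (x - b)‖ * ‖t.eval (planeCoord l x)‖ * ‖planeCoord l‖ ^ (K * n)) := by
      fun_prop
    simpa [Function.comp_def] using (this.tendsto b).comp hsb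
  refine squeeze_zero_norm' ?_ hzero
  filter_upwards [hsb.eventually ((eventually_all (ι := Fin m)).2 fun l' =>
    eventually_le_norm_eval_nodePoly a l' n K b)] with k hk
  rw [hstep l _ hq k, Polynomial.eval_mul, Polynomial.eval_pow, Polynomial.eval_sub,
    Polynomial.eval_X, Polynomial.eval_C, norm_mul, norm_pow, ← map_sub, pow_succ]
  obtain ⟨l', hl'⟩ := exists_norm_le_planeCoord hm (s k - b)
  -- The power K n of the zero of q at b is absorbed by the node polynomial of the plane l', hence
  -- by ‖T_{s_k}‖; the one remaining factor tends to 0.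
  have h1 : ‖planeCoord l (s k - b)‖ ^ (K * n) ≤ ‖planeCoord l‖ ^ (K * n) * ((2 * m : ℝ) ^ (K * n)
      * ‖(nodePoly a l' n K).eval (planeCoord l' (s k))‖) := by
    calc ‖planeCoord l (s k - b)‖ ^ (K * n)
        ≤ (‖planeCoord l‖ * (2 * m * ‖planeCoord l' (s k - b)‖)) ^ (K * n) :=
          pow_le_pow_left₀ (norm_nonneg _) (((planeCoord l).le_opNorm _).trans
            (mul_le_mul_of_nonneg_left hl' (norm_nonneg _))) _
      _ = ‖planeCoord l‖ ^ (K * n) * ((2 * m : ℝ) ^ (K * n)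
            * ‖planeCoord l' (s k - b)‖ ^ (K * n)) := by rw [mul_pow, mul_pow]
      _ ≤ _ := by gcongr; exact hk l'
  set r := (hardyNorm (gramSchmidt B n (s k))).toReal⁻¹ with hr
  have hr0 : 0 ≤ r := inv_nonneg.2 ENNReal.toReal_nonneg
  calc r * (‖planeCoord l (s k - b)‖ ^ (K * n) * ‖planeCoord l (s k - b)‖
          * ‖t.eval (planeCoord l (s k))‖)
      ≤ r * (‖planeCoord l‖ ^ (K * n) * ((2 * m : ℝ) ^ (K * n)
          * ‖(nodePoly a l' n K).eval (planeCoord l' (s k))‖) * ‖planeCoord l (s k - b)‖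
          * ‖t.eval (planeCoord l (s k))‖) := by gcongr
    _ = (2 * m : ℝ) ^ (K * n) * (r * ‖(nodePoly a l' n K).eval (planeCoord l' (s k))‖) *
          (‖planeCoord l (s k - b)‖ * ‖t.eval (planeCoord l (s k))‖ * ‖planeCoord l‖ ^ (K * n)) := by
        ring
    _ ≤ _ := by gcongr; exact hbound l' k

/-- The functions of a Takenaka–Malmquist system are orthogonal to all test functions that vanish
to a sufficiently high order at the parameters. -/
theorem IsTMSystem.exists_hardyInner_planePoly_eq_zero (hm : 1 ≤ m) {a : ℕ → E m}
    {B : ℕ → E m → Cl m} (h : IsTMSystem a B) (n : ℕ) :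
    ∃ K, ∀ l q, nodePoly a l n K ∣ q → ∀ i < n, hardyInner (planePoly l q) (B i) = 0 := by
  induction n with
  | zero => exact ⟨0, fun _ _ _ i hi => absurd hi (Nat.not_lt_zero i)⟩
  | succ n ih =>
    obtain ⟨K, hK⟩ := ih
    have hB := h.isOrthogonalFamily n
    -- Order K at the old nodes serves the induction hypothesis, order K n + 1 at the new one the
    -- limit argument; their sum is used at all nodes.
    refine ⟨K + (K * n + 1), fun l q hq i hi => ?_⟩
    have hq1 : nodePoly a l n K ∣ q := by
      refine (nodePoly_dvd a l n (Nat.le_add_right K (K * n + 1))).trans (dvd_trans ?_ hq)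
      rw [nodePoly, nodePoly, Finset.prod_range_succ]
      exact dvd_mul_right _ _
    have hq2 : (Polynomial.X - Polynomial.C (planeCoord l (a n))) ^ (K * n + 1) ∣ q := by
      refine (pow_dvd_pow _ (Nat.le_add_left (K * n + 1) K)).trans (dvd_trans ?_ hq)
      rw [nodePoly, Finset.prod_range_succ]
      exact dvd_mul_left _ _
    rcases Nat.lt_succ_iff_lt_or_eq.1 hi with hi | rfl
    · exact hK l q hq1 i hi
    · rcases h i with ⟨hb, he⟩ | ⟨_, hβ, s, hs, hsb, he⟩
      · rw [hardyInner_congr (fun _ _ => rfl) he, hardyInner_normalizedStep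
          (memHardy_planePoly l q) hB.1 (norm_lt_of_mem_freshPoints hb)
          (fun j hj _ => hK l q hq1 j hj),
          planePoly_eq_zero ((dvd_pow_self _ (Nat.succ_ne_zero _)).trans hq2), smul_zero]
      · have hs' := fun k => norm_lt_of_mem_freshPoints (hs k)
        exact tendsto_nhds_unique (tendsto_hardyInner
          (fun k => memHardy_normalizedStep hB.1 (hs' k)) hβ (memHardy_planePoly l q) he)
          (tendsto_planePoly_normalizedStep hm hB hK hs' hsb hq1 hq2)

/-! ### Convergence of the expansion -/

/-- Left multiplication by x is injective on a finite-dimensional space, hence surjective. The right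
inverse so found is two-sided by injectivity again. -/
theorem isUnit_of_mul_eq_zero_imp {x : Cl m} (h : ∀ c, x * c = 0 → c = 0) : IsUnit x := by
  have hinj : Function.Injective (LinearMap.mulLeft ℝ x) :=
    (injective_iff_map_eq_zero _).2 fun c hc => h c hc
  obtain ⟨y, hy⟩ := LinearMap.surjective_of_injective hinj 1
  rw [LinearMap.mulLeft_apply] at hy
  have hy' : y * x = 1 := sub_eq_zero.1 (h _ (by rw [mul_sub, ← mul_assoc, hy]; simp))
  exact ⟨⟨x, y, hy, hy'⟩, rfl⟩

theorem hardyInner_eq_zero_of_hardyInner_self_eq_zero {β g : E m → Cl m} (hβ : MemHardy β)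
    (hg : MemHardy g) (h : hardyInner β β = 0) : hardyInner β g = 0 := by
  have h0 : (hardyNorm β).toReal = 0 := by
    rw [← pow_eq_zero_iff two_ne_zero, hardyNorm_sq_eq hβ, h, map_zero]
  have := norm_hardyInner_le hβ hg
  rw [h0, zero_mul, mul_zero] at this
  exact norm_le_zero_iff.1 this

/-- The square of a Hardy function is invertible as soon as one of its inner products is. -/
theorem isUnit_hardyInner_self {β g : E m → Cl m} (hβ : MemHardy β) (hg : MemHardy g)
    (h : IsUnit (hardyInner β g)) : IsUnit (hardyInner β β) := by
  refine isUnit_of_mul_eq_zero_imp fun c hc => ?_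
  -- If c is annihilated by ⟨β, β⟩, then βc has norm 0, so ⟨β, g⟩ c = 0, and invertibility of ⟨β, g⟩
  -- forces c = 0.
  have h1 : hardyInner (fun x => β x * c) (fun x => β x * c) = 0 := by
    rw [hardyInner_mul_const_left hβ (hβ.mul_const c), hardyInner_mul_const_right hβ hβ, mul_assoc,
      hc, mul_zero]
  have h2 := hardyInner_eq_zero_of_hardyInner_self_eq_zero (hβ.mul_const c) hg h1
  rw [hardyInner_mul_const_left hβ hg] at h2
  exact h.mul_right_eq_zero.1 h2

section

variable {a : ℕ → E m} {B : ℕ → E m → Cl m} {b : E m}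

/-- Different zeroth coordinates give different complex coordinates, so the value is a nonzero
complex number, and algebra maps preserve units. -/
theorem isUnit_planePoly_nodePoly (hb : ∀ j, b 0 ≠ a j 0) (l : Fin m) (n K : ℕ) :
    IsUnit (planePoly l (nodePoly a l n K) b) := by
  refine IsUnit.map (ofComplex l) (isUnit_iff_ne_zero.2 ?_)
  rw [eval_nodePoly]
  refine Finset.prod_ne_zero_iff.2 fun j _ => pow_ne_zero _ (sub_ne_zero.2 fun h => hb j ?_)
  simpa [planeCoord_apply] using congrArg Complex.re h

/-- At a generic parameter, the norm of the Gram–Schmidt step does not vanish and the normalized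
step has an invertible square. -/
theorem IsTMSystem.generic (hm : 1 ≤ m) (h : IsTMSystem a B) (hb1 : ‖b‖ < 1)
    (hb : ∀ j, b 0 ≠ a j 0) (n : ℕ) : 0 < (hardyNorm (gramSchmidt B n b)).toReal ∧
      IsUnit (hardyInner (normalizedStep B n b) (normalizedStep B n b)) := by
  have hB := h.isOrthogonalFamily n
  obtain ⟨K, hK⟩ := h.exists_hardyInner_planePoly_eq_zero hm n
  set l : Fin m := ⟨0, hm⟩
  set g := planePoly l (nodePoly a l n K)
  have hg : MemHardy g := memHardy_planePoly _ _
  have hT := memHardy_gramSchmidt hB.1 hb1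
  have hβ := memHardy_normalizedStep hB.1 hb1
  have hu : IsUnit (g b) := isUnit_planePoly_nodePoly hb l n K
  have hgB : ∀ i < n, IsUnit (hardyInner (B i) (B i)) → hardyInner g (B i) = 0 := fun i hi _ =>
    hK l _ dvd_rfl i hi
  -- If the norm were 0, Cauchy–Schwarz would give g(b) = ⟨g, T_b⟩ = 0.
  have hpos : 0 < (hardyNorm (gramSchmidt B n b)).toReal := by
    refine ENNReal.toReal_nonneg.lt_of_ne fun h0 => hu.ne_zero (norm_le_zero_iff.1 ?_)
    have := norm_hardyInner_le hg hT
    rwa [hardyInner_gramSchmidt hg hB.1 hb1 hgB, ← h0, mul_zero, mul_zero] at this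
  refine ⟨hpos, isUnit_hardyInner_self hβ hg ?_⟩
  have h1 : IsUnit (hardyInner g (normalizedStep B n b)) := by
    rw [hardyInner_normalizedStep hg hB.1 hb1 hgB]
    exact hu.smul (Units.mk0 _ (inv_pos.2 hpos).ne')
  rw [← conj_hardyInner hg hβ]
  obtain ⟨u, hu⟩ := h1
  rw [← hu]
  refine ⟨⟨Cl.conj u, Cl.conj (↑u⁻¹ : Cl m), ?_, ?_⟩, rfl⟩
  · rw [← Cl.conj_mul, Units.inv_mul, Cl.conj_one]
  · rw [← Cl.conj_mul, Units.mul_inv, Cl.conj_one]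

/-- At a generic point the remainder of the expansion is controlled by the next component. -/
theorem IsTMSystem.norm_residual_apply_le (hm : 1 ≤ m) (h : IsTMSystem a B) {f : E m → Cl m}
    (hf : MemHardy f) (hmax : MaximumSelection f a B) (hb1 : ‖b‖ < 1) (hb : ∀ j, b 0 ≠ a j 0)
    (n : ℕ) : ‖residual B f n b‖ ≤
      (hardyNorm (szego b)).toReal * Cl.mulBound m * (hardyNorm (component (B n) f)).toReal := by
  have hB := h.isOrthogonalFamily n
  have hR := hf.residual hB.1
  have hβ := memHardy_normalizedStep hB.1 hb1
  obtain ⟨hpos, hu⟩ := h.generic hm hb1 hb n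
  set β := normalizedStep B n b with hβd
  set t := (hardyNorm (gramSchmidt B n b)).toReal with ht
  have hc : ∀ j ∈ Finset.range n, MemHardy (component (B j) f) := fun j hj =>
    (hB.1 j (Finset.mem_range.1 hj)).component f
  have h1 : hardyInner (residual B f n) β = t⁻¹ • residual B f n b :=
    hardyInner_normalizedStep hR hB.1 hb1 fun i hi hui => hardyInner_residual hf hB hi hui
  -- Both sides equal ⟨f, β⟩: the left because β is orthogonal to the components subtracted from f,
  -- the right because the square of β is invertible.
  have h2 : hardyInner (residual B f n) β = hardyInner (component β f) β := by
    rw [hardyInner_component_self hβ hu, residual, hardyInner_sub_left hf (MemHardy.sum _ hc) hβ,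
      hardyInner_sum_left _ hc hβ, Finset.sum_eq_zero, sub_zero]
    intro i hi
    have hi' := Finset.mem_range.1 hi
    rw [← conj_hardyInner hβ (hc i hi), hardyInner_component_right (hB.1 i hi') hβ
      (fun hui => hardyInner_normalizedStep_left hB hb1 hi' hui), Cl.conj_zero]
  have hfresh : b ∈ freshPoints a n :=
    ⟨mem_ball_zero_iff.2 hb1, fun i _ hi => hb i (by rw [hi])⟩
  -- A generic point is fresh, so β itself competes in the maximum selection at step n.
  have h3 : (hardyNorm (component β f)).toReal ≤ (hardyNorm (component (B n) f)).toReal :=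
    ENNReal.toReal_mono (((h n).memHardy hB.1).component f).2.ne
      (hmax n b hfresh.1 β (Or.inl ⟨hfresh, fun _ _ => rfl⟩))
  have h4 : t ≤ (hardyNorm (szego b)).toReal := by
    rw [ht, gramSchmidt_eq]
    exact hardyNorm_residual_le (memHardy_szego hb1) hB
  have h5 : ‖hardyInner (residual B f n) β‖
      ≤ Cl.mulBound m * (hardyNorm (component (B n) f)).toReal := by
    rw [h2]
    refine (norm_hardyInner_le (hβ.component f) hβ).trans
      (mul_le_mul_of_nonneg_left ?_ Cl.mulBound_nonneg)
    exact (mul_le_of_le_one_right ENNReal.toReal_nonneg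
      (hardyNorm_normalizedStep_le hB.1 hb1)).trans h3
  have h6 : residual B f n b = t • hardyInner (residual B f n) β := by
    rw [h1, smul_inv_smul₀ hpos.ne']
  rw [h6, norm_smul, Real.norm_of_nonneg hpos.le, mul_assoc]
  exact mul_le_mul h4 h5 (norm_nonneg _) ENNReal.toReal_nonneg

end

theorem dense_setOf_apply_zero_ne (a : ℕ → E m) : Dense {b : E m | ∀ j, b 0 ≠ a j 0} := by
  have h1 : Dense (range fun j => (a j).ofLp 0)ᶜ := (countable_range _).dense_compl ℝ
  have hopen : IsOpenMap (EuclideanSpace.proj 0 : E m →L[ℝ] ℝ) :=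
    ContinuousLinearMap.isOpenMap _ fun y => ⟨EuclideanSpace.single 0 y, by simp⟩
  refine (h1.preimage hopen).mono fun b hb j hj => ?_
  exact (show b 0 ∉ range fun j => (a j).ofLp 0 from hb) ⟨j, hj.symm⟩

/-- By Pythagoras the squared distance of two remainders is the difference of their squared norms,
which form a decreasing sequence bounded below. -/
theorem IsTMSystem.residual_cauchy {a : ℕ → E m} {B : ℕ → E m → Cl m} (h : IsTMSystem a B)
    {f : E m → Cl m} (hf : MemHardy f) : ∀ ε > 0, ∃ N, ∀ n ≥ N, ∀ k ≥ N,
      (hardyNorm (residual B f n - residual B f k)).toReal ≤ ε := by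
  intro ε hε
  set u : ℕ → ℝ := fun n => (hardyNorm (residual B f n)).toReal ^ 2 with hu
  have key : ∀ n k, n ≤ k →
      (hardyNorm (residual B f n - residual B f k)).toReal ^ 2 = u n - u k := fun n k hnk => by
    rw [hu]
    simp only
    rw [hardyNorm_residual_sq hf (h.isOrthogonalFamily k) hnk, add_sub_cancel_right]
  have hanti : Antitone u := fun n k hnk => by
    have := key n k hnk
    nlinarith [sq_nonneg (hardyNorm (residual B f n - residual B f k)).toReal]
  have hcau : CauchySeq u :=
    (tendsto_atTop_ciInf hanti ⟨0, by rintro _ ⟨n, rfl⟩; positivity⟩).cauchySeq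
  obtain ⟨N, hN⟩ := Metric.cauchySeq_iff.1 hcau (ε ^ 2) (by positivity)
  have main : ∀ n ≥ N, ∀ k ≥ N, n ≤ k →
      (hardyNorm (residual B f n - residual B f k)).toReal ≤ ε := fun n hn k hk hnk => by
    refine (pow_le_pow_iff_left₀ ENNReal.toReal_nonneg hε.le two_ne_zero).1 ?_
    rw [key n k hnk]
    exact (le_abs_self _).trans (hN n hn k hk).le
  refine ⟨N, fun n hn k hk => ?_⟩
  rcases le_total n k with hnk | hnk
  · exact main n hn k hk hnk
  · rw [← neg_sub, hardyNorm_neg]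
    exact main k hk n hn hnk

/-- The n-th component is the difference of consecutive remainders. -/
theorem IsTMSystem.tendsto_component {a : ℕ → E m} {B : ℕ → E m → Cl m} (h : IsTMSystem a B)
    {f : E m → Cl m} (hf : MemHardy f) :
    Tendsto (fun n => (hardyNorm (component (B n) f)).toReal) atTop (𝓝 0) := by
  refine Metric.tendsto_atTop.2 fun ε hε => ?_
  obtain ⟨N, hN⟩ := h.residual_cauchy hf (ε / 2) (half_pos hε)
  refine ⟨N, fun n hn => ?_⟩
  have := hN n hn (n + 1) (hn.trans (Nat.le_succ n))
  rw [residual_eq_add (Nat.le_succ n), add_sub_cancel_right, Nat.succ_eq_add_one,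
    Nat.Ico_succ_singleton, Finset.sum_singleton] at this
  rw [dist_zero_right, Real.norm_of_nonneg ENNReal.toReal_nonneg]
  linarith

theorem IsTMSystem.tendsto_hardyNorm_residual (hm : 1 ≤ m) {a : ℕ → E m} {B : ℕ → E m → Cl m}
    (h : IsTMSystem a B) {f : E m → Cl m} (hf : MemHardy f) (hmax : MaximumSelection f a B) :
    Tendsto (fun n => hardyNorm (residual B f n)) atTop (𝓝 0) := by
  refine tendsto_hardyNorm_zero (fun n => hf.residual (h.isOrthogonalFamily n).1)
    (h.residual_cauchy hf) (dense_setOf_apply_zero_ne a) fun b hb hb1 => ?_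
  refine squeeze_zero_norm (fun n => h.norm_residual_apply_le hm hf hmax hb1 hb n) ?_
  simpa using (h.tendsto_component hf).const_mul
    ((hardyNorm (szego b)).toReal * Cl.mulBound m)

end CliffordTM

end

theorem theorem5p2 (m : ℕ) (hm : 1 ≤ m)
    (f : CliffordTM.E m → CliffordTM.Cl m) (hf : CliffordTM.MemHardy f)
    (a : ℕ → CliffordTM.E m) (B : ℕ → CliffordTM.E m → CliffordTM.Cl m)
    (hB : CliffordTM.IsTMSystem a B) (hmax : CliffordTM.MaximumSelection f a B) :
    Tendsto
      (fun N : ℕ => CliffordTM.hardyNorm fun x =>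
        (∑ n ∈ Finset.range N, CliffordTM.component (B n) f x) - f x)
      atTop (𝓝 0) := by
  refine (hB.tendsto_hardyNorm_residual hm hf hmax).congr fun N => ?_
  -- The remainder has the opposite sign, f minus the partial sum.
  rw [← CliffordTM.hardyNorm_neg]
  congr 1
  funext x
  simp [CliffordTM.residual]
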